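/- Work over $\mathbb C$ with a formal parameter $z$. Let $\mathrm{Sym}$ be the linear map from commutative polynomials in $A,B,C$ to noncommutative ones with $\mathrm{Sym}(X_1\cdots X_n)=\frac1{n!}\sum_{p\in S_n}X_{p(1)}\cdots X_{p(n)}$, extended coefficientwise to power series in $z$. Let $\rho\in\mathbb C$ and let $$\Delta(A)=1\otimes A+A\otimes1,\quad \Delta(B)=e^{zA}\otimes B+B\otimes e^{-zA},\quad \Delta(C)=e^{\rho zA}\otimes C+C\otimes e^{-\rho zA}.$$ **(I)** The extension of $\Delta$ to a continuous algebra homomorphism on noncommutative formal power series in $z$ (with coefficients in the free algebra on $A,B,C$) is coassociative; on noncommutative polynomials in $A,B,C$ (elements not involving $z$) it is invariant under the flip combined with $z\mapsto-z$; and on the generators $\Delta(X)=1\otimes X+X\otimes1+\eta(X)+O(z^2)$ with $\eta(A)=0$, $\eta(B)=zA\wedge B$, $\eta(C)=\rho zA\wedge C$, where $X\wedge Y=X\otimes Y-Y\otimes X$. **(II)** Let $a_i,b_i,c_i\in\mathbb C$ $(i=1,2,3)$ and let $F_{AB},F_{AC},F_{BC}\in\mathbb C[A,B,C][[z]]$.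 Let $U_z$ be the quotient of $\mathbb C\langle A,B,C\rangle[[z]]$ by the $z$-adically closed two-sided ideal generated by the relations $$[A,B]=\mathrm{Sym}\,F_{AB},\qquad [A,C]=\mathrm{Sym}\,F_{AC},\qquad [B,C]=\mathrm{Sym}\,F_{BC}.$$ Call $F=(F_{AB},F_{AC},F_{BC})$ a *quantization* for $(\rho;a,b,c)$ if * each of the three series has the form $\frac1z f(zA,zB,zC)$ with $f$ an odd formal power series in three commuting variables; * $F_{AB}|_{z=0}=c_1A+c_2B+c_3C$, $F_{AC}|_{z=0}=b_1A+b_2B+b_3C$, $F_{BC}|_{z=0}=a_1A+a_2B+a_3C$; these are the brackets $[A,B],[A,C],[B,C]$ of a Lie algebra $L$ with basis $A,B,C$; and $U_z/zU_z\cong U(L)$ compatibly with the generators; * the symmetrized monomials are a topological basis of $U_z$: each element is $\sum_n z^n\,\mathrm{Sym}(g_n)$ for exactly one sequence of polynomials $g_n\in\mathbb C[A,B,C]$; * $\Delta$ induces an algebra homomorphism $U_z\to U_z\,\widehat\otimes\,U_z$. Then the quantizations are exactly the following. 1. $\rho\ne\pm1$. $F$ is a quantization if and only if $$b_2=c_3=0,\quad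 b_1=-\rho a_2,\quad a_3=\rho c_1,\quad b_3=-\rho c_2,\quad a_2c_1(1+\rho)-a_1c_2=0$$ and one of the following holds. * $c_2\ne0$ and $[A,B]=c_1\frac{\sinh zA}{z}+c_2B$, $\;[A,C]=-a_2\frac{\sinh z\rho A}{z}-\rho c_2C$, $\;[B,C]=\frac{a_2c_1}{c_2}\frac{\sinh z(1+\rho)A}{z}+a_2\mathrm{Sym}[B\cosh z\rho A]+\rho c_1\mathrm{Sym}[C\cosh zA]$. * $c_2=a_2=0$ and $[A,B]=c_1\frac{\sinh zA}{z}$, $\;[A,C]=0$, $\;[B,C]=a_1\frac{\sinh z(1+\rho)A}{z(1+\rho)}+\rho c_1\mathrm{Sym}[C\cosh zA]$. * $c_2=c_1=0$, $a_2\neq0$ and $[A,B]=0$, $\;[A,C]=-a_2\frac{\sinh z\rho A}{z}$, $\;[B,C]=a_1\frac{\sinh z(1+\rho)A}{z(1+\rho)}+a_2\mathrm{Sym}[B\cosh z\rho A]$. 2. $\rho=1$. $F$ is a quantization if and only if $b_1=-a_2$, $a_3=c_1$, $b_3=-c_2$ and $[A,B]=c_1\frac{\sinh zA}{z}+c_2B+c_3C$,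 $\;[A,C]=-a_2\frac{\sinh zA}{z}+b_2B-c_2C$, $\;[B,C]=a_1\frac{\sinh2zA}{2z}+\mathrm{Sym}\{(a_2B+c_1C)\cosh zA\}$. 3. $\rho=-1$. $F$ is a quantization if and only if $b_2=c_3=0$, $b_1=a_2$, $a_3=-c_1$, $b_3=c_2$, $a_1c_2=0$ and one of the following holds. * $c_2\ne0$ and $[A,B]=c_1\frac{\sinh zA}{z}+c_2B$, $\;[A,C]=b_1\frac{\sinh zA}{z}+c_2C$, $\;[B,C]=\mathrm{Sym}\{(b_1B-c_1C)\cosh zA\}$. * $c_2=0$ and $[A,B]=c_1\frac{\sinh zA}{z}$, $\;[A,C]=b_1\frac{\sinh zA}{z}$, $\;[B,C]=a_1A+\mathrm{Sym}\{(b_1B-c_1C)\cosh zA\}$. -/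

import Mathlib

open scoped TensorProduct PowerSeries

namespace QuantumAlgebra3D

noncomputable section

/-! ### The symmetrized basis

Throughout, `z` is the variable of the formal power series, and the generators `A`, `B`, `C` have
the indices `0`, `1`, `2`. -/

/-- Ordinary (commutative) polynomials in the three letters `A, B, C`. -/
abbrev Poly : Type := MvPolynomial (Fin 3) ℂ

/-- Noncommutative polynomials in `A, B, C` (the free associative algebra). -/
abbrev Free : Type := FreeAlgebra ℂ (Fin 3)

/-- The three generators of the free algebra. -/
def gen (i : Fin 3) : Free := FreeAlgebra.ι ℂ i

/-- `Sym {X₁ ⋯ Xₙ} = (1 / n!) ∑_{p ∈ Sₙ} p (X₁ ⋯ Xₙ)` for a word in the generators. -/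
def symWord (w : List (Fin 3)) : Free :=
  ((w.length.factorial : ℂ)⁻¹) •
    ∑ p : Equiv.Perm (Fin w.length), (List.ofFn fun i => gen (w.get (p i))).prod

/-- The ordered word `A ^ (m 0) B ^ (m 1) C ^ (m 2)`. -/
def orderedWord (m : Fin 3 →₀ ℕ) : List (Fin 3) :=
  List.replicate (m 0) 0 ++ List.replicate (m 1) 1 ++ List.replicate (m 2) 2

/-- The linear operator `Sym`, from commutative to noncommutative polynomials. -/
def sym : Poly →ₗ[ℂ] Free :=
  (MvPolynomial.basisMonomials (Fin 3) ℂ).constr ℂ fun m => symWord (orderedWord m)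

/-- `Sym`, applied to the coefficient of every power of `z`. -/
def symZ (g : Poly⟦X⟧) : Free⟦X⟧ := PowerSeries.mk fun n => sym (PowerSeries.coeff n g)

/-! ### Algebras over formal power series given by generators and relations -/

section ClosedIdeal

variable {R : Type*} [Ring R]

/-- A two-sided ideal of `R⟦z⟧` is closed in the `z`-adic topology. -/
def IsZClosed (I : TwoSidedIdeal R⟦X⟧) : Prop :=
  ∀ p : R⟦X⟧, (∀ N : ℕ, ∃ q ∈ I, ∀ n < N, PowerSeries.coeff n p = PowerSeries.coeff n q) → p ∈ I

/-- The smallest `z`-adically closed two-sided ideal of `R⟦z⟧` that contains `S`. -/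
def closedIdeal (S : Set R⟦X⟧) : TwoSidedIdeal R⟦X⟧ :=
  sInf {I | S ⊆ (I : Set R⟦X⟧) ∧ IsZClosed I}

/-- The `z`-adically complete algebra `R⟦z⟧ / (closed ideal generated by S)`. -/
abbrev ClosedQuot (S : Set R⟦X⟧) : Type _ := (closedIdeal S).ringCon.Quotient

/-- The quotient map. -/
def toQuot (S : Set R⟦X⟧) : R⟦X⟧ →+* ClosedQuot S := (closedIdeal S).ringCon.mk'

end ClosedIdeal

/-- The right-hand sides of deformed commutation rules
`[A,B] = Sym AB`, `[A,C] = Sym AC`, `[B,C] = Sym BC`. -/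
@[ext] structure Rules where
  AB : Poly⟦X⟧
  AC : Poly⟦X⟧
  BC : Poly⟦X⟧

/-- The relation `[X_i, X_j] - Sym F`. -/
def relator (i j : Fin 3) (F : Poly⟦X⟧) : Free⟦X⟧ :=
  PowerSeries.C (gen i * gen j - gen j * gen i) - symZ F

/-- The three defining relations. -/
def Rules.relators (F : Rules) : Set Free⟦X⟧ :=
  {relator 0 1 F.AB, relator 0 2 F.AC, relator 1 2 F.BC}

/-- The algebra `U_z`: generated topologically over `ℂ⟦z⟧` by `A, B, C` with the given rules. -/
abbrev Rules.Uz (F : Rules) : Type := ClosedQuot F.relators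

/-- The defining relations of `U_z ⊗ U_z`: those of `U_z` in each of the two factors. -/
def Rules.relators₂ (F : Rules) : Set (Free ⊗[ℂ] Free)⟦X⟧ :=
  (PowerSeries.map
      (Algebra.TensorProduct.includeLeft : Free →ₐ[ℂ] Free ⊗[ℂ] Free).toRingHom '' F.relators) ∪
    (PowerSeries.map
      (Algebra.TensorProduct.includeRight : Free →ₐ[ℂ] Free ⊗[ℂ] Free).toRingHom '' F.relators)

/-- The completed tensor product of `U_z` with itself over `ℂ⟦z⟧`. -/
abbrev Rules.Uz₂ (F : Rules) : Type := ClosedQuot F.relators₂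

/-! ### The coproduct -/

/-- `exp (z x)`. -/
def expZ {R : Type*} [Ring R] [Algebra ℂ R] (x : R) : R⟦X⟧ :=
  PowerSeries.mk fun n => ((n.factorial : ℂ)⁻¹) • x ^ n

/-- The coproduct on generators: `Δ(A) = 1 ⊗ A + A ⊗ 1`,
`Δ(B) = exp(zA) ⊗ B + B ⊗ exp(-zA)` and `Δ(C) = exp(ρzA) ⊗ C + C ⊗ exp(-ρzA)`. -/
def coprodGen (ρ : ℂ) : Fin 3 → (Free ⊗[ℂ] Free)⟦X⟧ :=
  ![PowerSeries.C (1 ⊗ₜ gen 0 + gen 0 ⊗ₜ 1),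
    expZ (gen 0 ⊗ₜ 1) * PowerSeries.C (1 ⊗ₜ gen 1)
      + PowerSeries.C (gen 1 ⊗ₜ 1) * expZ (-(1 ⊗ₜ gen 0)),
    expZ (ρ • (gen 0 ⊗ₜ 1)) * PowerSeries.C (1 ⊗ₜ gen 2)
      + PowerSeries.C (gen 2 ⊗ₜ 1) * expZ (-(ρ • (1 ⊗ₜ gen 0)))]

/-- The coproduct as an algebra homomorphism on noncommutative polynomials in `A, B, C`. -/
def coprod (ρ : ℂ) : Free →ₐ[ℂ] (Free ⊗[ℂ] Free)⟦X⟧ := FreeAlgebra.lift ℂ (coprodGen ρ)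

/-- The coefficient of `z ^ n` in the coproduct. -/
def coprodCoeff (ρ : ℂ) (n : ℕ) : Free →ₗ[ℂ] Free ⊗[ℂ] Free where
  toFun x := PowerSeries.coeff n (coprod ρ x)
  map_add' x y := by simp
  map_smul' c x := by simp

/-- The continuous `ℂ⟦z⟧`-linear map `M⟦z⟧ → N⟦z⟧` that is `∑ zⁿ D n` on `M`. -/
def extendZ {M N : Type*} [Ring M] [Algebra ℂ M] [Ring N] [Algebra ℂ N]
    (D : ℕ → M →ₗ[ℂ] N) (p : M⟦X⟧) : N⟦X⟧ :=
  PowerSeries.mk fun n =>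
    ∑ ij ∈ Finset.HasAntidiagonal.antidiagonal n, D ij.2 (PowerSeries.coeff ij.1 p)

/-- The coproduct `Δ` on formal power series. -/
def coprodZ (ρ : ℂ) : Free⟦X⟧ → (Free ⊗[ℂ] Free)⟦X⟧ := extendZ (coprodCoeff ρ)

/-- `Δ ⊗ id`, with values in `(Free ⊗ Free) ⊗ Free`. -/
def coprodTensorId (ρ : ℂ) : (Free ⊗[ℂ] Free)⟦X⟧ → ((Free ⊗[ℂ] Free) ⊗[ℂ] Free)⟦X⟧ :=
  extendZ fun n => (coprodCoeff ρ n).rTensor Free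

/-- `id ⊗ Δ`, with values in `Free ⊗ (Free ⊗ Free)`. -/
def idTensorCoprod (ρ : ℂ) : (Free ⊗[ℂ] Free)⟦X⟧ → (Free ⊗[ℂ] (Free ⊗[ℂ] Free))⟦X⟧ :=
  extendZ fun n => (coprodCoeff ρ n).lTensor Free

/-- The identification `(Free ⊗ Free) ⊗ Free = Free ⊗ (Free ⊗ Free)`, coefficientwise. -/
def assocZ (p : ((Free ⊗[ℂ] Free) ⊗[ℂ] Free)⟦X⟧) : (Free ⊗[ℂ] (Free ⊗[ℂ] Free))⟦X⟧ :=
  PowerSeries.mk fun n => TensorProduct.assoc ℂ Free Free Free (PowerSeries.coeff n p)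

/-- Coassociativity `(Δ ⊗ id) ∘ Δ = (id ⊗ Δ) ∘ Δ`. -/
def IsCoassociative (ρ : ℂ) : Prop :=
  ∀ p : Free⟦X⟧, assocZ (coprodTensorId ρ (coprodZ ρ p)) = idTensorCoprod ρ (coprodZ ρ p)

/-- The flip of the two tensor factors combined with `z ↦ -z`. -/
def flipNeg (p : (Free ⊗[ℂ] Free)⟦X⟧) : (Free ⊗[ℂ] Free)⟦X⟧ :=
  PowerSeries.mk fun n => ((-1 : ℂ) ^ n) • TensorProduct.comm ℂ Free Free (PowerSeries.coeff n p)

/-- `X ∧ Y = X ⊗ Y - Y ⊗ X` for two generators. -/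
def wedge (i j : Fin 3) : Free ⊗[ℂ] Free := gen i ⊗ₜ gen j - gen j ⊗ₜ gen i

/-- The cocommutator, with its factor `z` removed:
`η(A) = 0`, `η(B) = z A ∧ B`, `η(C) = ρ z A ∧ C`. -/
def cocommutator (ρ : ℂ) : Fin 3 → Free ⊗[ℂ] Free := ![0, wedge 0 1, ρ • wedge 0 2]

/-! ### Quantizations -/

/-- The nine structure constants of
`[A,B] = c₁A + c₂B + c₃C`, `[A,C] = b₁A + b₂B + b₃C`, `[B,C] = a₁A + a₂B + a₃C`. -/
structure StructureConstants where
  (a₁ a₂ a₃ b₁ b₂ b₃ c₁ c₂ c₃ : ℂ)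

/-- The linear polynomial `r A + s B + t C`. -/
def linearPoly (r s t : ℂ) : Poly :=
  r • MvPolynomial.X 0 + s • MvPolynomial.X 1 + t • MvPolynomial.X 2

/-- `F = (1/z) f(zA, zB, zC)` for a power series `f` in three commuting variables that is odd,
that is, has no monomials of even total degree. -/
def IsOddAnsatz (F : Poly⟦X⟧) : Prop :=
  ∃ f : MvPowerSeries (Fin 3) ℂ,
    (∀ m : Fin 3 →₀ ℕ, Even m.degree → MvPowerSeries.coeff m f = 0) ∧
    ∀ (n : ℕ) (m : Fin 3 →₀ ℕ), MvPolynomial.coeff m (PowerSeries.coeff n F) =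
      if m.degree = n + 1 then MvPowerSeries.coeff m f else 0

/-- The commutation rules `F` define a quantum algebra with the coproduct of parameter `ρ` that
deforms the Lie algebra with structure constants `k`. -/
structure IsQuantization (ρ : ℂ) (k : StructureConstants) (F : Rules) : Prop where
  ansatz_AB : IsOddAnsatz F.AB
  ansatz_AC : IsOddAnsatz F.AC
  ansatz_BC : IsOddAnsatz F.BC
  /-- At `z = 0` the rules are those with the structure constants `k`. -/
  limit_AB : PowerSeries.coeff 0 F.AB = linearPoly k.c₁ k.c₂ k.c₃
  limit_AC : PowerSeries.coeff 0 F.AC = linearPoly k.b₁ k.b₂ k.b₃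
  limit_BC : PowerSeries.coeff 0 F.BC = linearPoly k.a₁ k.a₂ k.a₃
  /-- The constants `k` are those of a Lie algebra `L` with a basis `A, B, C`, and
  `U_z / z U_z` is the universal enveloping algebra of `L`. -/
  classical_limit : ∃ (L : Type) (_ : LieRing L) (_ : LieAlgebra ℂ L)
    (e : Module.Basis (Fin 3) ℂ L),
    ⁅e 0, e 1⁆ = k.c₁ • e 0 + k.c₂ • e 1 + k.c₃ • e 2 ∧
    ⁅e 0, e 2⁆ = k.b₁ • e 0 + k.b₂ • e 1 + k.b₃ • e 2 ∧
    ⁅e 1, e 2⁆ = k.a₁ • e 0 + k.a₂ • e 1 + k.a₃ • e 2 ∧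
    ∃ π : F.Uz →+* UniversalEnvelopingAlgebra ℂ L,
      Function.Surjective π ∧
      (∀ u, π u = 0 ↔ ∃ v, u = toQuot F.relators PowerSeries.X * v) ∧
      (∀ c : ℂ, π (toQuot F.relators (PowerSeries.C (algebraMap ℂ Free c))) =
        algebraMap ℂ (UniversalEnvelopingAlgebra ℂ L) c) ∧
      ∀ i, π (toQuot F.relators (PowerSeries.C (gen i))) = UniversalEnvelopingAlgebra.ι ℂ (e i)
  /-- The symmetrized monomials are a topological basis of `U_z` over `ℂ⟦z⟧`: every element is
  `∑ zⁿ Sym gₙ` for exactly one sequence of polynomials `gₙ`. -/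
  basis : Function.Bijective fun g : Poly⟦X⟧ => toQuot F.relators (symZ g)
  /-- The coproduct is well defined on `U_z` and an algebra homomorphism. -/
  coproduct : ∃ Δ : F.Uz →+* F.Uz₂,
    ∀ p : Free⟦X⟧, Δ (toQuot F.relators p) = toQuot F.relators₂ (coprodZ ρ p)

/-! ### The families

The entries are written with commuting letters; `Sym` is part of the meaning of `Rules`. -/

/-- The letter `A`, `B` or `C` as a commutative polynomial. -/
abbrev letter (i : Fin 3) : Poly := MvPolynomial.X i

/-- `sinh(z x) / z = ∑ z^(2k) x^(2k+1) / (2k+1)!`. -/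
def sinhDivZ (x : Poly) : Poly⟦X⟧ :=
  PowerSeries.mk fun n => if Even n then (((n + 1).factorial : ℂ)⁻¹) • x ^ (n + 1) else 0

/-- `cosh(z x) = ∑ z^(2k) x^(2k) / (2k)!`. -/
def coshZ (x : Poly) : Poly⟦X⟧ :=
  PowerSeries.mk fun n => if Even n then ((n.factorial : ℂ)⁻¹) • x ^ n else 0

local notation "𝐀" => letter 0
local notation "𝐁" => PowerSeries.C (letter 1)
local notation "𝐂" => PowerSeries.C (letter 2)

/-- The family for `ρ ≠ ±1`, `c₂ ≠ 0`. -/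
def family11 (ρ : ℂ) (k : StructureConstants) : Rules where
  AB := k.c₁ • sinhDivZ 𝐀 + k.c₂ • 𝐁
  AC := -(k.a₂ • sinhDivZ (ρ • 𝐀)) - (ρ * k.c₂) • 𝐂
  BC := (k.a₂ * k.c₁ / k.c₂) • sinhDivZ ((1 + ρ) • 𝐀)
    + k.a₂ • (𝐁 * coshZ (ρ • 𝐀)) + (ρ * k.c₁) • (𝐂 * coshZ 𝐀)

/-- The family for `ρ ≠ ±1`, `c₂ = a₂ = 0`. -/
def family12 (ρ : ℂ) (k : StructureConstants) : Rules where
  AB := k.c₁ • sinhDivZ 𝐀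
  AC := 0
  BC := (k.a₁ / (1 + ρ)) • sinhDivZ ((1 + ρ) • 𝐀) + (ρ * k.c₁) • (𝐂 * coshZ 𝐀)

/-- The family for `ρ ≠ ±1`, `c₂ = c₁ = 0`. -/
def family13 (ρ : ℂ) (k : StructureConstants) : Rules where
  AB := 0
  AC := -(k.a₂ • sinhDivZ (ρ • 𝐀))
  BC := (k.a₁ / (1 + ρ)) • sinhDivZ ((1 + ρ) • 𝐀) + k.a₂ • (𝐁 * coshZ (ρ • 𝐀))

/-- The family for `ρ = 1`. -/
def family21 (k : StructureConstants) : Rules where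
  AB := k.c₁ • sinhDivZ 𝐀 + k.c₂ • 𝐁 + k.c₃ • 𝐂
  AC := -(k.a₂ • sinhDivZ 𝐀) + k.b₂ • 𝐁 - k.c₂ • 𝐂
  BC := (k.a₁ / 2) • sinhDivZ ((2 : ℂ) • 𝐀) + (k.a₂ • 𝐁 + k.c₁ • 𝐂) * coshZ 𝐀

/-- The family for `ρ = -1`, `c₂ ≠ 0`. -/
def family31 (k : StructureConstants) : Rules where
  AB := k.c₁ • sinhDivZ 𝐀 + k.c₂ • 𝐁
  AC := k.b₁ • sinhDivZ 𝐀 + k.c₂ • 𝐂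
  BC := (k.b₁ • 𝐁 - k.c₁ • 𝐂) * coshZ 𝐀

/-- The family for `ρ = -1`, `c₂ = 0`. -/
def family32 (k : StructureConstants) : Rules where
  AB := k.c₁ • sinhDivZ 𝐀
  AC := k.b₁ • sinhDivZ 𝐀
  BC := k.a₁ • PowerSeries.C 𝐀 + (k.b₁ • 𝐁 - k.c₁ • 𝐂) * coshZ 𝐀

/-- The constraints on the structure constants for `ρ ≠ ±1`. -/
def ConstraintsGeneric (ρ : ℂ) (k : StructureConstants) : Prop :=
  k.b₂ = 0 ∧ k.c₃ = 0 ∧ k.b₁ = -ρ * k.a₂ ∧ k.a₃ = ρ * k.c₁ ∧ k.b₃ = -ρ * k.c₂ ∧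
    k.a₂ * k.c₁ * (1 + ρ) - k.a₁ * k.c₂ = 0

/-- The constraints on the structure constants for `ρ = 1`. -/
def ConstraintsOne (k : StructureConstants) : Prop :=
  k.b₁ = -k.a₂ ∧ k.a₃ = k.c₁ ∧ k.b₃ = -k.c₂

/-- The constraints on the structure constants for `ρ = -1`. -/
def ConstraintsNegOne (k : StructureConstants) : Prop :=
  k.b₂ = 0 ∧ k.c₃ = 0 ∧ k.b₁ = k.a₂ ∧ k.a₃ = -k.c₁ ∧ k.b₃ = k.c₂ ∧ k.a₁ * k.c₂ = 0

end

end QuantumAlgebra3D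

/-! All the listed cases are instances of one family, `family ρ k`, and the three systems of
constraints are instances of one system, `Constraints ρ k`. This works because sinh(tzA)/(tz) is
written as the series `shc t`, which makes sense at t = 0 and so covers 1 + ρ = 0. The
classification is `isQuantization_iff`: a quantization is the same as constants that satisfy the
constraints together with F = `family ρ k`. Matching this with the list (`cases_generic`,
`cases_one`, `cases_neg_one`) is bookkeeping. Part (I) compares continuous algebra homomorphisms on
the three generators.

Sufficiency, coproduct. The relations for [A,B] and [A,C] are twisted primitive (`relAB_twist`,
`relAC_twist`), because sinh is: sinh(x + y) = e^x sinh y + sinh x e^(-y). For [B,C] the mixed terms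
of [Δ(B), Δ(C)] are commutators with exponentials. These can be evaluated modulo the first two
relations, and they cancel exactly the failure of Sym[B cosh ρzA] and Sym[C cosh zA] to be twisted
primitive (`relBC_twist`). The symmetrized exponential `symE` is the directional derivative of exp
up to a factor z, so its rules come from exponentials over the dual numbers.

Sufficiency, basis. Symmetrized monomials span because commutators are linear at z = 0, and this
lifts z-adically (`exists_symZ`). They are independent because the relations have a representation
on polynomials in which A acts by multiplication. When c₃ = 0, the operators B and then C can be
built from values on the B^j C^l, since their commutators with A prescribe how they pass A. The
values of C are chosen recursively so that the third relation holds on the B^j C^l. A deformed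
Jacobi identity (`commutator_relBC`) makes the defect of that relation an eigenvector of ad A, so it
vanishes everywhere (`relBC_op`). If c₃ ≠ 0 then ρ = 1, and a linear change of B, C reduces to c₃ =
0. At z = 0 the operators have the letters, up to this linear change, as leading symbols. Hence Sym
g applied to 1 determines g (`Constraints.exists_faithful`).

Classical limit. The span of the generators in U_z/zU_z is closed under commutators. It serves as L,
so the Jacobi identity is automatic and no separate Poincaré–Birkhoff–Witt theorem is needed
(`exists_envelope`).

Necessity. The basis gives a normal form, and its tensor square kills the relations of U_z ⊗ U_z
(`normalForm₂_eq_zero`). The terms of order z of the images of the relations under Δ, together with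
the Jacobi identity in L, force the constraints (`IsQuantization.constraints`). The rules are then
unique. The lowest new coefficient d of a difference of two rules is homogeneous of degree n + 1
with n ≥ 1 and is primitive at z = 0 in the quotient. Multiplying the two tensor factors gives 2d =
2^(n+1) d up to lower degree, so d = 0 (`IsQuantization.eq_zero_of_defect`). -/

namespace QuantumAlgebra3D

noncomputable section

set_option linter.unusedSectionVars false

section

/-! ### `z`-linear maps between formal power series -/

section ZLinear

variable {R S T : Type*} [Ring R] [Ring S] [Ring T]

/-- Additive maps that commute with multiplication by `z`. -/
structure IsZLinear (f : R⟦X⟧ → S⟦X⟧) : Prop where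
  add : ∀ p q, f (p + q) = f p + f q
  X_mul : ∀ p, f (PowerSeries.X * p) = PowerSeries.X * f p

namespace IsZLinear

variable {f g : R⟦X⟧ → S⟦X⟧}

/-- Peeling off p = p(0) + z p' again and again shows that the n-th coefficient only sees finitely
many coefficients of p. The two algebraic axioms therefore already contain z-adic continuity. -/
theorem coeff_eq (hf : IsZLinear f) (n : ℕ) (p : R⟦X⟧) :
    PowerSeries.coeff n (f p) = ∑ ij ∈ Finset.HasAntidiagonal.antidiagonal n,
      PowerSeries.coeff ij.2 (f (PowerSeries.C (PowerSeries.coeff ij.1 p))) := by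
  induction n generalizing p with
  | zero =>
    conv_lhs => rw [PowerSeries.eq_X_mul_shift_add_const p, hf.add, hf.X_mul]
    simp
  | succ n ih =>
    conv_lhs => rw [PowerSeries.eq_X_mul_shift_add_const p, hf.add, hf.X_mul]
    rw [map_add, PowerSeries.coeff_succ_X_mul, ih, Finset.Nat.sum_antidiagonal_succ]
    simp [add_comm]

/-- This is the device by which most identities between series are reduced to constants. It is
applied to one factor at a time when both sides are bilinear over z. -/
theorem ext (hf : IsZLinear f) (hg : IsZLinear g)
    (h : ∀ r, f (PowerSeries.C r) = g (PowerSeries.C r)) (p : R⟦X⟧) : f p = g p := by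
  ext n
  rw [hf.coeff_eq, hg.coeff_eq]
  simp only [h]

theorem comp {h : S⟦X⟧ → T⟦X⟧} (hh : IsZLinear h) (hf : IsZLinear f) :
    IsZLinear fun p => h (f p) :=
  ⟨fun p q => by rw [hf.add, hh.add], fun p => by rw [hf.X_mul, hh.X_mul]⟩

theorem id : IsZLinear fun p : R⟦X⟧ => p := ⟨fun _ _ => rfl, fun _ => rfl⟩

theorem X_pow_mul (hf : IsZLinear f) (n : ℕ) (p : R⟦X⟧) :
    f (PowerSeries.X ^ n * p) = PowerSeries.X ^ n * f p := by
  induction n with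
  | zero => rw [pow_zero, pow_zero, one_mul, one_mul]
  | succ n ih => rw [pow_succ', mul_assoc, hf.X_mul, ih, pow_succ', mul_assoc]

theorem map_zero (hf : IsZLinear f) : f 0 = 0 := by
  simpa using hf.add 0 0

theorem zero : IsZLinear fun _ : R⟦X⟧ => (0 : S⟦X⟧) := ⟨by simp, by simp⟩

theorem map_neg (hf : IsZLinear f) (p : R⟦X⟧) : f (-p) = -f p := by
  rw [eq_neg_iff_add_eq_zero, ← hf.add, neg_add_cancel, hf.map_zero]

theorem map_sub (hf : IsZLinear f) (p q : R⟦X⟧) : f (p - q) = f p - f q := by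
  rw [sub_eq_add_neg, hf.add, hf.map_neg, sub_eq_add_neg]

theorem add_fun (hf : IsZLinear f) (hg : IsZLinear g) : IsZLinear fun p => f p + g p :=
  ⟨fun p q => by rw [hf.add, hg.add]; abel, fun p => by rw [hf.X_mul, hg.X_mul, mul_add]⟩

theorem sub_fun (hf : IsZLinear f) (hg : IsZLinear g) : IsZLinear fun p => f p - g p :=
  ⟨fun p q => by rw [hf.add, hg.add]; abel, fun p => by rw [hf.X_mul, hg.X_mul, mul_sub]⟩

theorem const_mul (s : S⟦X⟧) (hf : IsZLinear f) : IsZLinear fun p => s * f p :=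
  ⟨fun p q => by rw [hf.add, mul_add], fun p => by
    rw [hf.X_mul, ← mul_assoc, ← mul_assoc, PowerSeries.X_mul]⟩

theorem mul_const (hf : IsZLinear f) (s : S⟦X⟧) : IsZLinear fun p => f p * s :=
  ⟨fun p q => by rw [hf.add, add_mul], fun p => by rw [hf.X_mul, mul_assoc]⟩

theorem ringHom_map (φ : R →+* S) : IsZLinear (PowerSeries.map φ) :=
  ⟨map_add _, fun p => by rw [map_mul, PowerSeries.map_X]⟩

theorem mk_coeff {F : Type*} [FunLike F R S] [AddMonoidHomClass F R S] (φ : F) :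
    IsZLinear fun p : R⟦X⟧ => PowerSeries.mk fun n => φ (PowerSeries.coeff n p) :=
  ⟨fun p q => by ext n; simp, fun p => by
    ext n
    cases n with
    | zero => simp
    | succ n => simp [PowerSeries.coeff_succ_X_mul]⟩

end IsZLinear

end ZLinear

/-! ### Continuous extension from constants to power series. -/

section ExtendZ

variable {R S T : Type*} [Ring R] [Algebra ℂ R] [Ring S] [Algebra ℂ S] [Ring T] [Algebra ℂ T]

theorem C_smul (c : ℂ) (r : R) : PowerSeries.C (c • r) = c • PowerSeries.C r := by
  ext n
  simp only [PowerSeries.coeff_smul, PowerSeries.coeff_C]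
  split_ifs <;> simp

theorem coeff_extendZ (D : ℕ → R →ₗ[ℂ] S) (n : ℕ) (p : R⟦X⟧) :
    PowerSeries.coeff n (extendZ D p) =
      ∑ ij ∈ Finset.HasAntidiagonal.antidiagonal n, D ij.2 (PowerSeries.coeff ij.1 p) := by
  simp [extendZ]

theorem isZLinear_extendZ (D : ℕ → R →ₗ[ℂ] S) : IsZLinear (extendZ D) :=
  ⟨fun p q => by ext n; simp [coeff_extendZ, Finset.sum_add_distrib], fun p => by
    ext n
    cases n with
    | zero => simp [coeff_extendZ]
    | succ n =>
      rw [coeff_extendZ, Finset.Nat.sum_antidiagonal_succ, PowerSeries.coeff_succ_X_mul,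
        coeff_extendZ]
      simp [PowerSeries.coeff_succ_X_mul]⟩

theorem coeff_extendZ_C (D : ℕ → R →ₗ[ℂ] S) (n : ℕ) (r : R) :
    PowerSeries.coeff n (extendZ D (PowerSeries.C r)) = D n r := by
  rw [coeff_extendZ, Finset.sum_eq_single_of_mem (0, n) (by simp)]
  · simp
  · rintro ⟨i, j⟩ hij hne
    have : i ≠ 0 := by
      rintro rfl
      simp at hij
      exact hne (by rw [hij])
    simp [PowerSeries.coeff_C, this]

theorem extendZ_smul (D : ℕ → R →ₗ[ℂ] S) (c : ℂ) (p : R⟦X⟧) :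
    extendZ D (c • p) = c • extendZ D p := by
  ext n
  simp [coeff_extendZ, Finset.smul_sum]

/-- The coefficients of a linear map into power series. -/
def coeffMap (ψ : R →ₗ[ℂ] S⟦X⟧) (n : ℕ) : R →ₗ[ℂ] S :=
  { toFun := fun r => PowerSeries.coeff n (ψ r)
    map_add' := by simp
    map_smul' := by simp }

theorem extendZ_coeffMap_C (ψ : R →ₗ[ℂ] S⟦X⟧) (r : R) :
    extendZ (coeffMap ψ) (PowerSeries.C r) = ψ r := by
  ext n
  rw [coeff_extendZ_C]
  rfl

/-- The continuous extension of an algebra homomorphism `R → S⟦z⟧` to `R⟦z⟧`. -/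
def extHom (ψ : R →ₐ[ℂ] S⟦X⟧) : R⟦X⟧ →+* S⟦X⟧ where
  toFun := extendZ (coeffMap ψ.toLinearMap)
  map_zero' := (isZLinear_extendZ _).map_zero
  map_one' := by
    have := extendZ_coeffMap_C ψ.toLinearMap 1
    simpa using this
  map_add' := (isZLinear_extendZ _).add
  map_mul' p q := by
    have hf := isZLinear_extendZ (coeffMap ψ.toLinearMap)
    -- Both sides are z-linear in p and in q separately, so only constants remain, where `ψ` is
    -- multiplicative.
    refine (hf.comp (IsZLinear.id.mul_const q)).ext (hf.mul_const _) (fun r => ?_) p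
    refine (hf.comp (IsZLinear.id.const_mul _)).ext (hf.const_mul _) (fun s => ?_) q
    rw [← map_mul]
    simp only [extendZ_coeffMap_C]
    simp

theorem extHom_apply (ψ : R →ₐ[ℂ] S⟦X⟧) (p : R⟦X⟧) :
    extHom ψ p = extendZ (coeffMap ψ.toLinearMap) p := rfl

theorem isZLinear_extHom (ψ : R →ₐ[ℂ] S⟦X⟧) : IsZLinear (extHom ψ) := isZLinear_extendZ _

@[simp] theorem extHom_C (ψ : R →ₐ[ℂ] S⟦X⟧) (r : R) : extHom ψ (PowerSeries.C r) = ψ r :=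
  extendZ_coeffMap_C ψ.toLinearMap r

theorem extHom_smul (ψ : R →ₐ[ℂ] S⟦X⟧) (c : ℂ) (p : R⟦X⟧) : extHom ψ (c • p) = c • extHom ψ p :=
  extendZ_smul _ c p

theorem coprodZ_eq_extHom (ρ : ℂ) (p : Free⟦X⟧) : coprodZ ρ p = extHom (coprod ρ) p := rfl

end ExtendZ

/-! ### Closed ideals -/

section Closed

variable {R S : Type*} [Ring R] [Ring S]

theorem subset_closedIdeal (s : Set R⟦X⟧) {p : R⟦X⟧} (hp : p ∈ s) : p ∈ closedIdeal s := by
  rw [closedIdeal, TwoSidedIdeal.mem_sInf]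
  exact fun I hI => hI.1 hp

theorem isZClosed_closedIdeal (s : Set R⟦X⟧) : IsZClosed (closedIdeal s) := by
  intro p hp
  rw [closedIdeal, TwoSidedIdeal.mem_sInf]
  intro I hI
  refine hI.2 p fun N => ?_
  obtain ⟨q, hq, h⟩ := hp N
  rw [closedIdeal, TwoSidedIdeal.mem_sInf] at hq
  exact ⟨q, hq I hI, h⟩

theorem closedIdeal_le {s : Set R⟦X⟧} {I : TwoSidedIdeal R⟦X⟧} (h : s ⊆ (I : Set R⟦X⟧))
    (hI : IsZClosed I) {p : R⟦X⟧} (hp : p ∈ closedIdeal s) : p ∈ I := by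
  rw [closedIdeal, TwoSidedIdeal.mem_sInf] at hp
  exact hp I ⟨h, hI⟩

theorem toQuot_eq_zero {s : Set R⟦X⟧} {p : R⟦X⟧} : toQuot s p = 0 ↔ p ∈ closedIdeal s := by
  rw [TwoSidedIdeal.mem_iff]
  exact (RingCon.eq _)

theorem toQuot_surjective (s : Set R⟦X⟧) : Function.Surjective (toQuot s) :=
  RingCon.mk'_surjective _

theorem toQuot_eq_iff {s : Set R⟦X⟧} {p q : R⟦X⟧} :
    toQuot s p = toQuot s q ↔ p - q ∈ closedIdeal s := by
  rw [← toQuot_eq_zero, map_sub, sub_eq_zero]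

theorem IsZLinear.coeff_congr {f : R⟦X⟧ → S⟦X⟧} (hf : IsZLinear f) {N : ℕ} {p q : R⟦X⟧}
    (h : ∀ n < N, PowerSeries.coeff n p = PowerSeries.coeff n q) {n : ℕ} (hn : n < N) :
    PowerSeries.coeff n (f p) = PowerSeries.coeff n (f q) := by
  rw [hf.coeff_eq, hf.coeff_eq]
  refine Finset.sum_congr rfl fun ij hij => ?_
  rw [h]
  have := Finset.HasAntidiagonal.mem_antidiagonal.1 hij
  omega

/-- The preimage of a closed ideal under a continuous homomorphism is closed. -/
theorem IsZClosed.comap {f : R⟦X⟧ →+* S⟦X⟧} (hf : IsZLinear f) {I : TwoSidedIdeal S⟦X⟧}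
    (hI : IsZClosed I) : IsZClosed (I.comap f) := by
  intro p hp
  rw [TwoSidedIdeal.mem_comap]
  refine hI _ fun N => ?_
  obtain ⟨q, hq, h⟩ := hp N
  exact ⟨f q, (TwoSidedIdeal.mem_comap _).1 hq, fun n hn => hf.coeff_congr h hn⟩

theorem isZClosed_bot : IsZClosed (⊥ : TwoSidedIdeal R⟦X⟧) := by
  intro p hp
  rw [TwoSidedIdeal.mem_bot]
  ext n
  obtain ⟨q, hq, h⟩ := hp (n + 1)
  rw [h n (Nat.lt_succ_self n), (TwoSidedIdeal.mem_bot _).1 hq]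

/-- A continuous homomorphism maps a closed ideal into a closed ideal if it does so for the
generators. -/
theorem map_mem_of_mem_closedIdeal {f : R⟦X⟧ →+* S⟦X⟧} (hf : IsZLinear f) {s : Set R⟦X⟧}
    {I : TwoSidedIdeal S⟦X⟧} (hI : IsZClosed I) (h : ∀ p ∈ s, f p ∈ I) {p : R⟦X⟧}
    (hp : p ∈ closedIdeal s) : f p ∈ I :=
  (TwoSidedIdeal.mem_comap _).1
    (closedIdeal_le (fun q hq => (TwoSidedIdeal.mem_comap _).2 (h q hq)) (hI.comap hf) hp)

/-- The partial sums lie in the ideal and agree with p to every order. This is how infinite sums ∑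
z^k t_k are shown to belong to a closed ideal. -/
theorem IsZClosed.mem_of_sum {I : TwoSidedIdeal R⟦X⟧} (hI : IsZClosed I) {p : R⟦X⟧} {t : ℕ → R⟦X⟧}
    (ht : ∀ n, t n ∈ I)
    (h : ∀ N, ∀ n < N, PowerSeries.coeff n p =
      PowerSeries.coeff n (∑ k ∈ Finset.range N, PowerSeries.X ^ k * t k)) : p ∈ I :=
  hI p fun N => ⟨_, sum_mem fun k _ => I.mul_mem_left _ _ (ht k), fun n hn => h N n hn⟩

end Closed

end

section

/-! ### Exponentials and symmetrized exponentials -/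

section Exp

variable {R S : Type*} [Ring R] [Algebra ℂ R] [Ring S] [Algebra ℂ S]

theorem coeff_expZ (n : ℕ) (x : R) :
    PowerSeries.coeff n (expZ x) = ((n.factorial : ℂ)⁻¹) • x ^ n := by simp [expZ]

theorem expZ_zero : expZ (0 : R) = 1 := by
  ext n
  rw [coeff_expZ, PowerSeries.coeff_one]
  rcases n with _ | n <;> simp

theorem expZ_add {x y : R} (h : Commute x y) : expZ (x + y) = expZ x * expZ y := by
  ext n
  rw [coeff_expZ, PowerSeries.coeff_mul, h.add_pow', Finset.smul_sum]
  refine Finset.sum_congr rfl fun ij hij => ?_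
  have hn := Finset.HasAntidiagonal.mem_antidiagonal.1 hij
  rw [coeff_expZ, coeff_expZ, smul_mul_smul_comm, ← Nat.cast_smul_eq_nsmul ℂ, smul_smul]
  congr 1
  rw [← hn, Nat.choose_symm_add, Nat.add_choose]
  have h1 : (ij.1.factorial : ℂ) ≠ 0 := by exact_mod_cast ij.1.factorial_ne_zero
  have h2 : (ij.2.factorial : ℂ) ≠ 0 := by exact_mod_cast ij.2.factorial_ne_zero
  have h3 : ((ij.1 + ij.2).factorial : ℂ) ≠ 0 := by exact_mod_cast (ij.1 + ij.2).factorial_ne_zero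
  rw [Nat.cast_div (Nat.factorial_mul_factorial_dvd_factorial_add _ _)
    (by exact_mod_cast mul_ne_zero ij.1.factorial_ne_zero ij.2.factorial_ne_zero)]
  push_cast
  field_simp

theorem expZ_mul_neg (x : R) : expZ x * expZ (-x) = 1 := by
  rw [← expZ_add (Commute.neg_right (Commute.refl x)), add_neg_cancel, expZ_zero]

theorem expZ_neg_mul (x : R) : expZ (-x) * expZ x = 1 := by
  rw [← expZ_add (Commute.neg_left (Commute.refl x)), neg_add_cancel, expZ_zero]

theorem commute_of_coeff {p q : R⟦X⟧}
    (h : ∀ i j, Commute (PowerSeries.coeff i p) (PowerSeries.coeff j q)) : Commute p q := by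
  ext n
  rw [PowerSeries.coeff_mul, PowerSeries.coeff_mul, ← Finset.Nat.sum_antidiagonal_swap]
  exact Finset.sum_congr rfl fun ij _ => h _ _

theorem commute_C_coeff {x : R} {p : R⟦X⟧} (h : Commute (PowerSeries.C x) p) (n : ℕ) :
    Commute x (PowerSeries.coeff n p) := by
  have := congrArg (PowerSeries.coeff n) h.eq
  rwa [PowerSeries.coeff_C_mul, PowerSeries.coeff_mul_C] at this

theorem commute_C_of_coeff {x : R} {p : R⟦X⟧} (h : ∀ n, Commute x (PowerSeries.coeff n p)) :
    Commute (PowerSeries.C x) p := by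
  ext n
  rw [PowerSeries.coeff_C_mul, PowerSeries.coeff_mul_C]
  exact h n

theorem commute_C_C {x y : R} (h : Commute x y) :
    Commute (PowerSeries.C x) (PowerSeries.C y) := h.map PowerSeries.C

theorem commute_C_expZ {x y : R} (h : Commute x y) : Commute (PowerSeries.C x) (expZ y) :=
  commute_C_of_coeff fun n => by
    rw [coeff_expZ]
    exact (h.pow_right n).smul_right _

theorem commute_expZ {x : R} {p : R⟦X⟧} (h : Commute (PowerSeries.C x) p) : Commute (expZ x) p :=
  commute_of_coeff fun i j => by
    rw [coeff_expZ]
    exact ((commute_C_coeff h j).pow_left i).smul_left _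

theorem extHom_of_const (ψ : R →ₐ[ℂ] S⟦X⟧) {p : R⟦X⟧} {q : S⟦X⟧}
    (h : ∀ n, ψ (PowerSeries.coeff n p) = PowerSeries.C (PowerSeries.coeff n q)) :
    extHom ψ p = q := by
  ext n
  rw [extHom_apply, coeff_extendZ, Finset.sum_eq_single_of_mem (n, 0) (by simp)]
  · simp [coeffMap, h]
  · rintro ⟨i, j⟩ hij hne
    have : j ≠ 0 := by
      rintro rfl
      simp at hij
      exact hne (by rw [hij])
    simp [coeffMap, h, PowerSeries.coeff_C, this]

theorem extHom_expZ (ψ : R →ₐ[ℂ] S⟦X⟧) {x : R} {y : S} (h : ψ x = PowerSeries.C y) :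
    extHom ψ (expZ x) = expZ y :=
  extHom_of_const ψ fun n => by
    rw [coeff_expZ, coeff_expZ, map_smul, map_pow, h, C_smul, map_pow]

/-! ### The series `sinh(t z x) / (t z)` -/

/-- `∑ z^(2k) t^(2k) x^(2k+1) / (2k+1)!`, that is, `sinh(t z x) / (t z)`. -/
def shc (t : ℂ) (x : R) : R⟦X⟧ :=
  PowerSeries.mk fun n => if Even n then (t ^ n * ((n + 1).factorial : ℂ)⁻¹) • x ^ (n + 1) else 0

theorem coeff_shc (n : ℕ) (t : ℂ) (x : R) : PowerSeries.coeff n (shc t x) =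
    if Even n then (t ^ n * ((n + 1).factorial : ℂ)⁻¹) • x ^ (n + 1) else 0 := by simp [shc]

/-- The normalization by t, and not only by z, is chosen for this value: it turns the term a₁
sinh(z(1+ρ)A)/(z(1+ρ)) into a₁A when ρ = -1. -/
theorem shc_zero (x : R) : shc 0 x = PowerSeries.C x := by
  ext n
  rw [coeff_shc, PowerSeries.coeff_C]
  rcases n with _ | n <;> simp

/-- Multiplication by z is injective, so for t ≠ 0 every identity for `shc` can be checked on
exponentials after clearing 2tz. -/
theorem two_smul_X_mul_shc (t : ℂ) (x : R) :
    (2 * t) • (PowerSeries.X * shc t x) = expZ (t • x) - expZ (-(t • x)) := by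
  ext n
  rw [PowerSeries.coeff_smul, map_sub, coeff_expZ, coeff_expZ]
  rcases n with _ | n
  · simp
  · rw [PowerSeries.coeff_succ_X_mul, coeff_shc]
    split_ifs with h
    · rw [h.add_one.neg_pow, smul_pow, smul_neg, sub_neg_eq_add, smul_smul, ← two_smul ℂ, smul_smul,
        smul_smul]
      congr 1
      ring
    · rw [(Nat.even_add_one.2 h).neg_pow, smul_zero, sub_self]

theorem commute_shc {x y : R} (h : Commute x y) (t : ℂ) : Commute (PowerSeries.C x) (shc t y) :=
  commute_C_of_coeff fun n => by
    rw [coeff_shc]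
    split_ifs
    · exact (h.pow_right _).smul_right _
    · exact Commute.zero_right _

theorem smul_X_mul_cancel {c : ℂ} (hc : c ≠ 0) {p q : R⟦X⟧}
    (h : c • (PowerSeries.X * p) = c • (PowerSeries.X * q)) : p = q :=
  PowerSeries.X_mul_cancel (smul_right_injective _ hc h)

/-- The telescoping e^x (e^y - e^(-y)) + (e^x - e^(-x)) e^(-y) = e^(x+y) - e^(-x-y) is divided by
2tz. The value t = 0 is separate because it does not allow the division. -/
theorem shc_add (t : ℂ) {x y : R} (h : Commute x y) :
    shc t (x + y) = expZ (t • x) * shc t y + shc t x * expZ (-(t • y)) := by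
  by_cases ht : t = 0
  · subst ht
    simp [shc_zero, expZ_zero, add_comm]
  · have h' : Commute (t • x) (t • y) := (h.smul_left t).smul_right t
    refine smul_X_mul_cancel (mul_ne_zero two_ne_zero ht) ?_
    have key : (2 * t) • (PowerSeries.X * (expZ (t • x) * shc t y + shc t x * expZ (-(t • y)))) =
        expZ (t • x) * ((2 * t) • (PowerSeries.X * shc t y)) +
          ((2 * t) • (PowerSeries.X * shc t x)) * expZ (-(t • y)) := by
      rw [mul_smul_comm, smul_mul_assoc, ← smul_add, mul_add, ← mul_assoc, ← mul_assoc,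
        ← mul_assoc, PowerSeries.X_mul (φ := expZ (t • x))]
    rw [key, two_smul_X_mul_shc, two_smul_X_mul_shc, two_smul_X_mul_shc, smul_add, neg_add,
      expZ_add h', expZ_add (Commute.neg_left (Commute.neg_right h'))]
    noncomm_ring

theorem extHom_shc (ψ : R →ₐ[ℂ] S⟦X⟧) {x : R} {y : S} (h : ψ x = PowerSeries.C y) (t : ℂ) :
    extHom ψ (shc t x) = shc t y :=
  extHom_of_const ψ fun n => by
    rw [coeff_shc, coeff_shc]
    split_ifs
    · rw [map_smul, map_pow, h, C_smul, map_pow]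
    · simp

/-! ### The symmetrization of `y exp(z x)` -/

/-- The sum of the products `x ^ i * y * x ^ j` with `i + j = n`. -/
def sandwich (x : R) (n : ℕ) : R →ₗ[ℂ] R :=
  ∑ ij ∈ Finset.HasAntidiagonal.antidiagonal n,
    LinearMap.mulLeft ℂ (x ^ ij.1) ∘ₗ LinearMap.mulRight ℂ (x ^ ij.2)

theorem sandwich_apply (x : R) (n : ℕ) (y : R) :
    sandwich x n y = ∑ ij ∈ Finset.HasAntidiagonal.antidiagonal n, x ^ ij.1 * y * x ^ ij.2 := by
  simp [sandwich, LinearMap.sum_apply, mul_assoc]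

theorem sandwich_succ (x : R) (n : ℕ) (y : R) :
    sandwich x (n + 1) y = y * x ^ (n + 1) + x * sandwich x n y := by
  rw [sandwich_apply, sandwich_apply, Finset.Nat.sum_antidiagonal_succ, Finset.mul_sum]
  simp [pow_succ', mul_assoc]

theorem sandwich_zero (x y : R) : sandwich x 0 y = y := by simp [sandwich_apply]

/-- `∑ zⁿ / (n+1)! ∑ x ^ i * y * x ^ j` over `i + j = n`, the symmetrization of `y exp(z x)`. -/
def symE (x : R) : R⟦X⟧ → R⟦X⟧ := extendZ fun n => (((n + 1).factorial : ℂ)⁻¹) • sandwich x n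

theorem isZLinear_symE (x : R) : IsZLinear (symE x) := isZLinear_extendZ _

theorem symE_smul (x : R) (c : ℂ) (p : R⟦X⟧) : symE x (c • p) = c • symE x p := extendZ_smul _ _ _

theorem coeff_symE_C (x y : R) (n : ℕ) : PowerSeries.coeff n (symE x (PowerSeries.C y)) =
    (((n + 1).factorial : ℂ)⁻¹) • sandwich x n y := by
  rw [symE, coeff_extendZ_C]
  rfl

/-- The sum telescopes. Weighted by 1/(n+1)!, it becomes [e^(zx), p] = z `symE` x [x, p] in
`expZ_commutator`, which converts commutators with exponentials into commutators with the generator.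
-/
theorem sandwich_commutator (x y : R) (n : ℕ) :
    sandwich x n (x * y - y * x) = x ^ (n + 1) * y - y * x ^ (n + 1) := by
  induction n with
  | zero => simp [sandwich_zero]
  | succ n ih =>
    rw [sandwich_succ, ih, pow_succ' x (n + 1)]
    noncomm_ring

theorem expZ_commutator (x : R) (p : R⟦X⟧) : expZ x * p - p * expZ x =
    PowerSeries.X * symE x (PowerSeries.C x * p - p * PowerSeries.C x) := by
  refine ((IsZLinear.id.const_mul _).sub_fun (IsZLinear.id.mul_const _)).ext
    (((isZLinear_symE x).comp ((IsZLinear.id.const_mul _).sub_fun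
      (IsZLinear.id.mul_const _))).const_mul _) (fun y => ?_) p
  rw [← map_mul, ← map_mul, ← map_sub]
  ext n
  rw [map_sub, PowerSeries.coeff_mul_C, PowerSeries.coeff_C_mul, coeff_expZ]
  rcases n with _ | n
  · simp
  · rw [PowerSeries.coeff_succ_X_mul, coeff_symE_C, sandwich_commutator, smul_mul_assoc,
      mul_smul_comm, smul_sub]

/-- A series whose coefficients commute with `x` comes from the centralizer of `x`. -/
theorem exists_centralizer {x : R} {p : R⟦X⟧} (h : Commute (PowerSeries.C x) p) :
    ∃ q : (Subring.centralizer {x})⟦X⟧, PowerSeries.map (Subring.centralizer {x}).subtype q = p :=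
  ⟨PowerSeries.mk fun n => ⟨PowerSeries.coeff n p, by
    rw [Subring.mem_centralizer_iff]
    rintro y rfl
    exact commute_C_coeff h n⟩, by ext n; simp⟩

theorem centralizer_pow {x : R} (r : Subring.centralizer {x}) (n : ℕ) : Commute (x ^ n) (r : R) :=
  Commute.pow_left (Subring.mem_centralizer_iff.1 r.2 x rfl) n

/-- Factors that commute with x can be pulled through each x^i y x^j, so `symE x` is linear over the
centralizer of x. -/
theorem symE_mul_left {x : R} {b : R⟦X⟧} (h : Commute (PowerSeries.C x) b) (p : R⟦X⟧) :
    symE x (b * p) = b * symE x p := by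
  -- Moving the coefficients of b into the centralizer as a ring of its own keeps the commutation
  -- hypothesis available after the reduction to constants.
  obtain ⟨q, rfl⟩ := exists_centralizer h
  refine ((isZLinear_symE x).comp ((IsZLinear.ringHom_map _).mul_const p)).ext
    ((IsZLinear.ringHom_map _).mul_const _) (fun r => ?_) q
  refine ((isZLinear_symE x).comp (IsZLinear.id.const_mul _)).ext
    ((isZLinear_symE x).const_mul _) (fun y => ?_) p
  rw [PowerSeries.map_C, ← map_mul]
  ext n
  rw [coeff_symE_C, PowerSeries.coeff_C_mul, coeff_symE_C, mul_smul_comm, sandwich_apply,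
    sandwich_apply, Finset.mul_sum]
  congr 1
  refine Finset.sum_congr rfl fun ij _ => ?_
  rw [← mul_assoc, Subring.subtype_apply, (centralizer_pow r _).eq]
  simp [mul_assoc]

theorem symE_mul_right {x : R} {b : R⟦X⟧} (h : Commute (PowerSeries.C x) b) (p : R⟦X⟧) :
    symE x (p * b) = symE x p * b := by
  obtain ⟨q, rfl⟩ := exists_centralizer h
  refine ((isZLinear_symE x).comp ((IsZLinear.ringHom_map _).const_mul p)).ext
    ((IsZLinear.ringHom_map _).const_mul _) (fun r => ?_) q
  refine ((isZLinear_symE x).comp (IsZLinear.id.mul_const _)).ext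
    ((isZLinear_symE x).mul_const _) (fun y => ?_) p
  rw [PowerSeries.map_C, ← map_mul]
  ext n
  rw [coeff_symE_C, PowerSeries.coeff_mul_C, coeff_symE_C, smul_mul_assoc, sandwich_apply,
    sandwich_apply, Finset.sum_mul]
  congr 1
  refine Finset.sum_congr rfl fun ij _ => ?_
  rw [mul_assoc, mul_assoc, mul_assoc, Subring.subtype_apply, ← (centralizer_pow r _).eq]
  simp [mul_assoc]

theorem symE_one (x : R) : symE x 1 = expZ x := by
  ext n
  rw [← map_one PowerSeries.C, coeff_symE_C, coeff_expZ, sandwich_apply]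
  rw [Finset.sum_congr rfl (g := fun _ => x ^ n) (fun ij hij => by
    rw [mul_one, ← pow_add, Finset.HasAntidiagonal.mem_antidiagonal.1 hij])]
  rw [Finset.sum_const, Finset.Nat.card_antidiagonal, ← Nat.cast_smul_eq_nsmul ℂ, smul_smul]
  congr 1
  have h1 : (n.factorial : ℂ) ≠ 0 := by exact_mod_cast n.factorial_ne_zero
  have h2 : ((n : ℂ) + 1) ≠ 0 := by exact_mod_cast n.succ_ne_zero
  rw [Nat.factorial_succ]
  push_cast
  field_simp

theorem symE_of_commute {x : R} {b : R⟦X⟧} (h : Commute (PowerSeries.C x) b) :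
    symE x b = expZ x * b := by
  rw [← one_mul b, symE_mul_right h, symE_one, one_mul]

theorem extHom_symE (ψ : R →ₐ[ℂ] S⟦X⟧) {x : R} {y : S} (h : ψ x = PowerSeries.C y) (p : R⟦X⟧) :
    extHom ψ (symE x p) = symE y (extHom ψ p) := by
  refine ((isZLinear_extHom ψ).comp (isZLinear_symE x)).ext
    ((isZLinear_symE y).comp (isZLinear_extHom ψ)) (fun r => ?_) p
  have key : ∀ n, ψ (sandwich x n r) = ∑ ij ∈ Finset.HasAntidiagonal.antidiagonal n,
      PowerSeries.C (y ^ ij.1) * ψ r * PowerSeries.C (y ^ ij.2) := fun n => by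
    rw [sandwich_apply, map_sum]
    simp [h]
  ext n
  rw [extHom_apply, coeff_extendZ, symE, symE, coeff_extendZ, ← Finset.Nat.sum_antidiagonal_swap]
  refine Finset.sum_congr rfl fun ij _ => ?_
  simp only [Prod.fst_swap, Prod.snd_swap, coeff_extendZ_C, coeffMap, LinearMap.coe_mk,
    AddHom.coe_mk, AlgHom.toLinearMap_apply, map_smul, key, map_sum,
    PowerSeries.coeff_mul_C, PowerSeries.coeff_C_mul, LinearMap.smul_apply, extHom_C]
  rw [sandwich_apply]

/-! ### Dual numbers -/

/-- By the Leibniz rule this is the derivative of x^(n+1) in the direction y. Thus z `symE x y` is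
the ε-part of exp(z(x + εy)), and functional equations of exp can be differentiated to give rules
for `symE`. -/
theorem snd_pow_succ (x y : R) (n : ℕ) :
    ((TrivSqZeroExt.inl x + TrivSqZeroExt.inr y : TrivSqZeroExt R R) ^ (n + 1)).snd =
      sandwich x n y := by
  induction n with
  | zero => simp [sandwich_zero]
  | succ n ih =>
    rw [pow_succ', TrivSqZeroExt.snd_mul, ih, sandwich_succ]
    simp [add_comm]

/-- The `ε`-part of a power series over the dual numbers. -/
def sndZ (p : (TrivSqZeroExt R R)⟦X⟧) : R⟦X⟧ :=
  PowerSeries.mk fun n => (PowerSeries.coeff n p).snd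

/-- The constant part of a power series over the dual numbers. -/
def fstZ (p : (TrivSqZeroExt R R)⟦X⟧) : R⟦X⟧ :=
  PowerSeries.mk fun n => (PowerSeries.coeff n p).fst

theorem sndZ_mul (p q : (TrivSqZeroExt R R)⟦X⟧) :
    sndZ (p * q) = fstZ p * sndZ q + sndZ p * fstZ q := by
  ext n
  simp only [sndZ, fstZ, PowerSeries.coeff_mk, map_add, PowerSeries.coeff_mul,
    TrivSqZeroExt.snd_sum, TrivSqZeroExt.snd_mul, Finset.sum_add_distrib, smul_eq_mul,
    MulOpposite.smul_eq_mul_unop, MulOpposite.unop_op]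

theorem fstZ_expZ (x y : R) :
    fstZ (expZ (TrivSqZeroExt.inl x + TrivSqZeroExt.inr y : TrivSqZeroExt R R)) = expZ x := by
  ext n
  simp [fstZ, coeff_expZ]

theorem sndZ_expZ (x y : R) :
    sndZ (expZ (TrivSqZeroExt.inl x + TrivSqZeroExt.inr y : TrivSqZeroExt R R)) =
      PowerSeries.X * symE x (PowerSeries.C y) := by
  ext n
  rw [sndZ, PowerSeries.coeff_mk, coeff_expZ, TrivSqZeroExt.snd_smul]
  rcases n with _ | n
  · simp
  · rw [snd_pow_succ, PowerSeries.coeff_succ_X_mul, coeff_symE_C]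

/-- This is the ε-part of exp(a + (x + εy)) = exp(a) exp(x + εy), divided by z. -/
theorem symE_add {x a y : R} (hx : Commute a x) (hy : Commute a y) :
    symE (a + x) (PowerSeries.C y) = expZ a * symE x (PowerSeries.C y) := by
  have h : Commute (TrivSqZeroExt.inl a + TrivSqZeroExt.inr 0 : TrivSqZeroExt R R)
      (TrivSqZeroExt.inl x + TrivSqZeroExt.inr y) := by
    ext <;> simp [hx.eq, hy.eq]
  have := congrArg sndZ (expZ_add h)
  rw [sndZ_mul, fstZ_expZ, fstZ_expZ, sndZ_expZ, sndZ_expZ, map_zero,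
    (isZLinear_symE a).map_zero, mul_zero, zero_mul, add_zero, ← mul_assoc,
    ← PowerSeries.X_mul, mul_assoc, add_add_add_comm, ← TrivSqZeroExt.inl_add,
    ← TrivSqZeroExt.inr_add, zero_add, sndZ_expZ] at this
  exact PowerSeries.X_mul_cancel this

/-- This is the derivative of an inverse, d(u⁻¹) = -u⁻¹ du u⁻¹ with u = exp(zx), read off as an
ε-part. The sign is absorbed by the direction -y. -/
theorem expZ_neg_symE (x y : R) :
    expZ (-x) * symE x (PowerSeries.C y) * expZ (-x) = symE (-x) (PowerSeries.C y) := by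
  have := congrArg sndZ (expZ_mul_neg
    (TrivSqZeroExt.inl x + TrivSqZeroExt.inr y : TrivSqZeroExt R R))
  rw [sndZ_mul, neg_add, ← TrivSqZeroExt.inl_neg, ← TrivSqZeroExt.inr_neg, fstZ_expZ, fstZ_expZ,
    sndZ_expZ, sndZ_expZ] at this
  have h0 : sndZ (1 : (TrivSqZeroExt R R)⟦X⟧) = 0 := by
    ext n
    rw [sndZ, PowerSeries.coeff_mk, PowerSeries.coeff_one]
    split_ifs <;> simp
  rw [h0, map_neg, (isZLinear_symE (-x)).map_neg, mul_neg, mul_neg, neg_add_eq_zero, ← mul_assoc,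
    ← PowerSeries.X_mul, mul_assoc, mul_assoc] at this
  rw [mul_assoc, ← PowerSeries.X_mul_cancel this, ← mul_assoc, expZ_neg_mul, one_mul]

/-! ### Closed ideals -/

theorem smul_mem_ideal (I : TwoSidedIdeal R) (c : ℂ) {x : R} (hx : x ∈ I) : c • x ∈ I := by
  rw [Algebra.smul_def]
  exact I.mul_mem_left _ _ hx

/-- The element is an infinite sum of z^k times combinations of x^i p x^j, so closedness of the
ideal is needed. It lets relations be used inside a symmetrized exponential. -/
theorem IsZClosed.symE_mem {I : TwoSidedIdeal R⟦X⟧} (hI : IsZClosed I) (x : R) {p : R⟦X⟧}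
    (hp : p ∈ I) : symE x p ∈ I := by
  refine hI.mem_of_sum (t := fun k => ((((k + 1).factorial : ℂ)⁻¹) •
    ∑ ij ∈ Finset.HasAntidiagonal.antidiagonal k,
      PowerSeries.C (x ^ ij.1) * p * PowerSeries.C (x ^ ij.2))) (fun k => ?_) (fun N n hn => ?_)
  · exact smul_mem_ideal _ _ (sum_mem fun ij _ => I.mul_mem_right _ _ (I.mul_mem_left _ _ hp))
  · simp only [map_sum, PowerSeries.coeff_X_pow_mul']
    rw [← Finset.sum_filter, symE, coeff_extendZ, Finset.Nat.sum_antidiagonal_eq_sum_range_succ_mk,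
      ← Finset.sum_range_reflect]
    have : Finset.filter (fun k => k ≤ n) (Finset.range N) = Finset.range n.succ := by
      ext k
      simp
      omega
    rw [this]
    refine Finset.sum_congr rfl fun k hk => ?_
    have hk' : k ≤ n := by simpa [Nat.lt_succ_iff] using hk
    have e1 : n.succ - 1 - k = n - k := by omega
    have e2 : n - (n - k) = k := by omega
    simp only [e1, e2, sandwich_apply, PowerSeries.coeff_mul_C, PowerSeries.coeff_C_mul,
      PowerSeries.coeff_smul, map_sum, LinearMap.smul_apply]

end Exp

end

section

/-! ### Symmetrization of words -/

/-- The product of the generators along a word. -/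
def word (l : List (Fin 3)) : Free := (l.map gen).prod

@[simp] theorem word_nil : word [] = 1 := rfl

@[simp] theorem word_cons (i : Fin 3) (l : List (Fin 3)) : word (i :: l) = gen i * word l := by
  simp [word]

theorem word_append (l l' : List (Fin 3)) : word (l ++ l') = word l * word l' := by
  simp [word]

/-- The homomorphism from noncommutative to commutative polynomials. -/
def abel : Free →ₐ[ℂ] Poly := FreeAlgebra.lift ℂ letter

@[simp] theorem abel_gen (i : Fin 3) : abel (gen i) = letter i := by simp [abel, gen]

theorem abel_word (l : List (Fin 3)) : abel (word l) = (l.map letter).prod := by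
  rw [word, map_list_prod, List.map_map]
  congr 2
  ext1 i
  simp

theorem span_word : Submodule.span ℂ (Set.range word) = ⊤ := by
  rw [eq_top_iff]
  rintro x -
  induction x using FreeAlgebra.induction with
  | grade0 r =>
    rw [Algebra.algebraMap_eq_smul_one]
    exact Submodule.smul_mem _ _ (Submodule.subset_span ⟨[], rfl⟩)
  | grade1 i => exact Submodule.subset_span ⟨[i], by simp [gen]⟩
  | add x y hx hy => exact Submodule.add_mem _ hx hy
  | mul x y hx hy =>
    have := Submodule.mul_mem_mul hx hy
    rw [Submodule.span_mul_span] at this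
    refine Submodule.span_mono ?_ this
    rintro _ ⟨_, ⟨l, rfl⟩, _, ⟨l', rfl⟩, rfl⟩
    exact ⟨l ++ l', word_append l l'⟩

/-- The symmetrized product of `gen (w 0), …, gen (w (n - 1))`. -/
def symFn (n : ℕ) (w : Fin n → Fin 3) : Free :=
  ((n.factorial : ℂ)⁻¹) • ∑ p : Equiv.Perm (Fin n), (List.ofFn fun i => gen (w (p i))).prod

theorem symFn_congr {n n' : ℕ} (hn : n = n') {w : Fin n → Fin 3} {w' : Fin n' → Fin 3}
    (σ : Fin n ≃ Fin n') (h : ∀ i, w' (σ i) = w i) : symFn n w = symFn n' w' := by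
  subst hn
  rw [symFn, symFn, ← Equiv.sum_comp (Equiv.mulLeft (σ : Equiv.Perm (Fin n)))
    fun p : Equiv.Perm (Fin n) => (List.ofFn fun i => gen (w' (p i))).prod]
  simp [h]

theorem symWord_perm {l l' : List (Fin 3)} (h : l.Perm l') : symWord l = symWord l' := by
  have hi : Function.Injective h.idxBij := h.subperm.idxInj_injective
  have hb : Function.Bijective h.idxBij :=
    (Fintype.bijective_iff_injective_and_card _).2 ⟨hi, by simpa using h.length_eq⟩
  exact symFn_congr h.length_eq (Equiv.ofBijective _ hb) fun i => h.getElem_idxBij_eq_getElem i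

theorem sym_monomial (m : Fin 3 →₀ ℕ) :
    sym (MvPolynomial.monomial m 1) = symWord (orderedWord m) := by
  have := (MvPolynomial.basisMonomials (Fin 3) ℂ).constr_basis ℂ
    (fun m => symWord (orderedWord m)) m
  rwa [MvPolynomial.coe_basisMonomials] at this

theorem prod_letter (l : List (Fin 3)) : (l.map letter).prod =
    MvPolynomial.monomial (Multiset.toFinsupp (l : Multiset (Fin 3))) 1 := by
  induction l with
  | nil => simp
  | cons i l ih =>
    rw [List.map_cons, List.prod_cons, ih, ← Multiset.cons_coe, ← Multiset.singleton_add, map_add,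
      Multiset.toFinsupp_singleton, letter, MvPolynomial.X, MvPolynomial.monomial_mul, one_mul]

theorem orderedWord_perm (l : List (Fin 3)) :
    (orderedWord (Multiset.toFinsupp (l : Multiset (Fin 3)))).Perm l := by
  rw [List.perm_iff_count]
  intro i
  fin_cases i <;> simp [orderedWord, List.count_replicate]

/-- Symmetrization ignores the order of the letters, so the ordered word in the definition of `sym`
may be replaced by any other arrangement. -/
theorem sym_prod_letter (l : List (Fin 3)) : sym (l.map letter).prod = symWord l := by
  rw [prod_letter, sym_monomial, symWord_perm (orderedWord_perm l)]

theorem abel_symWord (l : List (Fin 3)) : abel (symWord l) = (l.map letter).prod := by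
  have h : ∀ p : Equiv.Perm (Fin l.length),
      abel (List.ofFn fun i => gen (l.get (p i))).prod = (l.map letter).prod := fun p => by
    rw [map_list_prod, List.map_ofFn]
    have e : (l.map letter).prod = (List.ofFn fun i => letter (l.get i)).prod := by
      congr 1
      conv_lhs => rw [← List.ofFn_get l, List.map_ofFn]
      rfl
    rw [e, List.prod_ofFn, List.prod_ofFn, ← Equiv.prod_comp p fun i => letter (l.get i)]
    simp
  rw [symWord, map_smul, map_sum, Finset.sum_congr rfl fun p _ => h p, Finset.sum_const,
    Finset.card_univ, Fintype.card_perm, Fintype.card_fin, ← Nat.cast_smul_eq_nsmul ℂ, smul_smul,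
    inv_mul_cancel₀ (by exact_mod_cast l.length.factorial_ne_zero), one_smul]

theorem monomial_eq_prod_letter (m : Fin 3 →₀ ℕ) :
    ∃ l : List (Fin 3), l.length = m.degree ∧
      (MvPolynomial.monomial m 1 : Poly) = (l.map letter).prod := by
  refine ⟨(Finsupp.toMultiset m).toList, ?_, ?_⟩
  · rw [Multiset.length_toList, Finsupp.card_toMultiset]
    rfl
  · rw [prod_letter, Multiset.coe_toList, Finsupp.toMultiset_toFinsupp]

theorem abel_sym (g : Poly) : abel (sym g) = g := by
  have : abel.toLinearMap ∘ₗ sym = LinearMap.id := by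
    refine (MvPolynomial.basisMonomials (Fin 3) ℂ).ext fun m => ?_
    obtain ⟨l, -, hl⟩ := monomial_eq_prod_letter m
    simp only [MvPolynomial.coe_basisMonomials, LinearMap.comp_apply, LinearMap.id_apply,
      AlgHom.toLinearMap_apply]
    rw [hl, sym_prod_letter, abel_symWord]
  exact LinearMap.congr_fun this g

theorem prod_ofFn_ite {M : Type*} [Monoid M] (a b : M) (n : ℕ) (i : Fin (n + 1)) :
    (List.ofFn fun k => if k = i then b else a).prod = a ^ (i : ℕ) * b * a ^ (n - i) := by
  induction n with
  | zero =>
    have : i = 0 := Fin.fin_one_eq_zero i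
    simp [this]
  | succ n ih =>
    rw [List.ofFn_succ, List.prod_cons]
    refine Fin.cases ?_ (fun i => ?_) i
    · simp [Fin.succ_ne_zero, List.ofFn_const, pow_succ']
    · rw [if_neg (Fin.succ_ne_zero i).symm]
      simp only [Fin.succ_inj, ih, Fin.val_succ, pow_succ', mul_assoc, Nat.add_sub_add_right]

/-- Each index is the preimage of 0 under exactly n! permutations. -/
theorem sum_perm_symm_zero {M : Type*} [AddCommMonoid M] (n : ℕ) (f : Fin (n + 1) → M) :
    ∑ p : Equiv.Perm (Fin (n + 1)), f (p.symm 0) = n.factorial • ∑ i, f i := by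
  rw [← Equiv.sum_comp (Equiv.inv (Equiv.Perm (Fin (n + 1)))),
    ← Equiv.sum_comp Equiv.Perm.decomposeFin.symm, Fintype.sum_prod_type, Finset.smul_sum]
  refine Finset.sum_congr rfl fun i _ => ?_
  simp [Fintype.card_perm, Equiv.Perm.inv_def]

/-- With all other letters equal to A, a permuted product depends only on the position in which the
letter j lands. -/
theorem symWord_cons_replicate (j : Fin 3) (n : ℕ) : symWord (j :: List.replicate n 0) =
    ((n : ℂ) + 1)⁻¹ • sandwich (gen 0) n (gen j) := by
  have h1 : symWord (j :: List.replicate n 0) =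
      symFn (n + 1) (fun k => if k = 0 then j else 0) := by
    refine symFn_congr (by simp) (finCongr (by simp)) fun i => ?_
    rcases i with ⟨_ | i, hi⟩ <;> simp [Fin.ext_iff]
  have h2 : ∀ p : Equiv.Perm (Fin (n + 1)),
      (List.ofFn fun i => gen (if p i = 0 then j else 0)).prod =
        gen 0 ^ (p.symm 0 : ℕ) * gen j * gen 0 ^ (n - p.symm 0) := fun p => by
    rw [← prod_ofFn_ite]
    congr 2
    ext1 i
    rw [apply_ite gen]
    simp only [← Equiv.eq_symm_apply]
  rw [h1, symFn, Finset.sum_congr rfl fun p _ => h2 p,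
    sum_perm_symm_zero n fun i => gen 0 ^ (i : ℕ) * gen j * gen 0 ^ (n - i),
    ← Nat.cast_smul_eq_nsmul ℂ, smul_smul, sandwich_apply,
    Finset.Nat.sum_antidiagonal_eq_sum_range_succ_mk, ← Fin.sum_univ_eq_sum_range
      (fun i => gen 0 ^ i * gen j * gen 0 ^ (n - i))]
  congr 1
  have h1 : (n.factorial : ℂ) ≠ 0 := by exact_mod_cast n.factorial_ne_zero
  have h2 : ((n : ℂ) + 1) ≠ 0 := by exact_mod_cast n.succ_ne_zero
  rw [Nat.factorial_succ]
  push_cast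
  field_simp

theorem sym_letter_mul_pow (j : Fin 3) (n : ℕ) : sym (letter j * letter 0 ^ n) =
    ((n : ℂ) + 1)⁻¹ • sandwich (gen 0) n (gen j) := by
  rw [← symWord_cons_replicate, ← sym_prod_letter]
  simp

theorem sandwich_self {R : Type*} [Ring R] [Algebra ℂ R] (x : R) (n : ℕ) :
    sandwich x n x = ((n : ℂ) + 1) • x ^ (n + 1) := by
  induction n with
  | zero => simp [sandwich_zero]
  | succ n ih =>
    rw [sandwich_succ, ih, mul_smul_comm, ← pow_succ']
    push_cast
    module

theorem sym_pow (n : ℕ) : sym (letter 0 ^ (n + 1)) = gen 0 ^ (n + 1) := by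
  have h2 : ((n : ℂ) + 1) ≠ 0 := by exact_mod_cast n.succ_ne_zero
  rw [pow_succ', sym_letter_mul_pow, sandwich_self, smul_smul, inv_mul_cancel₀ h2, one_smul]

theorem sym_letter (j : Fin 3) : sym (letter j) = gen j := by
  simpa [sandwich_zero] using sym_letter_mul_pow j 0

theorem sym_one : sym 1 = 1 := by
  simpa [symWord] using sym_prod_letter []

theorem sym_linearPoly (r s t : ℂ) :
    sym (linearPoly r s t) = r • gen 0 + s • gen 1 + t • gen 2 := by
  simp only [linearPoly, map_add, map_smul]
  rw [← sym_letter, ← sym_letter, ← sym_letter]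

/-! ### Symmetrization of power series -/

theorem isZLinear_symZ : IsZLinear symZ := IsZLinear.mk_coeff sym

theorem coeff_symZ (n : ℕ) (g : Poly⟦X⟧) :
    PowerSeries.coeff n (symZ g) = sym (PowerSeries.coeff n g) := by simp [symZ]

theorem symZ_C (g : Poly) : symZ (PowerSeries.C g) = PowerSeries.C (sym g) := by
  ext n
  rw [coeff_symZ, PowerSeries.coeff_C, PowerSeries.coeff_C]
  split_ifs <;> simp

theorem symZ_smul (c : ℂ) (g : Poly⟦X⟧) : symZ (c • g) = c • symZ g := by
  ext n
  simp [coeff_symZ]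

theorem symZ_shc (t : ℂ) : symZ (shc t (letter 0)) = shc t (gen 0) := by
  ext n
  rw [coeff_symZ, coeff_shc, coeff_shc]
  split_ifs
  · rw [map_smul, sym_pow]
  · simp

theorem sinhDivZ_smul (t : ℂ) (x : Poly) : sinhDivZ (t • x) = t • shc t x := by
  ext1 n
  rw [sinhDivZ, PowerSeries.coeff_mk, PowerSeries.coeff_smul, coeff_shc]
  split_ifs
  · rw [smul_pow, smul_smul, smul_smul]
    congr 1
    ring
  · simp

theorem sinhDivZ_eq (x : Poly) : sinhDivZ x = shc 1 x := by
  simpa using sinhDivZ_smul 1 x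

theorem sandwich_smul {R : Type*} [Ring R] [Algebra ℂ R] (t : ℂ) (x y : R) (n : ℕ) :
    sandwich (t • x) n y = t ^ n • sandwich x n y := by
  rw [sandwich_apply, sandwich_apply, Finset.smul_sum]
  refine Finset.sum_congr rfl fun ij hij => ?_
  rw [← Finset.HasAntidiagonal.mem_antidiagonal.1 hij, smul_pow, smul_pow, pow_add]
  simp [smul_smul, mul_comm]

/-- Averaging over ±t keeps the even orders, and there the weight 1/(n+1) of the symmetrization and
1/n! of cosh combine into the 1/(n+1)! of `symE`. -/
theorem symZ_mul_coshZ (j : Fin 3) (t : ℂ) :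
    symZ (PowerSeries.C (letter j) * coshZ (t • letter 0)) =
      (2⁻¹ : ℂ) • (symE (t • gen 0) (PowerSeries.C (gen j)) +
        symE (-(t • gen 0)) (PowerSeries.C (gen j))) := by
  ext n
  rw [coeff_symZ, PowerSeries.coeff_C_mul, PowerSeries.coeff_smul, map_add, coeff_symE_C,
    coeff_symE_C, coshZ, PowerSeries.coeff_mk, ← neg_smul, sandwich_smul, sandwich_smul]
  split_ifs with h
  · rw [h.neg_pow, ← two_smul ℂ (_ • _), smul_smul, mul_smul_comm, map_smul, smul_pow,
      mul_smul_comm, map_smul, sym_letter_mul_pow]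
    simp only [smul_smul]
    congr 1
    have h1 : (n.factorial : ℂ) ≠ 0 := by exact_mod_cast n.factorial_ne_zero
    have h2 : ((n : ℂ) + 1) ≠ 0 := by exact_mod_cast n.succ_ne_zero
    rw [Nat.factorial_succ]
    push_cast
    field_simp
  · rw [(Nat.not_even_iff_odd.1 h).neg_pow]
    simp

end

section

/-! ### The coproduct on the free algebra -/

section AlgHoms

variable {R S : Type*} [Ring R] [Algebra ℂ R] [Ring S] [Algebra ℂ S]

/-- The constant power series, as an algebra homomorphism. -/
def constHom (R : Type*) [Ring R] [Algebra ℂ R] : R →ₐ[ℂ] R⟦X⟧ where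
  __ := (PowerSeries.C : R →+* R⟦X⟧)
  commutes' c := by rw [PowerSeries.algebraMap_apply]; rfl

@[simp] theorem constHom_apply (r : R) : constHom R r = PowerSeries.C r := rfl

/-- An algebra homomorphism, applied to every coefficient. -/
def mapHom (φ : R →ₐ[ℂ] S) : R⟦X⟧ →ₐ[ℂ] S⟦X⟧ where
  __ := PowerSeries.map (φ : R →+* S)
  commutes' c := by
    rw [PowerSeries.algebraMap_apply, PowerSeries.algebraMap_apply]
    exact (PowerSeries.map_C _ _).trans (congrArg _ (φ.commutes c))

theorem coeff_mapHom (φ : R →ₐ[ℂ] S) (n : ℕ) (p : R⟦X⟧) :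
    PowerSeries.coeff n (mapHom φ p) = φ (PowerSeries.coeff n p) := PowerSeries.coeff_map _ _ _

@[simp] theorem mapHom_C (φ : R →ₐ[ℂ] S) (r : R) :
    mapHom φ (PowerSeries.C r) = PowerSeries.C (φ r) := PowerSeries.map_C _ _

theorem mapHom_expZ (φ : R →ₐ[ℂ] S) (x : R) : mapHom φ (expZ x) = expZ (φ x) := by
  ext n
  simp [coeff_mapHom, coeff_expZ]

@[simp] theorem constantCoeff_expZ (x : R) : PowerSeries.constantCoeff (expZ x) = 1 := by
  rw [← PowerSeries.coeff_zero_eq_constantCoeff_apply, coeff_expZ]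
  simp

theorem isZLinear_mapHom (φ : R →ₐ[ℂ] S) : IsZLinear (mapHom φ) := IsZLinear.ringHom_map _

/-- `extHom` as an algebra homomorphism. -/
def extAlgHom (ψ : R →ₐ[ℂ] S⟦X⟧) : R⟦X⟧ →ₐ[ℂ] S⟦X⟧ where
  __ := extHom ψ
  commutes' c := by
    rw [PowerSeries.algebraMap_apply]
    exact (extHom_C ψ _).trans (ψ.commutes c)

variable (T : Type*) [Ring T] [Algebra ℂ T]

/-- The shape `exp(t z a) b + c exp(-t z d)` of the coproducts of the generators. -/
def twist (t : ℂ) (a b c d : R) : R⟦X⟧ :=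
  expZ (t • a) * PowerSeries.C b + PowerSeries.C c * expZ (-(t • d))

theorem coeff_zero_twist (t : ℂ) (a b c d : R) :
    PowerSeries.coeff 0 (twist t a b c d) = b + c := by
  simp [twist]

theorem coeff_one_twist (t : ℂ) (a b c d : R) : PowerSeries.coeff 1 (twist t a b c d) =
      t • (a * b - c * d) := by
  rw [twist, map_add, PowerSeries.coeff_mul_C, PowerSeries.coeff_C_mul, coeff_expZ, coeff_expZ]
  simp [sub_eq_add_neg]

theorem extHom_twist (ψ : R →ₐ[ℂ] S⟦X⟧) (t : ℂ) {a d : R} (b c : R) {a' d' : S}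
    (ha : ψ a = PowerSeries.C a') (hd : ψ d = PowerSeries.C d') :
    extHom ψ (twist t a b c d) = expZ (t • a') * ψ b + ψ c * expZ (-(t • d')) := by
  rw [twist, map_add, map_mul, map_mul, extHom_C, extHom_C, extHom_expZ ψ (y := t • a'),
    extHom_expZ ψ (y := -(t • d'))]
  · rw [map_neg, map_smul, hd, map_neg, C_smul]
  · rw [map_smul, ha, C_smul]

theorem mapHom_twist (φ : R →ₐ[ℂ] S) (t : ℂ) (a b c d : R) :
    mapHom φ (twist t a b c d) = twist t (φ a) (φ b) (φ c) (φ d) := by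
  rw [twist, map_add, map_mul, map_mul, mapHom_C, mapHom_C, mapHom_expZ, mapHom_expZ, map_neg,
    map_smul, map_smul, twist]

/-- An algebra homomorphism, applied to every coefficient, combined with `z ↦ -z`. -/
def signHom (φ : R →ₐ[ℂ] S) : R⟦X⟧ →ₐ[ℂ] S⟦X⟧ where
  toFun p := PowerSeries.mk fun n => ((-1 : ℂ) ^ n) • φ (PowerSeries.coeff n p)
  map_one' := by
    ext n
    rw [PowerSeries.coeff_mk, PowerSeries.coeff_one, PowerSeries.coeff_one]
    split_ifs with h <;> simp [h]
  map_mul' p q := by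
    ext n
    rw [PowerSeries.coeff_mk, PowerSeries.coeff_mul, PowerSeries.coeff_mul, map_sum,
      Finset.smul_sum]
    refine Finset.sum_congr rfl fun ij hij => ?_
    rw [PowerSeries.coeff_mk, PowerSeries.coeff_mk, smul_mul_smul_comm, ← pow_add,
      Finset.HasAntidiagonal.mem_antidiagonal.1 hij, map_mul]
  map_zero' := by
    ext n
    simp
  map_add' p q := by
    ext n
    simp
  commutes' c := by
    ext n
    rw [PowerSeries.algebraMap_apply, PowerSeries.algebraMap_apply, PowerSeries.coeff_mk,
      PowerSeries.coeff_C, PowerSeries.coeff_C]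
    split_ifs with h <;> simp [h]

theorem coeff_signHom (φ : R →ₐ[ℂ] S) (n : ℕ) (p : R⟦X⟧) :
    PowerSeries.coeff n (signHom φ p) = ((-1 : ℂ) ^ n) • φ (PowerSeries.coeff n p) :=
  PowerSeries.coeff_mk n fun n => ((-1 : ℂ) ^ n) • φ (PowerSeries.coeff n p)

theorem signHom_expZ (φ : R →ₐ[ℂ] S) (x : R) : signHom φ (expZ x) = expZ (-φ x) := by
  ext n
  rw [coeff_signHom, coeff_expZ, coeff_expZ, map_smul, map_pow, ← neg_one_smul ℂ (φ x), smul_pow,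
    smul_comm]

theorem signHom_C (φ : R →ₐ[ℂ] S) (x : R) :
    signHom φ (PowerSeries.C x) = PowerSeries.C (φ x) := by
  ext n
  rw [coeff_signHom, PowerSeries.coeff_C, PowerSeries.coeff_C]
  split_ifs with h <;> simp [h]

theorem signHom_twist (φ : R →ₐ[ℂ] S) (t : ℂ) (a b c d : R) {a' b' c' d' : S} (ha : φ a = a')
    (hb : φ b = b') (hc : φ c = c') (hd : φ d = d') (hdc : Commute d' c') (hba : Commute b' a') :
    signHom φ (twist t a b c d) = twist t d' c' b' a' := by
  rw [twist, map_add, map_mul, map_mul, signHom_C, signHom_C, signHom_expZ, signHom_expZ, map_neg,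
    neg_neg, map_smul, map_smul, ha, hb, hc, hd, twist, add_comm,
    (commute_C_expZ (hba.smul_right t).neg_right).eq, (commute_C_expZ (hdc.symm.smul_right t)).eq]

/-- Both sides expand to e^(a₁+a₂) b₃ + e^(a₁) b₂ e^(-a₃) + b₁ e^(-a₂-a₃), with factors tz in the
exponents. This is coassociativity for B and C at once. -/
theorem twist_assoc (t : ℂ) {a₁ a₂ a₃ : R} (b₁ b₂ b₃ : R) (h₁₂ : Commute a₁ a₂)
    (h₂₃ : Commute a₂ a₃) :
    expZ (t • (a₂ + a₁)) * PowerSeries.C b₃ + twist t a₁ b₂ b₁ a₂ * expZ (-(t • a₃)) =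
      expZ (t • a₁) * twist t a₂ b₃ b₂ a₃ + PowerSeries.C b₁ * expZ (-(t • (a₃ + a₂))) := by
  have h : Commute (t • a₁) (t • a₂) := (h₁₂.smul_left t).smul_right t
  have h' : Commute (-(t • a₂)) (-(t • a₃)) := ((h₂₃.smul_left t).smul_right t).neg_left.neg_right
  rw [add_comm a₂, add_comm a₃, smul_add, smul_add, neg_add, expZ_add h, expZ_add h', twist, twist]
  noncomm_ring

theorem commute_includeLeft_includeRight (s : S) (t : T) :
    Commute (s ⊗ₜ[ℂ] (1 : T)) ((1 : S) ⊗ₜ[ℂ] t) := by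
  rw [Commute, SemiconjBy, Algebra.TensorProduct.tmul_mul_tmul,
    Algebra.TensorProduct.tmul_mul_tmul, one_mul, one_mul, mul_one, mul_one]

/-- `ψ ⊗ id`. -/
def rTensorHom (ψ : R →ₐ[ℂ] S⟦X⟧) : R ⊗[ℂ] T →ₐ[ℂ] (S ⊗[ℂ] T)⟦X⟧ :=
  Algebra.TensorProduct.lift
    ((mapHom (Algebra.TensorProduct.includeLeft : S →ₐ[ℂ] S ⊗[ℂ] T)).comp ψ)
    ((constHom (S ⊗[ℂ] T)).comp Algebra.TensorProduct.includeRight) fun x y =>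
      (commute_C_of_coeff fun n => by
        rw [AlgHom.comp_apply, coeff_mapHom]
        exact (commute_includeLeft_includeRight T _ _).symm).symm

/-- `id ⊗ ψ`. -/
def lTensorHom (ψ : R →ₐ[ℂ] S⟦X⟧) : T ⊗[ℂ] R →ₐ[ℂ] (T ⊗[ℂ] S)⟦X⟧ :=
  Algebra.TensorProduct.lift
    ((constHom (T ⊗[ℂ] S)).comp Algebra.TensorProduct.includeLeft)
    ((mapHom (Algebra.TensorProduct.includeRight : S →ₐ[ℂ] T ⊗[ℂ] S)).comp ψ) fun x y =>
      (commute_C_of_coeff fun n => by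
        rw [AlgHom.comp_apply, coeff_mapHom]
        exact commute_includeLeft_includeRight S _ _)

theorem rTensorHom_tmul (ψ : R →ₐ[ℂ] S⟦X⟧) (x : R) (y : T) : rTensorHom T ψ (x ⊗ₜ y) =
    mapHom (Algebra.TensorProduct.includeLeft : S →ₐ[ℂ] S ⊗[ℂ] T) (ψ x) *
      PowerSeries.C (1 ⊗ₜ y) := Algebra.TensorProduct.lift_tmul _ _ _ _ _

theorem lTensorHom_tmul (ψ : R →ₐ[ℂ] S⟦X⟧) (x : R) (y : T) : lTensorHom T ψ (y ⊗ₜ x) =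
    PowerSeries.C (y ⊗ₜ 1) *
      mapHom (Algebra.TensorProduct.includeRight : S →ₐ[ℂ] T ⊗[ℂ] S) (ψ x) :=
  Algebra.TensorProduct.lift_tmul _ _ _ _ _

end AlgHoms

/-! ### Coassociativity, flip symmetry and first order of the coproduct. -/

theorem free_hom_ext {S : Type*} [Ring S] [Algebra ℂ S] {f g : Free →ₐ[ℂ] S}
    (h : ∀ i, f (gen i) = g (gen i)) : f = g := FreeAlgebra.hom_ext (funext h)

@[simp] theorem coprod_gen (ρ : ℂ) (i : Fin 3) : coprod ρ (gen i) = coprodGen ρ i := by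
  simp [coprod, gen]

theorem coprodGen_zero (ρ : ℂ) :
    coprodGen ρ 0 = PowerSeries.C (1 ⊗ₜ gen 0 + gen 0 ⊗ₜ 1) := rfl

theorem coprodGen_one (ρ : ℂ) : coprodGen ρ 1 =
    twist 1 (gen 0 ⊗ₜ 1) (1 ⊗ₜ gen 1) (gen 1 ⊗ₜ 1) (1 ⊗ₜ gen 0) := by
  rw [twist, one_smul, one_smul]
  rfl

theorem coprodGen_two (ρ : ℂ) : coprodGen ρ 2 =
    twist ρ (gen 0 ⊗ₜ 1) (1 ⊗ₜ gen 2) (gen 2 ⊗ₜ 1) (1 ⊗ₜ gen 0) := rfl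

/-- `Δ ⊗ id` on constants. -/
def coprodTensorIdHom (ρ : ℂ) : Free ⊗[ℂ] Free →ₐ[ℂ] ((Free ⊗[ℂ] Free) ⊗[ℂ] Free)⟦X⟧ :=
  rTensorHom Free (coprod ρ)

/-- `id ⊗ Δ` on constants. -/
def idTensorCoprodHom (ρ : ℂ) : Free ⊗[ℂ] Free →ₐ[ℂ] (Free ⊗[ℂ] (Free ⊗[ℂ] Free))⟦X⟧ :=
  lTensorHom Free (coprod ρ)

theorem coprodTensorIdHom_right (ρ : ℂ) (x : Free) :
    coprodTensorIdHom ρ (1 ⊗ₜ x) = PowerSeries.C (1 ⊗ₜ x) := by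
  rw [coprodTensorIdHom, rTensorHom_tmul, map_one, map_one, one_mul]

theorem coprodTensorIdHom_left (ρ : ℂ) (i : Fin 3) : coprodTensorIdHom ρ (gen i ⊗ₜ 1) =
    mapHom (R := Free ⊗[ℂ] Free) (S := (Free ⊗[ℂ] Free) ⊗[ℂ] Free)
      Algebra.TensorProduct.includeLeft (coprodGen ρ i) := by
  rw [coprodTensorIdHom, rTensorHom_tmul, coprod_gen, ← Algebra.TensorProduct.one_def, map_one,
    mul_one]

theorem idTensorCoprodHom_left (ρ : ℂ) (x : Free) :
    idTensorCoprodHom ρ (x ⊗ₜ 1) = PowerSeries.C (x ⊗ₜ 1) := by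
  rw [idTensorCoprodHom, lTensorHom_tmul, map_one, map_one, mul_one]

theorem idTensorCoprodHom_right (ρ : ℂ) (i : Fin 3) : idTensorCoprodHom ρ (1 ⊗ₜ gen i) =
    mapHom (R := Free ⊗[ℂ] Free) (S := Free ⊗[ℂ] (Free ⊗[ℂ] Free))
      Algebra.TensorProduct.includeRight (coprodGen ρ i) := by
  rw [idTensorCoprodHom, lTensorHom_tmul, coprod_gen, ← Algebra.TensorProduct.one_def, map_one,
    one_mul]

/-- The map given coefficientwise is the continuous extension of an algebra homomorphism. This
multiplicativity is what makes a check on generators sufficient. -/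
theorem coprodTensorId_eq (ρ : ℂ) (p : (Free ⊗[ℂ] Free)⟦X⟧) :
    coprodTensorId ρ p = extHom (coprodTensorIdHom ρ) p := by
  rw [extHom_apply, coprodTensorId]
  congr 1
  funext n
  refine TensorProduct.ext' fun x y => ?_
  simp [coeffMap, coprodTensorIdHom, rTensorHom_tmul, coeff_mapHom, coprodCoeff,
    PowerSeries.coeff_mul_C]

theorem idTensorCoprod_eq (ρ : ℂ) (p : (Free ⊗[ℂ] Free)⟦X⟧) :
    idTensorCoprod ρ p = extHom (idTensorCoprodHom ρ) p := by
  rw [extHom_apply, idTensorCoprod]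
  congr 1
  funext n
  refine TensorProduct.ext' fun x y => ?_
  simp [coeffMap, idTensorCoprodHom, lTensorHom_tmul, coeff_mapHom, coprodCoeff,
    PowerSeries.coeff_C_mul]

/-- The associativity isomorphism. -/
def assocHom : (Free ⊗[ℂ] Free) ⊗[ℂ] Free →ₐ[ℂ] Free ⊗[ℂ] (Free ⊗[ℂ] Free) :=
  (Algebra.TensorProduct.assoc ℂ ℂ ℂ Free Free Free).toAlgHom

@[simp] theorem assocHom_tmul (x y z : Free) :
    assocHom ((x ⊗ₜ y) ⊗ₜ z) = x ⊗ₜ (y ⊗ₜ z) := rfl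

theorem assocZ_eq (p : ((Free ⊗[ℂ] Free) ⊗[ℂ] Free)⟦X⟧) : assocZ p =
    mapHom assocHom p := by
  ext n
  rw [assocZ, PowerSeries.coeff_mk]
  exact (coeff_mapHom (S := Free ⊗[ℂ] (Free ⊗[ℂ] Free)) assocHom n p).symm

theorem coprodTensorIdHom_twist (ρ t : ℂ) (i : Fin 3)
    (hi : coprodGen ρ i = twist t (gen 0 ⊗ₜ 1) (1 ⊗ₜ gen i) (gen i ⊗ₜ 1) (1 ⊗ₜ gen 0)) :
    extHom (S := (Free ⊗[ℂ] Free) ⊗[ℂ] Free) (coprodTensorIdHom ρ) (coprodGen ρ i) =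
      expZ (R := (Free ⊗[ℂ] Free) ⊗[ℂ] Free) (t • ((1 ⊗ₜ gen 0 + gen 0 ⊗ₜ 1) ⊗ₜ 1)) *
          PowerSeries.C (1 ⊗ₜ gen i) +
        twist (R := (Free ⊗[ℂ] Free) ⊗[ℂ] Free) t ((gen 0 ⊗ₜ 1) ⊗ₜ 1) ((1 ⊗ₜ gen i) ⊗ₜ 1)
          ((gen i ⊗ₜ 1) ⊗ₜ 1) ((1 ⊗ₜ gen 0) ⊗ₜ 1) *
          expZ (-(t • (1 ⊗ₜ gen 0))) := by
  have h := extHom_twist (R := Free ⊗[ℂ] Free) (S := (Free ⊗[ℂ] Free) ⊗[ℂ] Free)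
    (coprodTensorIdHom ρ) t (a := gen 0 ⊗ₜ 1) (d := 1 ⊗ₜ gen 0) (1 ⊗ₜ gen i) (gen i ⊗ₜ 1)
    (a' := (1 ⊗ₜ gen 0 + gen 0 ⊗ₜ 1) ⊗ₜ 1) (d' := 1 ⊗ₜ gen 0)
    ((coprodTensorIdHom_left ρ 0).trans (mapHom_C _ _)) (coprodTensorIdHom_right ρ (gen 0))
  rw [coprodTensorIdHom_right, coprodTensorIdHom_left, hi, mapHom_twist] at h
  rw [hi]
  exact h

theorem idTensorCoprodHom_twist (ρ t : ℂ) (i : Fin 3)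
    (hi : coprodGen ρ i = twist t (gen 0 ⊗ₜ 1) (1 ⊗ₜ gen i) (gen i ⊗ₜ 1) (1 ⊗ₜ gen 0)) :
    extHom (S := Free ⊗[ℂ] (Free ⊗[ℂ] Free)) (idTensorCoprodHom ρ) (coprodGen ρ i) =
      expZ (R := Free ⊗[ℂ] (Free ⊗[ℂ] Free)) (t • (gen 0 ⊗ₜ 1)) *
        twist (R := Free ⊗[ℂ] (Free ⊗[ℂ] Free)) t (1 ⊗ₜ (gen 0 ⊗ₜ 1)) (1 ⊗ₜ (1 ⊗ₜ gen i))
          (1 ⊗ₜ (gen i ⊗ₜ 1)) (1 ⊗ₜ (1 ⊗ₜ gen 0)) +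
        PowerSeries.C (gen i ⊗ₜ 1) * expZ (-(t • (1 ⊗ₜ (1 ⊗ₜ gen 0 + gen 0 ⊗ₜ 1)))) := by
  have h := extHom_twist (R := Free ⊗[ℂ] Free) (S := Free ⊗[ℂ] (Free ⊗[ℂ] Free))
    (idTensorCoprodHom ρ) t (a := gen 0 ⊗ₜ 1) (d := 1 ⊗ₜ gen 0) (1 ⊗ₜ gen i) (gen i ⊗ₜ 1)
    (a' := gen 0 ⊗ₜ 1) (d' := 1 ⊗ₜ (1 ⊗ₜ gen 0 + gen 0 ⊗ₜ 1))
    (idTensorCoprodHom_left ρ (gen 0)) ((idTensorCoprodHom_right ρ 0).trans (mapHom_C _ _))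
  rw [idTensorCoprodHom_right, idTensorCoprodHom_left, hi, mapHom_twist] at h
  rw [hi]
  exact h

theorem coassoc_of_twist (ρ t : ℂ) (i : Fin 3)
    (hi : coprodGen ρ i = twist t (gen 0 ⊗ₜ 1) (1 ⊗ₜ gen i) (gen i ⊗ₜ 1) (1 ⊗ₜ gen 0)) :
    mapHom (S := Free ⊗[ℂ] (Free ⊗[ℂ] Free)) assocHom
      (extHom (S := (Free ⊗[ℂ] Free) ⊗[ℂ] Free) (coprodTensorIdHom ρ) (coprodGen ρ i)) =
    extHom (S := Free ⊗[ℂ] (Free ⊗[ℂ] Free)) (idTensorCoprodHom ρ) (coprodGen ρ i) := by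
  have h := congrArg (mapHom (R := (Free ⊗[ℂ] Free) ⊗[ℂ] Free) (S := Free ⊗[ℂ] (Free ⊗[ℂ] Free))
    assocHom) (coprodTensorIdHom_twist ρ t i hi)
  rw [map_add, map_mul, map_mul, mapHom_expZ, mapHom_expZ, mapHom_twist, mapHom_C,
    map_neg assocHom, map_smul assocHom, map_smul assocHom] at h
  refine h.trans (Eq.trans ?_ (idTensorCoprodHom_twist ρ t i hi).symm)
  have h₁₂ : Commute (gen 0 ⊗ₜ[ℂ] (1 : Free ⊗[ℂ] Free))
      ((1 : Free) ⊗ₜ[ℂ] (gen 0 ⊗ₜ[ℂ] (1 : Free))) := commute_includeLeft_includeRight _ _ _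
  have h₂₃ : Commute ((1 : Free) ⊗ₜ[ℂ] (gen 0 ⊗ₜ[ℂ] (1 : Free)))
      ((1 : Free) ⊗ₜ[ℂ] ((1 : Free) ⊗ₜ[ℂ] gen 0)) :=
    (commute_includeLeft_includeRight Free (gen 0) (gen 0)).map
      (Algebra.TensorProduct.includeRight : Free ⊗[ℂ] Free →ₐ[ℂ] Free ⊗[ℂ] (Free ⊗[ℂ] Free))
  have h' := twist_assoc (R := Free ⊗[ℂ] (Free ⊗[ℂ] Free)) t (gen i ⊗ₜ 1)
    (1 ⊗ₜ (gen i ⊗ₜ 1)) (1 ⊗ₜ (1 ⊗ₜ gen i)) h₁₂ h₂₃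
  rw [← TensorProduct.tmul_add] at h'
  rw [TensorProduct.add_tmul, map_add]
  exact h'

theorem coassoc_zero (ρ : ℂ) :
    mapHom (R := (Free ⊗[ℂ] Free) ⊗[ℂ] Free) (S := Free ⊗[ℂ] (Free ⊗[ℂ] Free)) assocHom
      (extHom (S := (Free ⊗[ℂ] Free) ⊗[ℂ] Free) (coprodTensorIdHom ρ) (coprodGen ρ 0)) =
    extHom (S := Free ⊗[ℂ] (Free ⊗[ℂ] Free)) (idTensorCoprodHom ρ) (coprodGen ρ 0) := by
  have hl : extHom (S := (Free ⊗[ℂ] Free) ⊗[ℂ] Free) (coprodTensorIdHom ρ) (coprodGen ρ 0) =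
      PowerSeries.C (1 ⊗ₜ gen 0 + (1 ⊗ₜ gen 0 + gen 0 ⊗ₜ 1) ⊗ₜ 1) := by
    rw [coprodGen_zero, extHom_C, map_add, coprodTensorIdHom_right, coprodTensorIdHom_left,
      coprodGen_zero, mapHom_C, map_add PowerSeries.C]
    rfl
  have hr : extHom (S := Free ⊗[ℂ] (Free ⊗[ℂ] Free)) (idTensorCoprodHom ρ) (coprodGen ρ 0) =
      PowerSeries.C (1 ⊗ₜ (1 ⊗ₜ gen 0 + gen 0 ⊗ₜ 1) + gen 0 ⊗ₜ 1) := by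
    rw [coprodGen_zero, extHom_C, map_add, idTensorCoprodHom_right, idTensorCoprodHom_left,
      coprodGen_zero, mapHom_C, map_add PowerSeries.C]
    rfl
  have e : assocHom (1 ⊗ₜ gen 0 + (1 ⊗ₜ gen 0 + gen 0 ⊗ₜ 1) ⊗ₜ 1) =
      1 ⊗ₜ (1 ⊗ₜ gen 0 + gen 0 ⊗ₜ 1) + gen 0 ⊗ₜ 1 := by
    rw [map_add, TensorProduct.add_tmul, map_add, Algebra.TensorProduct.one_def, assocHom_tmul,
      assocHom_tmul, assocHom_tmul, TensorProduct.tmul_add, add_assoc]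
  rw [hl, hr, ← e]
  exact mapHom_C (R := (Free ⊗[ℂ] Free) ⊗[ℂ] Free) (S := Free ⊗[ℂ] (Free ⊗[ℂ] Free)) assocHom _

/-- Both composites are z-linear and restrict to algebra homomorphisms on the free algebra, so
agreement on the three generators is enough. -/
theorem isCoassociative (ρ : ℂ) : IsCoassociative ρ := by
  intro p
  simp only [coprodTensorId_eq, idTensorCoprod_eq, assocZ_eq, coprodZ_eq_extHom]
  refine ((isZLinear_mapHom _).comp ((isZLinear_extHom _).comp (isZLinear_extHom _))).ext
    ((isZLinear_extHom _).comp (isZLinear_extHom _)) (fun x => ?_) p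
  rw [extHom_C]
  let f : Free →ₐ[ℂ] (Free ⊗[ℂ] (Free ⊗[ℂ] Free))⟦X⟧ :=
    (mapHom (S := Free ⊗[ℂ] (Free ⊗[ℂ] Free)) assocHom).comp
      ((extAlgHom (R := Free ⊗[ℂ] Free) (S := (Free ⊗[ℂ] Free) ⊗[ℂ] Free)
        (coprodTensorIdHom ρ)).comp (coprod ρ))
  let g : Free →ₐ[ℂ] (Free ⊗[ℂ] (Free ⊗[ℂ] Free))⟦X⟧ :=
    (extAlgHom (R := Free ⊗[ℂ] Free) (S := Free ⊗[ℂ] (Free ⊗[ℂ] Free))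
      (idTensorCoprodHom ρ)).comp (coprod ρ)
  suffices h : f = g from DFunLike.congr_fun h x
  refine free_hom_ext (S := (Free ⊗[ℂ] (Free ⊗[ℂ] Free))⟦X⟧) fun i => ?_
  change mapHom (R := (Free ⊗[ℂ] Free) ⊗[ℂ] Free) (S := Free ⊗[ℂ] (Free ⊗[ℂ] Free)) assocHom
    (extHom (S := (Free ⊗[ℂ] Free) ⊗[ℂ] Free) (coprodTensorIdHom ρ) (coprod ρ (gen i))) =
    extHom (S := Free ⊗[ℂ] (Free ⊗[ℂ] Free)) (idTensorCoprodHom ρ) (coprod ρ (gen i))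
  rw [coprod_gen]
  match i with
  | 0 => exact coassoc_zero ρ
  | 1 => exact coassoc_of_twist ρ 1 1 (coprodGen_one ρ)
  | 2 => exact coassoc_of_twist ρ ρ 2 (coprodGen_two ρ)

/-- The flip of the tensor factors. -/
def commHom : Free ⊗[ℂ] Free →ₐ[ℂ] Free ⊗[ℂ] Free :=
  (Algebra.TensorProduct.comm ℂ Free Free).toAlgHom

@[simp] theorem commHom_tmul (x y : Free) : commHom (x ⊗ₜ y) = y ⊗ₜ x := rfl

/-- The flip combined with z ↦ -z is itself an algebra homomorphism, and it exchanges e^(tzA) ⊗ X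
with X ⊗ e^(-tzA). So only generators matter. -/
theorem flipNeg_coprod (ρ : ℂ) (x : Free) : flipNeg (coprod ρ x) = coprod ρ x := by
  let f : Free →ₐ[ℂ] (Free ⊗[ℂ] Free)⟦X⟧ :=
    (signHom (R := Free ⊗[ℂ] Free) (S := Free ⊗[ℂ] Free) commHom).comp (coprod ρ)
  suffices h : f = coprod ρ from DFunLike.congr_fun h x
  have key : ∀ (t : ℂ) (i : Fin 3),
      coprodGen ρ i = twist t (gen 0 ⊗ₜ 1) (1 ⊗ₜ gen i) (gen i ⊗ₜ 1) (1 ⊗ₜ gen 0) →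
      signHom (R := Free ⊗[ℂ] Free) (S := Free ⊗[ℂ] Free) commHom (coprodGen ρ i) =
        coprodGen ρ i := by
    intro t i hi
    have h := (congrArg (signHom (R := Free ⊗[ℂ] Free) (S := Free ⊗[ℂ] Free) commHom) hi).trans
      (signHom_twist (S := Free ⊗[ℂ] Free) commHom t (gen 0 ⊗ₜ 1) (1 ⊗ₜ gen i)
        (gen i ⊗ₜ 1) (1 ⊗ₜ gen 0) (a' := 1 ⊗ₜ gen 0) (b' := gen i ⊗ₜ 1)
        (c' := 1 ⊗ₜ gen i) (d' := gen 0 ⊗ₜ 1) rfl rfl rfl rfl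
        (commute_includeLeft_includeRight _ _ _) (commute_includeLeft_includeRight _ _ _))
    exact h.trans hi.symm
  refine free_hom_ext (S := (Free ⊗[ℂ] Free)⟦X⟧) fun i => ?_
  change signHom (R := Free ⊗[ℂ] Free) (S := Free ⊗[ℂ] Free) commHom (coprod ρ (gen i)) = _
  rw [coprod_gen]
  fin_cases i
  · ext n
    refine (coeff_signHom (S := Free ⊗[ℂ] Free) commHom n (coprodGen ρ 0)).trans ?_
    simp only [coprodGen_zero, PowerSeries.coeff_C, Fin.zero_eta]
    split_ifs with h
    · subst h
      rw [map_add, commHom_tmul, commHom_tmul, pow_zero, one_smul, add_comm]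
    · rw [map_zero, smul_zero]
  · exact key 1 1 (coprodGen_one ρ)
  · exact key ρ 2 (coprodGen_two ρ)

theorem coeff_coprod_gen (ρ : ℂ) (i : Fin 3) :
    PowerSeries.coeff 0 (coprod ρ (gen i)) = 1 ⊗ₜ gen i + gen i ⊗ₜ 1 ∧
        PowerSeries.coeff 1 (coprod ρ (gen i)) = cocommutator ρ i := by
  rw [coprod_gen]
  fin_cases i
  · simp [coprodGen_zero, cocommutator]
  · refine ⟨(congrArg _ (coprodGen_one ρ)).trans (coeff_zero_twist _ _ _ _ _),
      (congrArg _ (coprodGen_one ρ)).trans ((coeff_one_twist _ _ _ _ _).trans ?_)⟩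
    simp [cocommutator, wedge]
  · refine ⟨(congrArg _ (coprodGen_two ρ)).trans (coeff_zero_twist _ _ _ _ _),
      (congrArg _ (coprodGen_two ρ)).trans ((coeff_one_twist _ _ _ _ _).trans ?_)⟩
    simp [cocommutator, wedge]

end

section

/-! ### The unified family, in an arbitrary algebra -/

section Relations

variable {R S : Type*} [Ring R] [Algebra ℂ R] [Ring S] [Algebra ℂ S]

/-- The value of `[A,B]`. -/
def valAB (k : StructureConstants) (a : R) (b c : R⟦X⟧) : R⟦X⟧ :=
  k.c₁ • shc 1 a + k.c₂ • b + k.c₃ • c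

/-- The value of `[A,C]`. -/
def valAC (ρ : ℂ) (k : StructureConstants) (a : R) (b c : R⟦X⟧) : R⟦X⟧ :=
  -((k.a₂ * ρ) • shc ρ a) + k.b₂ • b - (ρ * k.c₂) • c

/-- The value of `[B,C]`. -/
def valBC (ρ : ℂ) (k : StructureConstants) (a : R) (b c : R⟦X⟧) : R⟦X⟧ :=
  k.a₁ • shc (1 + ρ) a + (k.a₂ * 2⁻¹) • (symE (ρ • a) b + symE (-(ρ • a)) b)
    + (ρ * k.c₁ * 2⁻¹) • (symE a c + symE (-a) c)

theorem commute_symE {x a y : R} (hx : Commute x a) (hy : Commute x y) :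
    Commute (PowerSeries.C x) (symE a (PowerSeries.C y)) :=
  commute_C_of_coeff fun n => by
    rw [coeff_symE_C, sandwich_apply]
    exact (Commute.sum_right _ _ _ fun ij _ =>
      ((hx.pow_right _).mul_right hy).mul_right (hx.pow_right _)).smul_right _

/-- Exponentials of commuting elements. -/
theorem expZ_conj {x y : R} (h : Commute x y) (p : R⟦X⟧) :
    expZ x * p * expZ y - expZ y * p * expZ x = PowerSeries.X * (expZ y *
      symE (x - y) (PowerSeries.C (x - y) * p - p * PowerSeries.C (x - y)) * expZ y) := by
  have h' : Commute y (x - y) := h.symm.sub_right (Commute.refl y)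
  have hx : expZ x = expZ y * expZ (x - y) := by
    rw [← expZ_add h', add_sub_cancel]
  have hx' : expZ x = expZ (x - y) * expZ y := by
    rw [← expZ_add h'.symm, sub_add_cancel]
  have := expZ_commutator (x - y) p
  calc expZ x * p * expZ y - expZ y * p * expZ x
      = expZ y * (expZ (x - y) * p - p * expZ (x - y)) * expZ y := by
        conv_lhs =>
          congr
          · rw [hx]
          · rw [hx']
        noncomm_ring
    _ = _ := by
        rw [this]
        simp only [← mul_assoc]
        rw [PowerSeries.X_mul (φ := expZ y)]

variable {g₁ g₂ : Fin 3 → R}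

/-- In each summand the letter A of the other tensor factor commutes with everything present and
splits off as an exponential. It shifts the existing exponent s by t on one side and by -t on the
other. -/
theorem symE_twist (h : ∀ i j, Commute (g₁ i) (g₂ j)) (s t : ℂ) (i : Fin 3) :
    symE (t • (g₁ 0 + g₂ 0)) (twist s (g₁ 0) (g₂ i) (g₁ i) (g₂ 0)) =
      expZ ((s + t) • g₁ 0) * symE (t • g₂ 0) (PowerSeries.C (g₂ i)) +
        symE (t • g₁ 0) (PowerSeries.C (g₁ i)) * expZ (-((s - t) • g₂ 0)) := by
  have h₀ := h 0 0
  have e₁ : symE (t • (g₁ 0 + g₂ 0)) (PowerSeries.C (g₂ i)) =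
      expZ (t • g₁ 0) * symE (t • g₂ 0) (PowerSeries.C (g₂ i)) := by
    rw [smul_add, symE_add ((h₀.smul_left t).smul_right t) ((h 0 i).smul_left t)]
  have e₂ : symE (t • (g₁ 0 + g₂ 0)) (PowerSeries.C (g₁ i)) =
      symE (t • g₁ 0) (PowerSeries.C (g₁ i)) * expZ (t • g₂ 0) := by
    rw [smul_add, add_comm, symE_add ((h₀.symm.smul_left t).smul_right t)
      ((h i 0).symm.smul_left t)]
    exact (commute_expZ (commute_symE ((h₀.symm.smul_left t).smul_right t)
      ((h i 0).symm.smul_left t))).eq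
  have c₁ : Commute (t • (g₁ 0 + g₂ 0)) (s • g₁ 0) :=
    (((Commute.refl _).add_left h₀.symm).smul_left t).smul_right s
  have c₂ : Commute (t • (g₁ 0 + g₂ 0)) (-(s • g₂ 0)) :=
    ((h₀.add_left (Commute.refl _)).smul_left t).smul_right s |>.neg_right
  rw [twist, (isZLinear_symE _).add, symE_mul_left (commute_C_expZ c₁),
    symE_mul_right (commute_C_expZ c₂), e₁, e₂, ← mul_assoc,
    ← expZ_add (((Commute.refl _).smul_left s).smul_right t), ← add_smul, mul_assoc (symE _ _),
    ← expZ_add (((Commute.refl _).smul_left t).smul_right s).neg_right, ← sub_eq_add_neg,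
    ← sub_smul, ← neg_smul, neg_sub]

theorem expZ_sub_expZ (s t : ℂ) (x : R) :
    expZ ((s + t) • x) - expZ ((s - t) • x) =
      (2 * t) • (PowerSeries.X * (expZ (s • x) * shc t x)) := by
  have c : ∀ u v : ℂ, Commute (u • x) (v • x) := fun u v =>
    ((Commute.refl _).smul_left u).smul_right v
  rw [add_smul, expZ_add (c s t), sub_smul, sub_eq_add_neg (s • x), expZ_add (c s t).neg_right,
    ← mul_sub, ← two_smul_X_mul_shc, mul_smul_comm, ← mul_assoc, ← mul_assoc,
    PowerSeries.X_mul (φ := expZ (s • x))]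

/-- Adding the formula for t and for -t gives the exponents s + t and s - t, while twisted
primitivity would ask for s + t throughout. Replacing e^(s-t) by e^(s+t) costs 2tz e^s `shc t`,
whence the two correction terms. -/
theorem symE_twist_defect (h : ∀ i j, Commute (g₁ i) (g₂ j)) (s t : ℂ) (i : Fin 3) :
    symE (t • (g₁ 0 + g₂ 0)) (twist s (g₁ 0) (g₂ i) (g₁ i) (g₂ 0)) +
      symE (-(t • (g₁ 0 + g₂ 0))) (twist s (g₁ 0) (g₂ i) (g₁ i) (g₂ 0)) =
    expZ ((s + t) • g₁ 0) * (symE (t • g₂ 0) (PowerSeries.C (g₂ i)) +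
        symE (-(t • g₂ 0)) (PowerSeries.C (g₂ i))) +
      (symE (t • g₁ 0) (PowerSeries.C (g₁ i)) + symE (-(t • g₁ 0)) (PowerSeries.C (g₁ i))) *
        expZ (-((s + t) • g₂ 0)) -
      (2 * t) • (PowerSeries.X * (expZ (s • g₁ 0) * shc t (g₁ 0) *
        symE (-(t • g₂ 0)) (PowerSeries.C (g₂ i)))) +
      (2 * t) • (PowerSeries.X * (symE (t • g₁ 0) (PowerSeries.C (g₁ i)) *
        (shc t (g₂ 0) * expZ (-(s • g₂ 0))))) := by
  have e₁ := symE_twist h s t i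
  have e₂ := symE_twist h s (-t) i
  have e₃ := expZ_sub_expZ s t (g₁ 0)
  have e₄ := expZ_sub_expZ (-s) t (g₂ 0)
  rw [neg_smul, neg_smul, neg_smul, ← sub_eq_add_neg, sub_neg_eq_add] at e₂
  have e₅ : -(s - t) = -s + t := by ring
  have e₆ : -(s + t) = -s - t := by ring
  have c : Commute (expZ (-(s • g₂ 0))) (shc t (g₂ 0)) := commute_expZ
    (commute_shc ((Commute.refl _).smul_left s).neg_left t)
  simp only [← neg_smul (s + t), ← neg_smul (s - t), e₅, e₆] at e₁ e₂ ⊢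
  rw [e₁, e₂, ← mul_assoc PowerSeries.X, ← smul_mul_assoc, ← e₃, ← c.eq, ← mul_assoc PowerSeries.X,
    PowerSeries.X_mul, mul_assoc _ PowerSeries.X, ← mul_smul_comm, ← neg_smul s, ← e₄]
  noncomm_ring

/-- Of the eight products, the four within a single factor give the twisted primitive part. The four
mixed ones pair up as e^x w e^y - e^y w e^x, the shape to which `expZ_conj` applies. -/
theorem twist_commutator (h : ∀ i j, Commute (g₁ i) (g₂ j)) (ρ : ℂ) :
    twist 1 (g₁ 0) (g₂ 1) (g₁ 1) (g₂ 0) * twist ρ (g₁ 0) (g₂ 2) (g₁ 2) (g₂ 0) -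
      twist ρ (g₁ 0) (g₂ 2) (g₁ 2) (g₂ 0) * twist 1 (g₁ 0) (g₂ 1) (g₁ 1) (g₂ 0) =
    expZ ((1 + ρ) • g₁ 0) * PowerSeries.C (g₂ 1 * g₂ 2 - g₂ 2 * g₂ 1) +
      PowerSeries.C (g₁ 1 * g₁ 2 - g₁ 2 * g₁ 1) * expZ (-((1 + ρ) • g₂ 0)) +
      ((expZ (g₁ 0) * PowerSeries.C (g₁ 2 * g₂ 1) * expZ (-(ρ • g₂ 0)) -
        expZ (-(ρ • g₂ 0)) * PowerSeries.C (g₁ 2 * g₂ 1) * expZ (g₁ 0)) -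
      (expZ (ρ • g₁ 0) * PowerSeries.C (g₁ 1 * g₂ 2) * expZ (-(g₂ 0)) -
        expZ (-(g₂ 0)) * PowerSeries.C (g₁ 1 * g₂ 2) * expZ (ρ • g₁ 0))) := by
  have ea : expZ ((1 + ρ) • g₁ 0) = expZ (g₁ 0) * expZ (ρ • g₁ 0) := by
    rw [add_smul, one_smul, expZ_add ((Commute.refl _).smul_right ρ)]
  have eb : expZ (-((1 + ρ) • g₂ 0)) = expZ (-(g₂ 0)) * expZ (-(ρ • g₂ 0)) := by
    rw [add_smul, one_smul, neg_add, expZ_add ((Commute.refl _).smul_right ρ).neg_left.neg_right]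
  have k₁ : Commute (expZ (g₁ 0)) (expZ (ρ • g₁ 0)) :=
    commute_expZ (commute_C_expZ ((Commute.refl _).smul_right ρ))
  have k₂ : Commute (expZ (-(g₂ 0))) (expZ (-(ρ • g₂ 0))) :=
    commute_expZ (commute_C_expZ ((Commute.refl _).smul_right ρ).neg_left.neg_right)
  have m : ∀ (t : ℂ) (i : Fin 3), Commute (expZ (t • g₁ 0)) (PowerSeries.C (g₂ i)) := fun t i =>
    commute_expZ (commute_C_C ((h 0 i).smul_left t))
  have n : ∀ (t : ℂ) (i : Fin 3), Commute (expZ (-(t • g₂ 0))) (PowerSeries.C (g₁ i)) := fun t i =>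
    commute_expZ (commute_C_C ((h i 0).symm.smul_left t).neg_left)
  have m₁ := m 1
  have n₁ := n 1
  have k : ∀ i j, Commute (PowerSeries.C (g₁ i)) (PowerSeries.C (g₂ j)) := fun i j =>
    commute_C_C (h i j)
  simp only [one_smul] at m₁ n₁
  rw [ea, eb, twist, twist, one_smul, one_smul]
  simp only [map_mul, map_sub]
  have t₁ := ((m ρ 1).symm).mul_mul_mul_comm (expZ (g₁ 0)) (PowerSeries.C (g₂ 2))
  have t₄ := (n₁ 2).mul_mul_mul_comm (PowerSeries.C (g₁ 1)) (expZ (-(ρ • g₂ 0)))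
  have t₅ := ((m₁ 2).symm).mul_mul_mul_comm (expZ (ρ • g₁ 0)) (PowerSeries.C (g₂ 1))
  have t₈ := (n ρ 1).mul_mul_mul_comm (PowerSeries.C (g₁ 2)) (expZ (-(g₂ 0)))
  rw [k₁.symm.eq] at t₅
  rw [k₂.symm.eq] at t₈
  have t₂ : expZ (g₁ 0) * PowerSeries.C (g₂ 1) * (PowerSeries.C (g₁ 2) * expZ (-(ρ • g₂ 0))) =
      expZ (g₁ 0) * (PowerSeries.C (g₁ 2) * PowerSeries.C (g₂ 1)) * expZ (-(ρ • g₂ 0)) := by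
    rw [(k 2 1).eq]
    simp only [mul_assoc]
  have t₆ : expZ (ρ • g₁ 0) * PowerSeries.C (g₂ 2) * (PowerSeries.C (g₁ 1) * expZ (-(g₂ 0))) =
      expZ (ρ • g₁ 0) * (PowerSeries.C (g₁ 1) * PowerSeries.C (g₂ 2)) * expZ (-(g₂ 0)) := by
    rw [(k 1 2).eq]
    simp only [mul_assoc]
  have t₃ : PowerSeries.C (g₁ 1) * expZ (-(g₂ 0)) * (expZ (ρ • g₁ 0) * PowerSeries.C (g₂ 2)) =
      expZ (-(g₂ 0)) * (PowerSeries.C (g₁ 1) * PowerSeries.C (g₂ 2)) * expZ (ρ • g₁ 0) := by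
    rw [← (n₁ 1).eq, (m ρ 2).eq]
    simp only [mul_assoc]
  have t₇ : PowerSeries.C (g₁ 2) * expZ (-(ρ • g₂ 0)) * (expZ (g₁ 0) * PowerSeries.C (g₂ 1)) =
      expZ (-(ρ • g₂ 0)) * (PowerSeries.C (g₁ 2) * PowerSeries.C (g₂ 1)) * expZ (g₁ 0) := by
    rw [← (n ρ 2).eq, (m₁ 1).eq]
    simp only [mul_assoc]
  simp only [mul_add, add_mul, t₁, t₂, t₃, t₄, t₅, t₆, t₇, t₈, mul_sub, sub_mul]
  abel

/-- The first letter A splits off by `symE_add`, and the exponentials on both sides reverse the sign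
in the remaining `symE` by `expZ_neg_symE`. The result has the form of a correction term in
`symE_twist_defect`. -/
theorem symE_conj_right (h : ∀ i j, Commute (g₁ i) (g₂ j)) (s t u : ℂ) (i : Fin 3) :
    expZ (-(t • g₂ 0)) * symE (s • g₁ 0 + t • g₂ 0) (shc u (g₁ 0) * PowerSeries.C (g₂ i)) *
      expZ (-(t • g₂ 0)) =
    expZ (s • g₁ 0) * shc u (g₁ 0) * symE (-(t • g₂ 0)) (PowerSeries.C (g₂ i)) := by
  have c₀ : ∀ v w : ℂ, Commute (v • g₁ 0) (w • g₂ 0) := fun v w =>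
    ((h 0 0).smul_left v).smul_right w
  have c₁ : Commute (PowerSeries.C (s • g₁ 0 + t • g₂ 0)) (shc u (g₁ 0)) :=
    commute_shc (((Commute.refl _).smul_left s).add_left ((h 0 0).symm.smul_left t)) u
  have c₂ : Commute (expZ (-(t • g₂ 0))) (shc u (g₁ 0)) :=
    commute_expZ (commute_shc ((h 0 0).symm.smul_left t).neg_left u)
  have c₃ : Commute (expZ (-(t • g₂ 0))) (expZ (s • g₁ 0)) :=
    commute_expZ (commute_C_expZ (c₀ s t).symm.neg_left)
  have c₄ : Commute (expZ (s • g₁ 0)) (shc u (g₁ 0)) :=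
    commute_expZ (commute_shc ((Commute.refl _).smul_left s) u)
  rw [symE_mul_left c₁, symE_add (c₀ s t) ((h 0 i).smul_left s), ← expZ_neg_symE, c₄.eq]
  simp only [← mul_assoc]
  rw [c₂.eq, mul_assoc (shc _ _), c₃.eq]
  simp only [mul_assoc]

theorem symE_conj_left (h : ∀ i j, Commute (g₁ i) (g₂ j)) (s t u : ℂ) (i : Fin 3) :
    expZ (-(t • g₂ 0)) * symE (s • g₁ 0 + t • g₂ 0) (PowerSeries.C (g₁ i) * shc u (g₂ 0)) *
      expZ (-(t • g₂ 0)) =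
    symE (s • g₁ 0) (PowerSeries.C (g₁ i)) * (shc u (g₂ 0) * expZ (-(t • g₂ 0))) := by
  have c₀ : ∀ v w : ℂ, Commute (v • g₁ 0) (w • g₂ 0) := fun v w =>
    ((h 0 0).smul_left v).smul_right w
  have c₁ : Commute (PowerSeries.C (s • g₁ 0 + t • g₂ 0)) (shc u (g₂ 0)) :=
    commute_shc (((h 0 0).smul_left s).add_left ((Commute.refl _).smul_left t)) u
  rw [symE_mul_right c₁, add_comm (s • g₁ 0), symE_add (c₀ s t).symm ((h i 0).symm.smul_left t)]
  simp only [← mul_assoc]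
  rw [expZ_neg_mul, one_mul]

/-- The difference of the two sides of the first relation. -/
def relAB (k : StructureConstants) (a : R) (b c : R⟦X⟧) : R⟦X⟧ :=
  PowerSeries.C a * b - b * PowerSeries.C a - valAB k a b c

/-- The difference of the two sides of the second relation. -/
def relAC (ρ : ℂ) (k : StructureConstants) (a : R) (b c : R⟦X⟧) : R⟦X⟧ :=
  PowerSeries.C a * c - c * PowerSeries.C a - valAC ρ k a b c

/-- The difference of the two sides of the third relation. -/
def relBC (ρ : ℂ) (k : StructureConstants) (a : R) (b c : R⟦X⟧) : R⟦X⟧ :=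
  b * c - c * b - valBC ρ k a b c

theorem commutator_twist (h : ∀ i j, Commute (g₁ i) (g₂ j)) (s : ℂ) (i : Fin 3) :
    PowerSeries.C (g₁ 0 + g₂ 0) * twist s (g₁ 0) (g₂ i) (g₁ i) (g₂ 0) -
      twist s (g₁ 0) (g₂ i) (g₁ i) (g₂ 0) * PowerSeries.C (g₁ 0 + g₂ 0) =
    expZ (s • g₁ 0) * PowerSeries.C (g₂ 0 * g₂ i - g₂ i * g₂ 0) +
      PowerSeries.C (g₁ 0 * g₁ i - g₁ i * g₁ 0) * expZ (-(s • g₂ 0)) := by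
  have a₁ : Commute (PowerSeries.C (g₁ 0)) (expZ (s • g₁ 0)) :=
    commute_C_expZ ((Commute.refl _).smul_right s)
  have a₂ : Commute (PowerSeries.C (g₂ 0)) (expZ (s • g₁ 0)) :=
    commute_C_expZ ((h 0 0).symm.smul_right s)
  have a₃ : Commute (PowerSeries.C (g₁ 0)) (expZ (-(s • g₂ 0))) :=
    commute_C_expZ ((h 0 0).smul_right s).neg_right
  have a₄ : Commute (PowerSeries.C (g₂ 0)) (expZ (-(s • g₂ 0))) :=
    commute_C_expZ ((Commute.refl _).smul_right s).neg_right
  have a₅ := commute_C_C (h 0 i)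
  have a₆ := commute_C_C (h i 0)
  rw [twist]
  simp only [mul_add, add_mul, map_add, map_sub, map_mul, mul_sub, sub_mul]
  simp only [← mul_assoc, a₁.eq, a₂.eq]
  simp only [mul_assoc, ← a₃.eq, ← a₄.eq, a₅.eq]
  simp only [← mul_assoc, a₆.eq]
  abel

/-- The commutator, sinh and B all scale with the exponent 1, but C scales with ρ. Hence the
hypothesis that C is absent or ρ = 1. -/
theorem relAB_twist (h : ∀ i j, Commute (g₁ i) (g₂ j)) {ρ : ℂ} {k : StructureConstants}
    (hρ : ρ = 1 ∨ k.c₃ = 0) :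
    relAB k (g₁ 0 + g₂ 0) (twist 1 (g₁ 0) (g₂ 1) (g₁ 1) (g₂ 0))
        (twist ρ (g₁ 0) (g₂ 2) (g₁ 2) (g₂ 0)) =
      expZ (g₁ 0) * relAB k (g₂ 0) (PowerSeries.C (g₂ 1)) (PowerSeries.C (g₂ 2)) +
        relAB k (g₁ 0) (PowerSeries.C (g₁ 1)) (PowerSeries.C (g₁ 2)) * expZ (-(g₂ 0)) := by
  have e := commutator_twist h 1 1
  have e' : k.c₃ • twist ρ (g₁ 0) (g₂ 2) (g₁ 2) (g₂ 0) =
      k.c₃ • twist 1 (g₁ 0) (g₂ 2) (g₁ 2) (g₂ 0) := by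
    rcases hρ with rfl | h0
    · rfl
    · simp [h0]
  simp only [relAB, valAB, e, e', shc_add 1 (h 0 0)]
  simp only [twist, one_smul, mul_sub, sub_mul, mul_add, add_mul, mul_smul_comm, smul_mul_assoc,
    smul_add, map_sub, map_mul]
  abel

theorem relAC_twist (h : ∀ i j, Commute (g₁ i) (g₂ j)) {ρ : ℂ} {k : StructureConstants}
    (hρ : ρ = 1 ∨ k.b₂ = 0) :
    relAC ρ k (g₁ 0 + g₂ 0) (twist 1 (g₁ 0) (g₂ 1) (g₁ 1) (g₂ 0))
        (twist ρ (g₁ 0) (g₂ 2) (g₁ 2) (g₂ 0)) =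
      expZ (ρ • g₁ 0) * relAC ρ k (g₂ 0) (PowerSeries.C (g₂ 1)) (PowerSeries.C (g₂ 2)) +
        relAC ρ k (g₁ 0) (PowerSeries.C (g₁ 1)) (PowerSeries.C (g₁ 2)) * expZ (-(ρ • g₂ 0)) := by
  have e := commutator_twist h ρ 2
  have e' : k.b₂ • twist 1 (g₁ 0) (g₂ 1) (g₁ 1) (g₂ 0) =
      k.b₂ • twist ρ (g₁ 0) (g₂ 1) (g₁ 1) (g₂ 0) := by
    rcases hρ with rfl | h0
    · rfl
    · simp [h0]
  simp only [relAC, valAC, e, e', shc_add ρ (h 0 0)]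
  simp only [twist, mul_sub, sub_mul, mul_add, add_mul, mul_smul_comm, smul_mul_assoc,
    smul_add, map_sub, map_mul, mul_neg, neg_mul]
  abel

/-- The element on the left is the difference of the exponents in the first mixed term of
`twist_commutator`. Modulo relations its commutator with C ⊗ B is explicit, and the quadratic part
b₂ B ⊗ B + ρc₃ C ⊗ C is the same as in `cross_commutator₂`. -/
theorem cross_commutator₁ (h : ∀ i j, Commute (g₁ i) (g₂ j)) (ρ : ℂ) (k : StructureConstants) :
    PowerSeries.C (g₁ 0 + ρ • g₂ 0) * PowerSeries.C (g₁ 2 * g₂ 1) -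
      PowerSeries.C (g₁ 2 * g₂ 1) * PowerSeries.C (g₁ 0 + ρ • g₂ 0) =
    (relAC ρ k (g₁ 0) (PowerSeries.C (g₁ 1)) (PowerSeries.C (g₁ 2)) * PowerSeries.C (g₂ 1) +
      ρ • (PowerSeries.C (g₁ 2) *
        relAB k (g₂ 0) (PowerSeries.C (g₂ 1)) (PowerSeries.C (g₂ 2)))) +
    ((ρ * k.c₁) • (PowerSeries.C (g₁ 2) * shc 1 (g₂ 0)) -
      (k.a₂ * ρ) • (shc ρ (g₁ 0) * PowerSeries.C (g₂ 1)) +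
      (k.b₂ • (PowerSeries.C (g₁ 1) * PowerSeries.C (g₂ 1)) +
        (ρ * k.c₃) • (PowerSeries.C (g₁ 2) * PowerSeries.C (g₂ 2)))) := by
  have a₁ := commute_C_C (h 0 1)
  have a₂ := commute_C_C (h 2 0)
  have b₁ : PowerSeries.C (g₁ 2) * PowerSeries.C (g₂ 1) * PowerSeries.C (g₁ 0) =
      PowerSeries.C (g₁ 2) * PowerSeries.C (g₁ 0) * PowerSeries.C (g₂ 1) := by
    rw [mul_assoc, ← a₁.eq, mul_assoc]
  have b₂ : PowerSeries.C (g₂ 0) * (PowerSeries.C (g₁ 2) * PowerSeries.C (g₂ 1)) =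
      PowerSeries.C (g₁ 2) * (PowerSeries.C (g₂ 0) * PowerSeries.C (g₂ 1)) := by
    rw [← mul_assoc, ← a₂.eq, mul_assoc]
  simp only [relAB, relAC, valAB, valAC, map_add, map_mul, C_smul, mul_sub, sub_mul, mul_add,
    add_mul, mul_smul_comm, smul_mul_assoc, smul_add, smul_sub, neg_mul, b₁, b₂]
  simp only [mul_assoc]
  module

theorem cross_commutator₂ (h : ∀ i j, Commute (g₁ i) (g₂ j)) (ρ : ℂ) (k : StructureConstants) :
    PowerSeries.C (ρ • g₁ 0 + g₂ 0) * PowerSeries.C (g₁ 1 * g₂ 2) -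
      PowerSeries.C (g₁ 1 * g₂ 2) * PowerSeries.C (ρ • g₁ 0 + g₂ 0) =
    (ρ • (relAB k (g₁ 0) (PowerSeries.C (g₁ 1)) (PowerSeries.C (g₁ 2)) * PowerSeries.C (g₂ 2)) +
      PowerSeries.C (g₁ 1) *
        relAC ρ k (g₂ 0) (PowerSeries.C (g₂ 1)) (PowerSeries.C (g₂ 2))) +
    ((ρ * k.c₁) • (shc 1 (g₁ 0) * PowerSeries.C (g₂ 2)) -
      (k.a₂ * ρ) • (PowerSeries.C (g₁ 1) * shc ρ (g₂ 0)) +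
      (k.b₂ • (PowerSeries.C (g₁ 1) * PowerSeries.C (g₂ 1)) +
        (ρ * k.c₃) • (PowerSeries.C (g₁ 2) * PowerSeries.C (g₂ 2)))) := by
  have a₁ := commute_C_C (h 0 2)
  have a₂ := commute_C_C (h 1 0)
  have b₁ : PowerSeries.C (g₁ 1) * PowerSeries.C (g₂ 2) * PowerSeries.C (g₁ 0) =
      PowerSeries.C (g₁ 1) * PowerSeries.C (g₁ 0) * PowerSeries.C (g₂ 2) := by
    rw [mul_assoc, ← a₁.eq, mul_assoc]
  have b₂ : PowerSeries.C (g₂ 0) * (PowerSeries.C (g₁ 1) * PowerSeries.C (g₂ 2)) =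
      PowerSeries.C (g₁ 1) * (PowerSeries.C (g₂ 0) * PowerSeries.C (g₂ 2)) := by
    rw [← mul_assoc, ← a₂.eq, mul_assoc]
  simp only [relAB, relAC, valAB, valAC, map_add, map_mul, C_smul, mul_sub, sub_mul, mul_add,
    add_mul, mul_smul_comm, smul_mul_assoc, smul_add, smul_sub, mul_neg, b₁, b₂]
  simp only [mul_assoc]
  module

/-- This is the central computation. `expZ_conj` and the two cross commutators turn the mixed terms
of the commutator into `shc` terms, quadratic terms and relators. The `shc` terms cancel the
corrections of `symE_twist_defect`, the quadratic terms cancel each other, and only the relators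
survive. -/
theorem relBC_twist (h : ∀ i j, Commute (g₁ i) (g₂ j)) {ρ : ℂ} {k : StructureConstants}
    (hρ : ρ = 1 ∨ k.b₂ = 0 ∧ k.c₃ = 0) :
    relBC ρ k (g₁ 0 + g₂ 0) (twist 1 (g₁ 0) (g₂ 1) (g₁ 1) (g₂ 0))
        (twist ρ (g₁ 0) (g₂ 2) (g₁ 2) (g₂ 0)) =
      expZ ((1 + ρ) • g₁ 0) *
          relBC ρ k (g₂ 0) (PowerSeries.C (g₂ 1)) (PowerSeries.C (g₂ 2)) +
        relBC ρ k (g₁ 0) (PowerSeries.C (g₁ 1)) (PowerSeries.C (g₁ 2)) *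
          expZ (-((1 + ρ) • g₂ 0)) +
      (PowerSeries.X * (expZ (-(ρ • g₂ 0)) * symE (g₁ 0 + ρ • g₂ 0)
        (relAC ρ k (g₁ 0) (PowerSeries.C (g₁ 1)) (PowerSeries.C (g₁ 2)) * PowerSeries.C (g₂ 1) +
          ρ • (PowerSeries.C (g₁ 2) *
            relAB k (g₂ 0) (PowerSeries.C (g₂ 1)) (PowerSeries.C (g₂ 2)))) *
          expZ (-(ρ • g₂ 0))) -
      PowerSeries.X * (expZ (-(g₂ 0)) * symE (ρ • g₁ 0 + g₂ 0)
        (ρ • (relAB k (g₁ 0) (PowerSeries.C (g₁ 1)) (PowerSeries.C (g₁ 2)) *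
            PowerSeries.C (g₂ 2)) +
          PowerSeries.C (g₁ 1) *
            relAC ρ k (g₂ 0) (PowerSeries.C (g₂ 1)) (PowerSeries.C (g₂ 2))) *
          expZ (-(g₂ 0)))) := by
  have x₁ := expZ_conj ((h 0 0).smul_right ρ).neg_right (PowerSeries.C (g₁ 2 * g₂ 1))
  have x₂ := expZ_conj ((h 0 0).smul_left ρ).neg_right (PowerSeries.C (g₁ 1 * g₂ 2))
  rw [sub_neg_eq_add, cross_commutator₁ h ρ k] at x₁
  rw [sub_neg_eq_add, cross_commutator₂ h ρ k] at x₂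
  have d₁ := symE_twist_defect h 1 ρ 1
  have d₂ := symE_twist_defect h ρ 1 2
  have s₁ := symE_conj_right h 1 ρ ρ 1
  have s₂ := symE_conj_left h 1 ρ 1 2
  have s₃ := symE_conj_right h ρ 1 1 2
  have s₄ := symE_conj_left h ρ 1 ρ 1
  have c := twist_commutator h ρ
  rw [x₁, x₂] at c
  simp only [one_smul] at d₁ d₂ s₁ s₂ s₃ s₄
  rw [add_comm ρ 1] at d₂
  -- The quadratic terms arrive with the exponentials of ρA in one place and of A in the other. They
  -- agree for ρ = 1 and vanish when b₂ = c₃ = 0.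
  have eQ : PowerSeries.X * (expZ (-(ρ • g₂ 0)) * symE (g₁ 0 + ρ • g₂ 0)
      (k.b₂ • (PowerSeries.C (g₁ 1) * PowerSeries.C (g₂ 1)) +
        (ρ * k.c₃) • (PowerSeries.C (g₁ 2) * PowerSeries.C (g₂ 2))) * expZ (-(ρ • g₂ 0))) =
      PowerSeries.X * (expZ (-(g₂ 0)) * symE (ρ • g₁ 0 + g₂ 0)
      (k.b₂ • (PowerSeries.C (g₁ 1) * PowerSeries.C (g₂ 1)) +
        (ρ * k.c₃) • (PowerSeries.C (g₁ 2) * PowerSeries.C (g₂ 2))) * expZ (-(g₂ 0))) := by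
    rcases hρ with rfl | ⟨h₁, h₂⟩
    · simp only [one_smul]
    · simp [h₁, h₂, (isZLinear_symE _).map_zero]
  simp only [(isZLinear_symE _).add, (isZLinear_symE _).map_sub, symE_smul, mul_add, add_mul,
    mul_sub, sub_mul, mul_smul_comm, smul_mul_assoc, s₁, s₂, s₃, s₄] at c eQ ⊢
  simp only [relBC, valBC, c, d₁, d₂, shc_add (1 + ρ) (h 0 0)]
  simp only [mul_add, add_mul, mul_sub, sub_mul, mul_smul_comm, smul_mul_assoc, smul_add, smul_sub,
    map_sub, map_mul] at eQ ⊢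
  rw [← sub_eq_zero] at eQ ⊢
  refine Eq.trans ?_ eQ
  simp only [mul_assoc]
  module

end Relations

end

section

/-! ### The unified family and its coproduct -/

section Relations

variable {R S : Type*} [Ring R] [Algebra ℂ R] [Ring S] [Algebra ℂ S]

theorem extHom_valBC (ψ : R →ₐ[ℂ] S⟦X⟧) {a : R} {a' : S} (h : ψ a = PowerSeries.C a') (ρ : ℂ)
    (k : StructureConstants) (b c : R⟦X⟧) :
    extHom ψ (valBC ρ k a b c) = valBC ρ k a' (extHom ψ b) (extHom ψ c) := by
  have hs : ∀ t : ℂ, ψ (t • a) = PowerSeries.C (t • a') := fun t => by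
    rw [map_smul, h, C_smul]
  have hn : ∀ {x : R} {y : S}, ψ x = PowerSeries.C y → ψ (-x) = PowerSeries.C (-y) :=
    fun h => by rw [map_neg, h, map_neg]
  simp only [valBC, map_add, extHom_smul, extHom_shc ψ h, extHom_symE ψ h,
    extHom_symE ψ (hs ρ), extHom_symE ψ (hn (hs ρ)), extHom_symE ψ (hn h)]

theorem extHom_relAB (ψ : R →ₐ[ℂ] S⟦X⟧) {a : R} {a' : S} (h : ψ a = PowerSeries.C a')
    (k : StructureConstants) (b c : R⟦X⟧) :
    extHom ψ (relAB k a b c) = relAB k a' (extHom ψ b) (extHom ψ c) := by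
  simp only [relAB, valAB, map_sub, map_add, map_mul, extHom_smul, extHom_shc ψ h, extHom_C, h]

theorem extHom_relAC (ψ : R →ₐ[ℂ] S⟦X⟧) {a : R} {a' : S} (h : ψ a = PowerSeries.C a') (ρ : ℂ)
    (k : StructureConstants) (b c : R⟦X⟧) :
    extHom ψ (relAC ρ k a b c) = relAC ρ k a' (extHom ψ b) (extHom ψ c) := by
  simp only [relAC, valAC, map_sub, map_add, map_neg, map_mul, extHom_smul, extHom_shc ψ h,
    extHom_C, h]

theorem extHom_relBC (ψ : R →ₐ[ℂ] S⟦X⟧) {a : R} {a' : S} (h : ψ a = PowerSeries.C a') (ρ : ℂ)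
    (k : StructureConstants) (b c : R⟦X⟧) :
    extHom ψ (relBC ρ k a b c) = relBC ρ k a' (extHom ψ b) (extHom ψ c) := by
  simp only [relBC, map_sub, map_mul, extHom_valBC ψ h]

theorem mapHom_eq_extHom (φ : R →ₐ[ℂ] S) (p : R⟦X⟧) :
    mapHom φ p = extHom ((constHom S).comp φ) p :=
  (isZLinear_mapHom φ).ext (isZLinear_extHom _) (fun r => by
    rw [mapHom_C, extHom_C]
    rfl) p

theorem mapHom_relAB (φ : R →ₐ[ℂ] S) (k : StructureConstants) (a b c : R) :
    mapHom φ (relAB k a (PowerSeries.C b) (PowerSeries.C c)) =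
      relAB k (φ a) (PowerSeries.C (φ b)) (PowerSeries.C (φ c)) := by
  rw [mapHom_eq_extHom, extHom_relAB ((constHom S).comp φ) (a' := φ a) rfl, extHom_C, extHom_C]
  rfl

theorem mapHom_relAC (φ : R →ₐ[ℂ] S) (ρ : ℂ) (k : StructureConstants) (a b c : R) :
    mapHom φ (relAC ρ k a (PowerSeries.C b) (PowerSeries.C c)) =
      relAC ρ k (φ a) (PowerSeries.C (φ b)) (PowerSeries.C (φ c)) := by
  rw [mapHom_eq_extHom, extHom_relAC ((constHom S).comp φ) (a' := φ a) rfl, extHom_C, extHom_C]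
  rfl

theorem mapHom_relBC (φ : R →ₐ[ℂ] S) (ρ : ℂ) (k : StructureConstants) (a b c : R) :
    mapHom φ (relBC ρ k a (PowerSeries.C b) (PowerSeries.C c)) =
      relBC ρ k (φ a) (PowerSeries.C (φ b)) (PowerSeries.C (φ c)) := by
  rw [mapHom_eq_extHom, extHom_relBC ((constHom S).comp φ) (a' := φ a) rfl, extHom_C, extHom_C]
  rfl

/-- Modulo the first two relations in both factors, the third relation is mapped to itself. -/
theorem relBC_twist_sub_mem {g₁ g₂ : Fin 3 → R} (h : ∀ i j, Commute (g₁ i) (g₂ j)) {ρ : ℂ}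
    {k : StructureConstants} (hρ : ρ = 1 ∨ k.b₂ = 0 ∧ k.c₃ = 0) {I : TwoSidedIdeal R⟦X⟧}
    (hI : IsZClosed I)
    (h₁ : relAB k (g₁ 0) (PowerSeries.C (g₁ 1)) (PowerSeries.C (g₁ 2)) ∈ I)
    (h₂ : relAB k (g₂ 0) (PowerSeries.C (g₂ 1)) (PowerSeries.C (g₂ 2)) ∈ I)
    (h₃ : relAC ρ k (g₁ 0) (PowerSeries.C (g₁ 1)) (PowerSeries.C (g₁ 2)) ∈ I)
    (h₄ : relAC ρ k (g₂ 0) (PowerSeries.C (g₂ 1)) (PowerSeries.C (g₂ 2)) ∈ I) :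
    relBC ρ k (g₁ 0 + g₂ 0) (twist 1 (g₁ 0) (g₂ 1) (g₁ 1) (g₂ 0))
        (twist ρ (g₁ 0) (g₂ 2) (g₁ 2) (g₂ 0)) -
      (expZ ((1 + ρ) • g₁ 0) *
          relBC ρ k (g₂ 0) (PowerSeries.C (g₂ 1)) (PowerSeries.C (g₂ 2)) +
        relBC ρ k (g₁ 0) (PowerSeries.C (g₁ 1)) (PowerSeries.C (g₁ 2)) *
          expZ (-((1 + ρ) • g₂ 0))) ∈ I := by
  rw [relBC_twist h hρ, add_sub_cancel_left]
  refine I.sub_mem ?_ ?_ <;>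
    refine I.mul_mem_left _ _ (I.mul_mem_right _ _ (I.mul_mem_left _ _ (hI.symE_mem _ ?_)))
  · exact I.add_mem (I.mul_mem_right _ _ h₃) (smul_mem_ideal I ρ (I.mul_mem_left _ _ h₂))
  · exact I.add_mem (smul_mem_ideal I ρ (I.mul_mem_right _ _ h₁)) (I.mul_mem_left _ _ h₄)

end Relations

/-- All the deformed commutation rules at once. -/
def family (ρ : ℂ) (k : StructureConstants) : Rules where
  AB := k.c₁ • shc 1 (letter 0) + k.c₂ • PowerSeries.C (letter 1) +
    k.c₃ • PowerSeries.C (letter 2)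
  AC := -((k.a₂ * ρ) • shc ρ (letter 0)) + k.b₂ • PowerSeries.C (letter 1) -
    (ρ * k.c₂) • PowerSeries.C (letter 2)
  BC := k.a₁ • shc (1 + ρ) (letter 0) +
    k.a₂ • (PowerSeries.C (letter 1) * coshZ (ρ • letter 0)) +
    (ρ * k.c₁) • (PowerSeries.C (letter 2) * coshZ ((1 : ℂ) • letter 0))

/-- The constraints on the structure constants, for all `ρ` at once. -/
structure Constraints (ρ : ℂ) (k : StructureConstants) : Prop where
  b₁ : k.b₁ = -(ρ * k.a₂)
  a₃ : k.a₃ = ρ * k.c₁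
  b₃ : k.b₃ = -(ρ * k.c₂)
  b₂ : ρ = 1 ∨ k.b₂ = 0
  c₃ : ρ = 1 ∨ k.c₃ = 0
  a₁ : ρ = 1 ∨ k.a₁ * k.c₂ = (1 + ρ) * (k.a₂ * k.c₁)

theorem relator_family_AB (ρ : ℂ) (k : StructureConstants) : relator 0 1 (family ρ k).AB =
    relAB k (gen 0) (PowerSeries.C (gen 1)) (PowerSeries.C (gen 2)) := by
  simp only [relator, family, relAB, valAB, isZLinear_symZ.add, symZ_smul, symZ_shc, symZ_C,
    sym_letter, map_sub, map_mul]

theorem relator_family_AC (ρ : ℂ) (k : StructureConstants) : relator 0 2 (family ρ k).AC =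
    relAC ρ k (gen 0) (PowerSeries.C (gen 1)) (PowerSeries.C (gen 2)) := by
  simp only [relator, family, relAC, valAC, isZLinear_symZ.add, isZLinear_symZ.map_sub,
    isZLinear_symZ.map_neg, symZ_smul, symZ_shc, symZ_C, sym_letter, map_sub, map_mul]

theorem relator_family_BC (ρ : ℂ) (k : StructureConstants) : relator 1 2 (family ρ k).BC =
    relBC ρ k (gen 0) (PowerSeries.C (gen 1)) (PowerSeries.C (gen 2)) := by
  simp only [relator, family, relBC, valBC, isZLinear_symZ.add, symZ_smul, symZ_shc,
    symZ_mul_coshZ, map_sub, map_mul, smul_smul]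
  rw [one_smul]

/-- The generators in the left tensor factor. -/
def genL (i : Fin 3) : Free ⊗[ℂ] Free := gen i ⊗ₜ 1

/-- The generators in the right tensor factor. -/
def genR (i : Fin 3) : Free ⊗[ℂ] Free := 1 ⊗ₜ gen i

theorem commute_genL_genR (i j : Fin 3) : Commute (genL i) (genR j) :=
  commute_includeLeft_includeRight Free (gen i) (gen j)

/-- The embedding of the left tensor factor. -/
def inL : Free →ₐ[ℂ] Free ⊗[ℂ] Free := Algebra.TensorProduct.includeLeft

/-- The embedding of the right tensor factor. -/
def inR : Free →ₐ[ℂ] Free ⊗[ℂ] Free := Algebra.TensorProduct.includeRight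

theorem inL_gen (i : Fin 3) : inL (gen i) = genL i := rfl

theorem inR_gen (i : Fin 3) : inR (gen i) = genR i := rfl

theorem coprod_gen_zero (ρ : ℂ) : coprod ρ (gen 0) = PowerSeries.C (genL 0 + genR 0) := by
  rw [coprod_gen, coprodGen_zero, add_comm]
  rfl

theorem coprod_gen_one (ρ : ℂ) :
    coprod ρ (gen 1) = twist 1 (genL 0) (genR 1) (genL 1) (genR 0) := by
  rw [coprod_gen, coprodGen_one]
  rfl

theorem coprod_gen_two (ρ : ℂ) :
    coprod ρ (gen 2) = twist ρ (genL 0) (genR 2) (genL 2) (genR 0) := by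
  rw [coprod_gen, coprodGen_two]
  rfl

variable {ρ : ℂ} {k : StructureConstants} {F : Rules}

theorem Rules.mapHom_inL_mem {p : Free⟦X⟧} (hp : p ∈ F.relators) :
    mapHom inL p ∈ closedIdeal F.relators₂ :=
  subset_closedIdeal _ (Or.inl ⟨p, hp, rfl⟩)

theorem Rules.mapHom_inR_mem {p : Free⟦X⟧} (hp : p ∈ F.relators) :
    mapHom inR p ∈ closedIdeal F.relators₂ :=
  subset_closedIdeal _ (Or.inr ⟨p, hp, rfl⟩)

theorem Rules.relator_AB_mem (F : Rules) : relator 0 1 F.AB ∈ F.relators := Or.inl rfl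

theorem Rules.relator_AC_mem (F : Rules) : relator 0 2 F.AC ∈ F.relators := Or.inr (Or.inl rfl)

theorem Rules.relator_BC_mem (F : Rules) : relator 1 2 F.BC ∈ F.relators := Or.inr (Or.inr rfl)

theorem coprodZ_relAB (ρ : ℂ) (k : StructureConstants) :
    coprodZ ρ (relator 0 1 (family ρ k).AB) =
      relAB k (genL 0 + genR 0) (twist 1 (genL 0) (genR 1) (genL 1) (genR 0))
        (twist ρ (genL 0) (genR 2) (genL 2) (genR 0)) := by
  rw [coprodZ_eq_extHom, relator_family_AB, extHom_relAB (coprod ρ) (coprod_gen_zero ρ), extHom_C,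
    extHom_C, coprod_gen_one, coprod_gen_two]

theorem coprodZ_relAC (ρ : ℂ) (k : StructureConstants) :
    coprodZ ρ (relator 0 2 (family ρ k).AC) =
      relAC ρ k (genL 0 + genR 0) (twist 1 (genL 0) (genR 1) (genL 1) (genR 0))
        (twist ρ (genL 0) (genR 2) (genL 2) (genR 0)) := by
  rw [coprodZ_eq_extHom, relator_family_AC, extHom_relAC (coprod ρ) (coprod_gen_zero ρ), extHom_C,
    extHom_C, coprod_gen_one, coprod_gen_two]

theorem coprodZ_relBC (ρ : ℂ) (k : StructureConstants) :
    coprodZ ρ (relator 1 2 (family ρ k).BC) =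
      relBC ρ k (genL 0 + genR 0) (twist 1 (genL 0) (genR 1) (genL 1) (genR 0))
        (twist ρ (genL 0) (genR 2) (genL 2) (genR 0)) := by
  rw [coprodZ_eq_extHom, relator_family_BC, extHom_relBC (coprod ρ) (coprod_gen_zero ρ), extHom_C,
    extHom_C, coprod_gen_one, coprod_gen_two]

/-- `Δ[A,B]`-relation, for arbitrary constants with `c₃ = 0` or `ρ = 1`. -/
theorem coprodZ_relator_AB (h : ρ = 1 ∨ k.c₃ = 0) :
    coprodZ ρ (relator 0 1 (family ρ k).AB) =
      expZ (genL 0) * mapHom inR (relator 0 1 (family ρ k).AB) +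
        mapHom inL (relator 0 1 (family ρ k).AB) * expZ (-(genR 0)) := by
  rw [coprodZ_relAB, relAB_twist commute_genL_genR h, relator_family_AB, mapHom_relAB,
    mapHom_relAB]
  rfl

theorem coprodZ_relator_AC (h : ρ = 1 ∨ k.b₂ = 0) :
    coprodZ ρ (relator 0 2 (family ρ k).AC) =
      expZ (ρ • genL 0) * mapHom inR (relator 0 2 (family ρ k).AC) +
        mapHom inL (relator 0 2 (family ρ k).AC) * expZ (-(ρ • genR 0)) := by
  rw [coprodZ_relAC, relAC_twist commute_genL_genR h, relator_family_AC, mapHom_relAC,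
    mapHom_relAC]
  rfl

/-- Only the first two rules of `F` need to be those of the family. The uniqueness proof uses this
before the third rule is known. -/
theorem coprodZ_relator_BC_sub_mem (h : ρ = 1 ∨ k.b₂ = 0 ∧ k.c₃ = 0)
    (hAB : F.AB = (family ρ k).AB) (hAC : F.AC = (family ρ k).AC) :
    coprodZ ρ (relator 1 2 (family ρ k).BC) -
      (expZ ((1 + ρ) • genL 0) * mapHom inR (relator 1 2 (family ρ k).BC) +
        mapHom inL (relator 1 2 (family ρ k).BC) * expZ (-((1 + ρ) • genR 0))) ∈
      closedIdeal F.relators₂ := by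
  have h₁ := F.mapHom_inL_mem F.relator_AB_mem
  have h₂ := F.mapHom_inR_mem F.relator_AB_mem
  have h₃ := F.mapHom_inL_mem F.relator_AC_mem
  have h₄ := F.mapHom_inR_mem F.relator_AC_mem
  rw [hAB, relator_family_AB, mapHom_relAB] at h₁ h₂
  rw [hAC, relator_family_AC, mapHom_relAC] at h₃ h₄
  rw [coprodZ_relBC, relator_family_BC, mapHom_relBC, mapHom_relBC]
  exact relBC_twist_sub_mem commute_genL_genR h (isZClosed_closedIdeal _) h₁ h₂ h₃ h₄

/-- The coproduct respects the relations of the family. -/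
theorem Constraints.coprodZ_mem (h : Constraints ρ k) {p : Free⟦X⟧}
    (hp : p ∈ closedIdeal (family ρ k).relators) :
    coprodZ ρ p ∈ closedIdeal (family ρ k).relators₂ := by
  rw [coprodZ_eq_extHom]
  refine map_mem_of_mem_closedIdeal (isZLinear_extHom _) (isZClosed_closedIdeal _) ?_ hp
  set I := closedIdeal (family ρ k).relators₂
  rintro p (rfl | rfl | rfl)
  · rw [← coprodZ_eq_extHom, coprodZ_relator_AB h.c₃]
    exact I.add_mem (I.mul_mem_left _ _ (Rules.mapHom_inR_mem (Rules.relator_AB_mem _)))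
      (I.mul_mem_right _ _ (Rules.mapHom_inL_mem (Rules.relator_AB_mem _)))
  · rw [← coprodZ_eq_extHom, coprodZ_relator_AC h.b₂]
    exact I.add_mem (I.mul_mem_left _ _ (Rules.mapHom_inR_mem (Rules.relator_AC_mem _)))
      (I.mul_mem_right _ _ (Rules.mapHom_inL_mem (Rules.relator_AC_mem _)))
  · have h' : ρ = 1 ∨ k.b₂ = 0 ∧ k.c₃ = 0 := by
      rcases h.b₂ with h₁ | h₁
      · exact Or.inl h₁
      · exact h.c₃.imp_right fun h₂ => ⟨h₁, h₂⟩
    have := coprodZ_relator_BC_sub_mem h' rfl (rfl : (family ρ k).AC = _)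
    rw [← coprodZ_eq_extHom]
    rw [← sub_add_cancel (coprodZ _ _)]
    refine I.add_mem this ?_
    exact I.add_mem (I.mul_mem_left _ _ (Rules.mapHom_inR_mem (Rules.relator_BC_mem _)))
      (I.mul_mem_right _ _ (Rules.mapHom_inL_mem (Rules.relator_BC_mem _)))

theorem Constraints.coproduct (h : Constraints ρ k) :
    ∃ Δ : (family ρ k).Uz →+* (family ρ k).Uz₂,
      ∀ p : Free⟦X⟧, Δ (toQuot (family ρ k).relators p) =
        toQuot (family ρ k).relators₂ (coprodZ ρ p) := by
  refine ⟨RingCon.lift _ ((toQuot (family ρ k).relators₂).comp (extHom (coprod ρ))) ?_, ?_⟩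
  · intro x y hxy
    rw [RingCon.ker_apply, ← sub_eq_zero, ← map_sub]
    have hm : x - y ∈ closedIdeal (family ρ k).relators :=
      ((closedIdeal (family ρ k).relators).rel_iff x y).1 hxy
    exact toQuot_eq_zero.2 (coprodZ_eq_extHom ρ (x - y) ▸ h.coprodZ_mem hm)
  · intro p
    rw [coprodZ_eq_extHom]
    rfl

end

section

/-! ### Degree filtrations -/

/-- The polynomials of degree less than `n`. -/
def lowerDeg (n : ℕ) : Submodule ℂ Poly where
  carrier := {p | ∀ m : Fin 3 →₀ ℕ, n ≤ m.degree → MvPolynomial.coeff m p = 0}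
  add_mem' hp hq m hm := by rw [MvPolynomial.coeff_add, hp m hm, hq m hm, add_zero]
  zero_mem' m _ := MvPolynomial.coeff_zero m
  smul_mem' c p hp m hm := by rw [MvPolynomial.coeff_smul, hp m hm, smul_zero]

theorem lowerDeg_mono {n n' : ℕ} (h : n ≤ n') : lowerDeg n ≤ lowerDeg n' :=
  fun _ hp m hm => hp m (h.trans hm)

/-- The bounds are strict, so `a + 1` stands for degree at most a. -/
theorem mul_mem_lowerDeg {a n : ℕ} {p q : Poly} (hp : p ∈ lowerDeg (a + 1))
    (hq : q ∈ lowerDeg n) : p * q ∈ lowerDeg (a + n) := by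
  intro m hm
  rw [MvPolynomial.coeff_mul]
  refine Finset.sum_eq_zero fun x hx => ?_
  have hd : m.degree = x.1.degree + x.2.degree := by
    rw [← Finset.HasAntidiagonal.mem_antidiagonal.1 hx, map_add]
  rcases le_or_gt n x.2.degree with h | h
  · rw [hq _ h, mul_zero]
  · rw [hp _ (by lia), zero_mul]

theorem monomial_mem_lowerDeg {m : Fin 3 →₀ ℕ} {n : ℕ} (h : m.degree < n) (c : ℂ) :
    MvPolynomial.monomial m c ∈ lowerDeg n := by
  intro m' hm'
  rw [MvPolynomial.coeff_monomial, if_neg]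
  rintro rfl
  exact absurd hm' (not_le.2 h)

theorem letter_mem_lowerDeg (i : Fin 3) : letter i ∈ lowerDeg 2 :=
  monomial_mem_lowerDeg (by simp [Finsupp.degree_single]) 1

theorem one_mem_lowerDeg : (1 : Poly) ∈ lowerDeg 1 :=
  monomial_mem_lowerDeg (m := 0) (by simp) 1

theorem prod_letter_mem_lowerDeg (l : List (Fin 3)) :
    (l.map letter).prod ∈ lowerDeg (l.length + 1) := by
  induction l with
  | nil => exact one_mem_lowerDeg
  | cons i l ih =>
    rw [List.map_cons, List.prod_cons, List.length_cons, add_comm l.length, add_assoc]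
    exact mul_mem_lowerDeg (letter_mem_lowerDeg i) ih

theorem lowerDeg_eq_span (n : ℕ) : lowerDeg n =
    Submodule.span ℂ {p | ∃ l : List (Fin 3), l.length < n ∧ p = (l.map letter).prod} := by
  refine le_antisymm (fun p hp => ?_) (Submodule.span_le.2 ?_)
  · rw [p.as_sum]
    refine Submodule.sum_mem _ fun m hm => ?_
    obtain ⟨l, hl, e⟩ := monomial_eq_prod_letter m
    rw [← mul_one (MvPolynomial.coeff m p), ← smul_eq_mul, ← MvPolynomial.smul_monomial, e]
    refine Submodule.smul_mem _ _ (Submodule.subset_span ⟨l, ?_, rfl⟩)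
    rw [hl]
    by_contra h
    exact MvPolynomial.mem_support_iff.1 hm (hp m (not_lt.1 h))
  · rintro _ ⟨l, hl, rfl⟩
    exact lowerDeg_mono hl (prod_letter_mem_lowerDeg l)

theorem exists_mem_lowerDeg (p : Poly) : ∃ n, p ∈ lowerDeg n := by
  refine ⟨p.totalDegree + 1, fun m hm => MvPolynomial.coeff_eq_zero_of_totalDegree_lt ?_⟩
  rwa [Finsupp.degree, ← Nat.succ_le_iff] at *

theorem lowerDeg_zero {p : Poly} (hp : p ∈ lowerDeg 0) : p = 0 :=
  MvPolynomial.ext _ _ fun m => hp m (Nat.zero_le _)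

/-- The span of the words with fewer than `n` letters. -/
def shortWords (n : ℕ) : Submodule ℂ Free :=
  Submodule.span ℂ {x | ∃ l : List (Fin 3), l.length < n ∧ x = word l}

theorem word_mem_shortWords {l : List (Fin 3)} {n : ℕ} (h : l.length < n) :
    word l ∈ shortWords n := Submodule.subset_span ⟨l, h, rfl⟩

theorem word_mul_mem_shortWords (l : List (Fin 3)) {n : ℕ} {x : Free} (hx : x ∈ shortWords n) :
    word l * x ∈ shortWords (l.length + n) := by
  induction hx using Submodule.span_induction with
  | mem x hx =>
    obtain ⟨l', hl', rfl⟩ := hx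
    rw [← word_append]
    exact word_mem_shortWords (by rw [List.length_append]; lia)
  | zero => simp
  | add x y _ _ hx hy => rw [mul_add]; exact Submodule.add_mem _ hx hy
  | smul c x _ hx => rw [mul_smul_comm]; exact Submodule.smul_mem _ _ hx

theorem mul_word_mem_shortWords (l : List (Fin 3)) {n : ℕ} {x : Free} (hx : x ∈ shortWords n) :
    x * word l ∈ shortWords (n + l.length) := by
  induction hx using Submodule.span_induction with
  | mem x hx =>
    obtain ⟨l', hl', rfl⟩ := hx
    rw [← word_append]
    exact word_mem_shortWords (by rw [List.length_append]; lia)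
  | zero => simp
  | add x y _ _ hx hy => rw [add_mul]; exact Submodule.add_mem _ hx hy
  | smul c x _ hx => rw [smul_mul_assoc]; exact Submodule.smul_mem _ _ hx

/-! ### Symmetrized monomials span -/

/-- The commutators of the generators are linear modulo `I`. -/
def LinearCommutators (I : TwoSidedIdeal Free) : Prop :=
  ∀ i j, ∃ v ∈ shortWords 2, gen i * gen j - gen j * gen i - v ∈ I

variable {I : TwoSidedIdeal Free}

/-- Exchanging two neighbouring letters costs a linear commutator, hence a word shorter by at least
one letter. Such exchanges generate all permutations. -/
theorem LinearCommutators.word_perm (hI : LinearCommutators I) {l l' : List (Fin 3)}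
    (h : l.Perm l') : ∃ v ∈ shortWords l.length, word l - word l' - v ∈ I := by
  induction h with
  | nil => exact ⟨0, Submodule.zero_mem _, by simp [I.zero_mem]⟩
  | @cons i l l' h ih =>
    obtain ⟨v, hv, hm⟩ := ih
    refine ⟨gen i * v, ?_, ?_⟩
    · have := word_mul_mem_shortWords [i] hv
      rwa [word_cons, word_nil, mul_one, List.length_singleton, add_comm] at this
    · rw [word_cons, word_cons, ← mul_sub, ← mul_sub]
      exact I.mul_mem_left _ _ hm
  | swap i j l =>
    obtain ⟨v, hv, hm⟩ := hI j i
    refine ⟨v * word l, ?_, ?_⟩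
    · have := mul_word_mem_shortWords l hv
      rwa [add_comm] at this
    · have := I.mul_mem_right _ (word l) hm
      simp only [word_cons]
      rwa [sub_mul, sub_mul, mul_assoc, mul_assoc] at this
  | trans h₁ _ ih₁ ih₂ =>
    obtain ⟨v, hv, hm⟩ := ih₁
    obtain ⟨w, hw, hn⟩ := ih₂
    refine ⟨v + w, Submodule.add_mem _ hv (h₁.length_eq ▸ hw), ?_⟩
    have := I.add_mem hm hn
    convert this using 1
    abel

theorem LinearCommutators.word_sub_symWord (hI : LinearCommutators I) (l : List (Fin 3)) :
    ∃ v ∈ shortWords l.length, word l - symWord l - v ∈ I := by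
  have h : ∀ p : Equiv.Perm (Fin l.length), ∃ v ∈ shortWords l.length,
      word l - word (List.ofFn fun i => l.get (p i)) - v ∈ I := fun p => by
    refine hI.word_perm ?_
    have := Equiv.Perm.ofFn_comp_perm p l.get
    rw [List.ofFn_get] at this
    exact this.symm
  choose v hv hm using h
  have hs : symWord l = ((l.length.factorial : ℂ)⁻¹) •
      ∑ p : Equiv.Perm (Fin l.length), word (List.ofFn fun i => l.get (p i)) := by
    simp only [symWord, word, List.map_ofFn]
    rfl
  have hw : word l = ((l.length.factorial : ℂ)⁻¹) • ∑ _p : Equiv.Perm (Fin l.length), word l := by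
    rw [Finset.sum_const, Finset.card_univ, Fintype.card_perm, Fintype.card_fin,
      ← Nat.cast_smul_eq_nsmul ℂ, smul_smul, inv_mul_cancel₀
        (Nat.cast_ne_zero.2 (Nat.factorial_ne_zero _)), one_smul]
  refine ⟨((l.length.factorial : ℂ)⁻¹) • ∑ p, v p,
    Submodule.smul_mem _ _ (Submodule.sum_mem _ fun p _ => hv p), ?_⟩
  rw [hs]
  nth_rewrite 1 [hw]
  rw [← smul_sub, ← smul_sub, ← Finset.sum_sub_distrib, ← Finset.sum_sub_distrib]
  exact smul_mem_ideal I _ (sum_mem fun p _ => hm p)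

/-- Words are symmetrized monomials up to lower degree. -/
theorem LinearCommutators.word_sub_sym (hI : LinearCommutators I) (l : List (Fin 3)) :
    ∃ g ∈ lowerDeg l.length, word l - sym ((l.map letter).prod + g) ∈ I := by
  induction hn : l.length using Nat.strong_induction_on generalizing l with
  | _ n ih =>
    have key : ∀ v ∈ shortWords n, ∃ g ∈ lowerDeg n, v - sym g ∈ I := by
      intro v hv
      induction hv using Submodule.span_induction with
      | mem x hx =>
        obtain ⟨l', hl', rfl⟩ := hx
        obtain ⟨g, hg, hm⟩ := ih _ hl' l' rfl
        exact ⟨_, Submodule.add_mem _ (lowerDeg_mono hl' (prod_letter_mem_lowerDeg l'))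
          (lowerDeg_mono hl'.le hg), hm⟩
      | zero => exact ⟨0, Submodule.zero_mem _, by simp [I.zero_mem]⟩
      | add x y _ _ hx hy =>
        obtain ⟨g, hg, hm⟩ := hx
        obtain ⟨g', hg', hm'⟩ := hy
        refine ⟨g + g', Submodule.add_mem _ hg hg', ?_⟩
        rw [map_add, add_sub_add_comm]
        exact I.add_mem hm hm'
      | smul c x _ hx =>
        obtain ⟨g, hg, hm⟩ := hx
        refine ⟨c • g, Submodule.smul_mem _ _ hg, ?_⟩
        rw [map_smul, ← smul_sub]
        exact smul_mem_ideal I c hm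
    obtain ⟨v, hv, hm⟩ := hI.word_sub_symWord l
    obtain ⟨g, hg, hm'⟩ := key v (hn ▸ hv)
    refine ⟨g, hg, ?_⟩
    rw [map_add, sym_prod_letter]
    have := I.add_mem hm hm'
    convert this using 1
    abel

theorem LinearCommutators.exists_sym (hI : LinearCommutators I) (x : Free) :
    ∃ g, x - sym g ∈ I := by
  have hx : x ∈ Submodule.span ℂ (Set.range word) := span_word ▸ Submodule.mem_top
  induction hx using Submodule.span_induction with
  | mem x hx =>
    obtain ⟨l, rfl⟩ := hx
    obtain ⟨g, -, hm⟩ := hI.word_sub_sym l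
    exact ⟨_, hm⟩
  | zero => exact ⟨0, by simp [I.zero_mem]⟩
  | add x y _ _ hx hy =>
    obtain ⟨g, hm⟩ := hx
    obtain ⟨g', hm'⟩ := hy
    refine ⟨g + g', ?_⟩
    rw [map_add, add_sub_add_comm]
    exact I.add_mem hm hm'
  | smul c x _ hx =>
    obtain ⟨g, hm⟩ := hx
    refine ⟨c • g, ?_⟩
    rw [map_smul, ← smul_sub]
    exact smul_mem_ideal I c hm

/-! ### The classical limit of an ideal -/

section Limit

variable {R : Type*} [Ring R]

/-- The ideal of constant coefficients. -/
def limitIdeal (J : TwoSidedIdeal R⟦X⟧) : TwoSidedIdeal R :=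
  TwoSidedIdeal.mk' {x | ∃ p ∈ J, PowerSeries.constantCoeff p = x}
    ⟨0, J.zero_mem, map_zero _⟩
    (fun ⟨p, hp, ep⟩ ⟨q, hq, eq⟩ => ⟨p + q, J.add_mem hp hq, by rw [map_add, ep, eq]⟩)
    (fun ⟨p, hp, ep⟩ => ⟨-p, J.neg_mem hp, by rw [map_neg, ep]⟩)
    (fun {x _} ⟨p, hp, ep⟩ => ⟨PowerSeries.C x * p, J.mul_mem_left _ _ hp, by
      rw [map_mul, ep, PowerSeries.constantCoeff_C]⟩)
    (fun {_ x} ⟨p, hp, ep⟩ => ⟨p * PowerSeries.C x, J.mul_mem_right _ _ hp, by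
      rw [map_mul, ep, PowerSeries.constantCoeff_C]⟩)

theorem mem_limitIdeal {J : TwoSidedIdeal R⟦X⟧} {x : R} :
    x ∈ limitIdeal J ↔ ∃ p ∈ J, PowerSeries.constantCoeff p = x :=
  TwoSidedIdeal.mem_mk' _ _ _ _ _ _ _

theorem eq_C_add_X_mul (p : R⟦X⟧) : ∃ q, p = PowerSeries.C (PowerSeries.constantCoeff p) +
    PowerSeries.X * q := by
  obtain ⟨q, hq⟩ := PowerSeries.X_dvd_iff.2
    (show PowerSeries.constantCoeff (p - PowerSeries.C (PowerSeries.constantCoeff p)) = 0 by simp)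
  exact ⟨q, by rw [← hq]; abel⟩

end Limit

/-- The symmetrized monomials span topologically. -/
theorem exists_symZ {J : TwoSidedIdeal Free⟦X⟧} (hJ : IsZClosed J)
    (hl : LinearCommutators (limitIdeal J)) (p : Free⟦X⟧) : ∃ g, p - symZ g ∈ J := by
  -- The constant term is symmetrized modulo the limit ideal, the error is lifted to an element of
  -- `J`, and what remains is divisible by z.
  have step : ∀ p : Free⟦X⟧, ∃ (g : Poly) (j q : Free⟦X⟧), j ∈ J ∧
      p = PowerSeries.C (sym g) + j + PowerSeries.X * q := by
    intro p
    obtain ⟨g, hg⟩ := hl.exists_sym (PowerSeries.constantCoeff p)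
    obtain ⟨j, hj, e⟩ := mem_limitIdeal.1 hg
    obtain ⟨q, hq⟩ := eq_C_add_X_mul (p - j)
    refine ⟨g, j, q, hj, ?_⟩
    rw [map_sub, e, sub_sub_cancel] at hq
    rw [add_right_comm, ← hq, sub_add_cancel]
  choose g j q hj hp using step
  let s : ℕ → Free⟦X⟧ := fun n => q^[n] p
  have hs : ∀ n, s (n + 1) = q (s n) := fun n => Function.iterate_succ_apply' q n p
  -- Iterating the step N times leaves z^N times a remainder, so the differences converge to an
  -- element of the closed ideal.
  have hN : ∀ N, p - symZ (PowerSeries.mk fun n => g (s n)) -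
      ∑ k ∈ Finset.range N, PowerSeries.X ^ k * j (s k) =
      PowerSeries.X ^ N * (s N - symZ (PowerSeries.mk fun n => g (s (N + n)))) := by
    intro N
    induction N with
    | zero => simp [s]
    | succ N ih =>
      have e : symZ (PowerSeries.mk fun n => g (s (N + n))) = PowerSeries.C (sym (g (s N))) +
          PowerSeries.X * symZ (PowerSeries.mk fun n => g (s (N + 1 + n))) := by
        ext n
        rcases n with _ | n
        · simp [coeff_symZ]
        · rw [map_add, coeff_symZ, PowerSeries.coeff_succ_X_mul, coeff_symZ,
            PowerSeries.coeff_mk, PowerSeries.coeff_mk, PowerSeries.coeff_C,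
            if_neg (Nat.succ_ne_zero n), zero_add, add_assoc, add_comm 1]
      rw [Finset.sum_range_succ, ← sub_sub, ih, e]
      rw [hs, pow_succ, mul_assoc, mul_sub PowerSeries.X, ← mul_sub]
      congr 1
      rw [sub_sub, sub_eq_iff_eq_add]
      refine (hp (s N)).trans ?_
      abel
  refine ⟨PowerSeries.mk fun n => g (s n), hJ.mem_of_sum (t := fun n => j (s n))
    (fun n => hj _) fun N n hn => ?_⟩
  rw [← sub_eq_zero, ← map_sub, hN N, PowerSeries.coeff_X_pow_mul', if_neg (not_le.2 hn)]

end

section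

/-! ### The third relation commutes with the first two -/

section Jacobi

variable {R : Type*} [Ring R] [Algebra ℂ R]

theorem commutator_shc (t : ℂ) (x : R) (p : R⟦X⟧) :
    (2 * t) • (shc t x * p - p * shc t x) =
      t • (symE (t • x) (PowerSeries.C x * p - p * PowerSeries.C x) +
        symE (-(t • x)) (PowerSeries.C x * p - p * PowerSeries.C x)) := by
  have h₁ := expZ_commutator (t • x) p
  have h₂ := expZ_commutator (-(t • x)) p
  have h₃ := two_smul_X_mul_shc t x
  have e₁ : PowerSeries.C (t • x) * p - p * PowerSeries.C (t • x) =
      t • (PowerSeries.C x * p - p * PowerSeries.C x) := by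
    rw [C_smul, smul_mul_assoc, mul_smul_comm, smul_sub]
  have e₂ : PowerSeries.C (-(t • x)) * p - p * PowerSeries.C (-(t • x)) =
      (-t) • (PowerSeries.C x * p - p * PowerSeries.C x) := by
    rw [← neg_smul, C_smul, smul_mul_assoc, mul_smul_comm, smul_sub]
  rw [e₁, symE_smul] at h₁
  rw [e₂, symE_smul] at h₂
  refine smul_X_mul_cancel one_ne_zero ?_
  rw [one_smul, one_smul]
  calc PowerSeries.X * ((2 * t) • (shc t x * p - p * shc t x))
      = ((2 * t) • (PowerSeries.X * shc t x)) * p - p * ((2 * t) • (PowerSeries.X * shc t x)) := by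
        rw [mul_smul_comm, mul_sub, smul_sub, smul_mul_assoc, mul_smul_comm, mul_assoc,
          ← mul_assoc p, ← mul_assoc PowerSeries.X p, PowerSeries.X_mul (φ := p)]
    _ = (expZ (t • x) * p - p * expZ (t • x)) - (expZ (-(t • x)) * p - p * expZ (-(t • x))) := by
        rw [h₃]
        noncomm_ring
    _ = _ := by
        rw [h₁, h₂]
        simp only [mul_smul_comm, mul_add]
        module

/-- After clearing 2z this is the addition theorem 2 sinh(s+t) = 2 cosh t sinh s + 2 cosh s sinh t.
It provides the sinh(z(1+ρ)A) in [B,C]. -/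
theorem shc_addition (s t : ℂ) (x : R) :
    (2 * (s + t)) • shc (s + t) x = s • (expZ (t • x) * shc s x + expZ (-(t • x)) * shc s x) +
      t • (expZ (s • x) * shc t x + expZ (-(s • x)) * shc t x) := by
  have c : Commute (s • x) (t • x) := ((Commute.refl x).smul_left s).smul_right t
  have e₁ : expZ ((s + t) • x) = expZ (s • x) * expZ (t • x) := by rw [add_smul, expZ_add c]
  have e₁' : expZ (s • x) * expZ (t • x) = expZ (t • x) * expZ (s • x) :=
    commute_expZ (commute_C_expZ c)
  have e₂ : expZ (-((s + t) • x)) = expZ (-(s • x)) * expZ (-(t • x)) := by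
    rw [add_smul, neg_add, expZ_add c.neg_left.neg_right]
  have e₂' : expZ (-(s • x)) * expZ (-(t • x)) = expZ (-(t • x)) * expZ (-(s • x)) :=
    commute_expZ (commute_C_expZ c.neg_left.neg_right)
  have e₃ : expZ (s • x) * expZ (-(t • x)) = expZ (-(t • x)) * expZ (s • x) :=
    commute_expZ (commute_C_expZ c.neg_right)
  have e₄ : expZ (-(s • x)) * expZ (t • x) = expZ (t • x) * expZ (-(s • x)) :=
    commute_expZ (commute_C_expZ c.neg_left)
  have k : ∀ (y : R) (u : ℂ), (2 : ℂ) • (PowerSeries.X * (u • (expZ y * shc u x))) =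
      expZ y * (expZ (u • x) - expZ (-(u • x))) := fun y u => by
    rw [← two_smul_X_mul_shc, mul_smul_comm, mul_smul_comm, smul_smul, ← mul_assoc, ← mul_assoc,
      PowerSeries.X_mul (φ := expZ y)]
  refine smul_X_mul_cancel (two_ne_zero (α := ℂ)) ?_
  simp only [smul_add, mul_add PowerSeries.X, k]
  rw [mul_smul_comm, two_smul_X_mul_shc, e₁, e₂]
  simp only [mul_sub, e₁', e₂', e₃, e₄]
  module

/-- This is the Jacobi identity in deformed form. Under ad A both [B,C] and its prescribed value
have weight c₂ - ρc₂, up to terms that match by the sinh addition theorem. The defect of the third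
relation is then an eigenvector of ad A, so it only has to be checked on the B^j C^l. -/
theorem commutator_relBC {ρ : ℂ} {k : StructureConstants} {a : R} {b c : R⟦X⟧}
    (h₃ : k.c₃ = 0) (hb : ρ = 1 ∨ k.b₂ = 0)
    (ha : ρ = 1 ∨ k.a₁ * k.c₂ = (1 + ρ) * (k.a₂ * k.c₁))
    (hAB : relAB k a b c = 0) (hAC : relAC ρ k a b c = 0) :
    PowerSeries.C a * relBC ρ k a b c - relBC ρ k a b c * PowerSeries.C a =
      ((1 - ρ) * k.c₂) • relBC ρ k a b c := by
  rw [relAB, sub_eq_zero, valAB, h₃, zero_smul, add_zero] at hAB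
  rw [relAC, sub_eq_zero, valAC] at hAC
  have hsa : ∀ t : ℂ, PowerSeries.C a * shc t a - shc t a * PowerSeries.C a = 0 := fun t =>
    sub_eq_zero.2 (commute_shc (Commute.refl a) t).eq
  have hE : ∀ (t u : ℂ), symE (t • a) (shc u a) = expZ (t • a) * shc u a := fun t u =>
    symE_of_commute (commute_shc ((Commute.refl a).smul_left t) u)
  have hE' : ∀ (t u : ℂ), symE (-(t • a)) (shc u a) = expZ (-(t • a)) * shc u a := fun t u =>
    symE_of_commute (commute_shc ((Commute.refl a).smul_left t).neg_left u)
  have hc : ∀ (t : ℂ) (p q : R⟦X⟧), PowerSeries.C a * p - p * PowerSeries.C a = q →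
      PowerSeries.C a * symE (t • a) p - symE (t • a) p * PowerSeries.C a = symE (t • a) q := by
    intro t p q hq
    have ht : Commute (PowerSeries.C (t • a)) (PowerSeries.C a) :=
      commute_C_C ((Commute.refl a).smul_left t)
    rw [← hq, (isZLinear_symE _).map_sub, symE_mul_left ht, symE_mul_right ht]
  have hc' : ∀ (t : ℂ) (p q : R⟦X⟧), PowerSeries.C a * p - p * PowerSeries.C a = q →
      PowerSeries.C a * symE (-(t • a)) p - symE (-(t • a)) p * PowerSeries.C a =
        symE (-(t • a)) q := by
    intro t p q hq
    rw [← neg_smul]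
    exact hc _ _ _ hq
  have k₁ := commutator_shc 1 a c
  have k₂ := commutator_shc ρ a b
  rw [hAC] at k₁
  rw [hAB] at k₂
  have l₁ := hc ρ b _ hAB
  have l₂ := hc' ρ b _ hAB
  have l₃ := hc 1 c _ hAC
  have l₄ := hc' 1 c _ hAC
  have m := shc_addition 1 ρ a
  have n₁ : PowerSeries.C a * (b * c - c * b) - (b * c - c * b) * PowerSeries.C a =
      (PowerSeries.C a * b - b * PowerSeries.C a) * c +
        b * (PowerSeries.C a * c - c * PowerSeries.C a) -
        (PowerSeries.C a * c - c * PowerSeries.C a) * b -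
        c * (PowerSeries.C a * b - b * PowerSeries.C a) := by
    noncomm_ring
  have n₂ : PowerSeries.C a * relBC ρ k a b c - relBC ρ k a b c * PowerSeries.C a =
      (PowerSeries.C a * (b * c - c * b) - (b * c - c * b) * PowerSeries.C a) -
      (k.a₁ • (PowerSeries.C a * shc (1 + ρ) a - shc (1 + ρ) a * PowerSeries.C a) +
      (k.a₂ * 2⁻¹) • ((PowerSeries.C a * symE (ρ • a) b - symE (ρ • a) b * PowerSeries.C a) +
        (PowerSeries.C a * symE (-(ρ • a)) b - symE (-(ρ • a)) b * PowerSeries.C a)) +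
      (ρ * k.c₁ * 2⁻¹) • ((PowerSeries.C a * symE ((1 : ℂ) • a) c -
          symE ((1 : ℂ) • a) c * PowerSeries.C a) +
        (PowerSeries.C a * symE (-((1 : ℂ) • a)) c -
          symE (-((1 : ℂ) • a)) c * PowerSeries.C a))) := by
    rw [one_smul]
    simp only [relBC, valBC, mul_sub, sub_mul, mul_add, add_mul, mul_smul_comm, smul_mul_assoc]
    module
  rw [n₁, hAB, hAC, hsa, l₁, l₂, l₃, l₄] at n₂
  have k₁' : shc 1 a * c - c * shc 1 a =
      (2⁻¹ : ℂ) • ((2 * 1 : ℂ) • (shc 1 a * c - c * shc 1 a)) := by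
    module
  have k₂' : (k.a₂ * ρ) • (shc ρ a * b - b * shc ρ a) =
      (k.a₂ * 2⁻¹) • ((2 * ρ) • (shc ρ a * b - b * shc ρ a)) := by
    module
  rw [k₁] at k₁'
  rw [k₂] at k₂'
  -- Here the constraint on a₁ enters. For ρ = 1 the factor 1 - ρ makes it superfluous.
  have m' : ((1 - ρ) * (k.a₁ * k.c₂)) • shc (1 + ρ) a =
      ((1 - ρ) * (k.a₂ * k.c₁) * 2⁻¹) • ((2 * (1 + ρ)) • shc (1 + ρ) a) := by
    rcases ha with rfl | ha
    · simp
    · rw [ha, smul_smul]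
      congr 1
      ring
  rw [m] at m'
  -- The cosh terms in B with coefficient b₂ come once with c₁ and once with -ρc₁, so only the
  -- multiple by 1 - ρ is left.
  have hb' : (1 - ρ) * k.b₂ = 0 := by rcases hb with rfl | hb <;> simp [*]
  have m'' : (k.c₁ * 2⁻¹ * ((1 - ρ) * k.b₂)) • (symE a b + symE (-a) b) = 0 := by
    rw [hb', mul_zero, zero_smul]
  have hE₁ := hE 1
  have hE₁' := hE' 1
  simp only [one_smul] at n₂ k₁' k₂' m' hE₁ hE₁'
  have n₃ : PowerSeries.C a * relBC ρ k a b c - relBC ρ k a b c * PowerSeries.C a -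
      ((1 - ρ) * k.c₂) • relBC ρ k a b c = k.c₁ • (shc 1 a * c - c * shc 1 a) +
      (k.a₂ * ρ) • (shc ρ a * b - b * shc ρ a) - (k.a₂ * 2⁻¹) •
        (symE (ρ • a) (k.c₁ • shc 1 a + k.c₂ • b) + symE (-(ρ • a)) (k.c₁ • shc 1 a + k.c₂ • b)) -
      (ρ * k.c₁ * 2⁻¹) •
        (symE a (-((k.a₂ * ρ) • shc ρ a) + k.b₂ • b - (ρ * k.c₂) • c) +
          symE (-a) (-((k.a₂ * ρ) • shc ρ a) + k.b₂ • b - (ρ * k.c₂) • c)) +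
      ((1 - ρ) * k.c₂) • valBC ρ k a b c := by
    rw [n₂]
    simp only [relBC, mul_sub, sub_mul, mul_add, add_mul, mul_smul_comm, smul_mul_assoc, neg_mul,
      mul_neg]
    module
  rw [← sub_eq_zero, n₃, k₁', k₂', valBC]
  simp only [(isZLinear_symE _).add, (isZLinear_symE _).map_sub, (isZLinear_symE _).map_neg,
    symE_smul, hE, hE', hE₁, hE₁']
  linear_combination (norm := module) m' + m''

end Jacobi

end

section

section Values

variable {R : Type*} [Ring R] [Algebra ℂ R]

theorem valAC_sub (ρ : ℂ) (k : StructureConstants) (a : R) (b c c' : R⟦X⟧) :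
    valAC ρ k a b c - valAC ρ k a b c' = (-(ρ * k.c₂)) • (c - c') := by
  rw [valAC, valAC]
  module

theorem valBC_sub (ρ : ℂ) (k : StructureConstants) (a : R) (b c c' : R⟦X⟧) :
    valBC ρ k a b c - valBC ρ k a b c' = symE a ((ρ * k.c₁ * 2⁻¹) • (c - c')) +
      symE (-a) ((ρ * k.c₁ * 2⁻¹) • (c - c')) := by
  rw [symE_smul, symE_smul, (isZLinear_symE _).map_sub, (isZLinear_symE _).map_sub, valBC, valBC]
  module

end Values

/-! ### Operators on polynomials -/

/-- The linear operators on `ℂ[A,B,C]`. -/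
abbrev Op : Type := Module.End ℂ Poly

/-- The action of a series of operators on a series of polynomials. -/
def act (D : Op⟦X⟧) : Poly⟦X⟧ → Poly⟦X⟧ := extendZ fun n => PowerSeries.coeff n D

theorem isZLinear_act (D : Op⟦X⟧) : IsZLinear (act D) := isZLinear_extendZ _

theorem coeff_act_C (D : Op⟦X⟧) (n : ℕ) (p : Poly) :
    PowerSeries.coeff n (act D (PowerSeries.C p)) = PowerSeries.coeff n D p := coeff_extendZ_C _ n p

theorem act_mul (D E : Op⟦X⟧) (v : Poly⟦X⟧) : act (D * E) v = act D (act E v) := by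
  refine (isZLinear_act _).ext ((isZLinear_act D).comp (isZLinear_act E)) (fun p => ?_) v
  ext1 n
  rw [coeff_act_C, act, coeff_extendZ, PowerSeries.coeff_mul, LinearMap.sum_apply,
    ← Finset.Nat.sum_antidiagonal_swap]
  exact Finset.sum_congr rfl fun ij _ => by rw [coeff_act_C]; rfl

theorem act_add (D E : Op⟦X⟧) (v : Poly⟦X⟧) : act (D + E) v = act D v + act E v := by
  refine (isZLinear_act _).ext ((isZLinear_act D).add_fun (isZLinear_act E)) (fun p => ?_) v
  ext1 n
  rw [map_add, coeff_act_C, coeff_act_C, coeff_act_C, map_add, LinearMap.add_apply]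

theorem act_sub (D E : Op⟦X⟧) (v : Poly⟦X⟧) : act (D - E) v = act D v - act E v := by
  rw [eq_sub_iff_add_eq, ← act_add, sub_add_cancel]

/-- Multiplication by `A`. -/
def mulA : Op := LinearMap.mulLeft ℂ (letter 0)

/-- The monomial `A ^ i B ^ j C ^ k`. -/
def mon (i j k : ℕ) : Poly :=
  MvPolynomial.monomial (Finsupp.equivFunOnFinite.symm ![i, j, k]) 1

theorem letter_mul_mon_aux (s : Fin 3) (i j k i' j' k' : ℕ)
    (h : ∀ t, Finsupp.single s 1 t + ![i, j, k] t = ![i', j', k'] t) :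
    letter s * mon i j k = mon i' j' k' := by
  rw [letter, mon, mon, MvPolynomial.X, MvPolynomial.monomial_mul, one_mul]
  exact congrArg (fun m => MvPolynomial.monomial m (1 : ℂ)) (Finsupp.ext h)

theorem letter_zero_mul_mon (i j k : ℕ) : letter 0 * mon i j k = mon (i + 1) j k :=
  letter_mul_mon_aux _ _ _ _ _ _ _ fun t => by fin_cases t <;> simp [add_comm]

theorem letter_one_mul_mon (i j k : ℕ) : letter 1 * mon i j k = mon i (j + 1) k :=
  letter_mul_mon_aux _ _ _ _ _ _ _ fun t => by fin_cases t <;> simp [add_comm]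

theorem letter_two_mul_mon (i j k : ℕ) : letter 2 * mon i j k = mon i j (k + 1) :=
  letter_mul_mon_aux _ _ _ _ _ _ _ fun t => by fin_cases t <;> simp [add_comm]

theorem mulA_mon (i j k : ℕ) : mulA (mon i j k) = mon (i + 1) j k := letter_zero_mul_mon i j k

theorem mulA_pow_mon (n i j k : ℕ) : (mulA ^ n) (mon i j k) = mon (i + n) j k := by
  induction n with
  | zero => rfl
  | succ n ih => rw [pow_succ', Module.End.mul_apply, ih, mulA_mon, add_assoc]

theorem monomial_eq_mon (m : Fin 3 →₀ ℕ) :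
    (MvPolynomial.monomial m 1 : Poly) = mon (m 0) (m 1) (m 2) := by
  rw [mon]
  refine congrArg (fun m => MvPolynomial.monomial m (1 : ℂ)) (Finsupp.ext fun t => ?_)
  fin_cases t <;> rfl

theorem op_ext {D E : Op} (h : ∀ i j k, D (mon i j k) = E (mon i j k)) : D = E := by
  refine (MvPolynomial.basisMonomials (Fin 3) ℂ).ext fun m => ?_
  rw [MvPolynomial.coe_basisMonomials]
  change D (MvPolynomial.monomial m 1) = E (MvPolynomial.monomial m 1)
  rw [monomial_eq_mon]
  exact h _ _ _

theorem mon_mem_lowerDeg (i j k : ℕ) : mon i j k ∈ lowerDeg (i + j + k + 1) :=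
  monomial_mem_lowerDeg (by
    rw [Finsupp.degree_eq_sum, Fin.sum_univ_three]
    exact Nat.lt_succ_self _) 1

theorem lowerDeg_eq_span_mon (n : ℕ) : lowerDeg n =
    Submodule.span ℂ {p | ∃ i j k : ℕ, i + j + k < n ∧ p = mon i j k} := by
  refine le_antisymm (fun p hp => ?_) (Submodule.span_le.2 ?_)
  · rw [p.as_sum]
    refine Submodule.sum_mem _ fun m hm => ?_
    rw [← mul_one (MvPolynomial.coeff m p), ← smul_eq_mul, ← MvPolynomial.smul_monomial,
      monomial_eq_mon]
    refine Submodule.smul_mem _ _ (Submodule.subset_span ⟨_, _, _, ?_, rfl⟩)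
    by_contra h
    refine MvPolynomial.mem_support_iff.1 hm (hp m ?_)
    rw [Finsupp.degree_eq_sum, Fin.sum_univ_three]
    exact not_lt.1 h
  · rintro _ ⟨i, j, k, h, rfl⟩
    exact lowerDeg_mono h (mon_mem_lowerDeg i j k)

/-- The operator `D` with `D (A p) = (A - μ) D p + W p` and prescribed values on `B ^ j C ^ k`. -/
def rowOp (μ : ℂ) (W : Op) (base : ℕ → ℕ → Poly) : Op :=
  (MvPolynomial.basisMonomials (Fin 3) ℂ).constr ℂ fun m =>
    Nat.rec (base (m 1) (m 2))
      (fun i p => letter 0 * p - μ • p + W (mon i (m 1) (m 2))) (m 0)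

theorem rowOp_mon (μ : ℂ) (W : Op) (base : ℕ → ℕ → Poly) (i j k : ℕ) :
    rowOp μ W base (mon i j k) = Nat.rec (base j k)
      (fun i p => letter 0 * p - μ • p + W (mon i j k)) i :=
  (MvPolynomial.basisMonomials (Fin 3) ℂ).constr_basis ℂ _ _

theorem rowOp_mon_zero (μ : ℂ) (W : Op) (base : ℕ → ℕ → Poly) (j k : ℕ) :
    rowOp μ W base (mon 0 j k) = base j k := rowOp_mon μ W base 0 j k

/-- The recursion in the exponent of A is exactly this commutation rule. Since every monomial is
reached from some B^j C^l by multiplication with A, the values there can be prescribed freely. -/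
theorem rowOp_commutator (μ : ℂ) (W : Op) (base : ℕ → ℕ → Poly) :
    mulA * rowOp μ W base - rowOp μ W base * mulA = μ • rowOp μ W base - W := by
  refine op_ext fun i j k => ?_
  have h : rowOp μ W base (mon (i + 1) j k) = letter 0 * rowOp μ W base (mon i j k) -
      μ • rowOp μ W base (mon i j k) + W (mon i j k) := by
    rw [rowOp_mon, rowOp_mon]
  rw [LinearMap.sub_apply, Module.End.mul_apply, Module.End.mul_apply, mulA_mon, h,
    LinearMap.sub_apply, LinearMap.smul_apply]
  change letter 0 * _ - _ = _
  abel

/-- The coefficientwise version of `rowOp`. -/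
def rowOpZ (μ : ℂ) (W : Op⟦X⟧) (base : ℕ → ℕ → Poly⟦X⟧) : Op⟦X⟧ :=
  PowerSeries.mk fun n =>
    rowOp μ (PowerSeries.coeff n W) fun j k => PowerSeries.coeff n (base j k)

theorem act_rowOpZ (μ : ℂ) (W : Op⟦X⟧) (base : ℕ → ℕ → Poly⟦X⟧) (j k : ℕ) :
    act (rowOpZ μ W base) (PowerSeries.C (mon 0 j k)) = base j k := by
  ext1 n
  rw [coeff_act_C, rowOpZ, PowerSeries.coeff_mk, rowOp_mon_zero]

theorem rowOpZ_commutator (μ : ℂ) (W : Op⟦X⟧) (base : ℕ → ℕ → Poly⟦X⟧) :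
    PowerSeries.C mulA * rowOpZ μ W base - rowOpZ μ W base * PowerSeries.C mulA =
      μ • rowOpZ μ W base - W := by
  ext1 n
  rw [map_sub, PowerSeries.coeff_C_mul, PowerSeries.coeff_mul_C, map_sub,
    PowerSeries.coeff_smul, rowOpZ, PowerSeries.coeff_mk]
  exact rowOp_commutator _ _ _

theorem coeff_apply_mon_eq_zero {μ : ℂ} {D : Op⟦X⟧}
    (h : PowerSeries.C mulA * D - D * PowerSeries.C mulA = μ • D) {j k : ℕ}
    (h₀ : act D (PowerSeries.C (mon 0 j k)) = 0) (n i : ℕ) :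
    PowerSeries.coeff n D (mon i j k) = 0 := by
  have hn := congrArg (PowerSeries.coeff n) h
  rw [map_sub, PowerSeries.coeff_C_mul, PowerSeries.coeff_mul_C, PowerSeries.coeff_smul] at hn
  induction i with
  | zero => rw [← coeff_act_C, h₀, map_zero]
  | succ i ih =>
    have := LinearMap.congr_fun hn (mon i j k)
    rw [LinearMap.sub_apply, Module.End.mul_apply, Module.End.mul_apply, mulA_mon, ih,
      LinearMap.smul_apply, ih, map_zero, smul_zero, zero_sub, neg_eq_zero] at this
    exact this

/-- An eigenvector of ad A can be moved past each factor A at the cost of a scalar, so vanishing on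
the B^j C^l spreads to all monomials. -/
theorem eq_zero_of_row {μ : ℂ} {D : Op⟦X⟧}
    (h : PowerSeries.C mulA * D - D * PowerSeries.C mulA = μ • D)
    (h₀ : ∀ j k, act D (PowerSeries.C (mon 0 j k)) = 0) : D = 0 := by
  ext1 n
  exact op_ext fun i j k => (coeff_apply_mon_eq_zero h (h₀ j k) n i).trans (by simp)

/-- The terms A^a D A^b apply D to A^b B^j C^l, where it vanishes as soon as it does on B^j C^l
itself. -/
theorem act_symE_eq_zero {μ : ℂ} {D : Op⟦X⟧}
    (h : PowerSeries.C mulA * D - D * PowerSeries.C mulA = μ • D) {j k : ℕ}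
    (h₀ : act D (PowerSeries.C (mon 0 j k)) = 0) (t : ℂ) :
    act (symE (t • mulA) D) (PowerSeries.C (mon 0 j k)) = 0 := by
  ext1 n
  rw [coeff_act_C, (isZLinear_symE _).coeff_eq, LinearMap.sum_apply]
  refine Finset.sum_eq_zero fun ij _ => ?_
  rw [coeff_symE_C, sandwich_apply, LinearMap.smul_apply, LinearMap.sum_apply,
    Finset.sum_eq_zero, smul_zero]
  intro ab _
  rw [Module.End.mul_apply, Module.End.mul_apply, smul_pow, smul_pow, LinearMap.smul_apply,
    LinearMap.smul_apply, mulA_pow_mon, map_smul, coeff_apply_mon_eq_zero h h₀, smul_zero, map_zero,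
    smul_zero]

/-! ### The operators B and C that represent the relations when c₃ = 0. -/

section Representation

variable (ρ : ℂ) (k : StructureConstants)

/-- The operator `B`. -/
def opB : Op⟦X⟧ :=
  rowOpZ k.c₂ (-(k.c₁ • shc 1 mulA)) fun j l => PowerSeries.C (mon 0 (j + 1) l)

/-- An operator that satisfies the second relation. -/
def opRow (base : ℕ → ℕ → Poly⟦X⟧) : Op⟦X⟧ :=
  rowOpZ (-(ρ * k.c₂)) ((k.a₂ * ρ) • shc ρ mulA - k.b₂ • opB k) base

/-- The values of the operator `C` on `B ^ j C ^ l`. -/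
def baseC (j l : ℕ) : Poly⟦X⟧ :=
  Nat.rec (PowerSeries.C (mon 0 0 (l + 1)))
    -- The rule CB = BC - [B,C] forces the value on B^(j+1) C^l. The operator C inside [B,C] is not
    -- yet available, so a row operator with the constant base value v replaces it;
    -- `act_valBC_congr` shows that this changes nothing.
    (fun j v => act (opB k) v -
      act (valBC ρ k mulA (opB k) (opRow ρ k fun _ _ => v)) (PowerSeries.C (mon 0 j l))) j

theorem baseC_zero (l : ℕ) : baseC ρ k 0 l = PowerSeries.C (mon 0 0 (l + 1)) := rfl

theorem baseC_succ (j l : ℕ) : baseC ρ k (j + 1) l = act (opB k) (baseC ρ k j l) -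
    act (valBC ρ k mulA (opB k) (opRow ρ k fun _ _ => baseC ρ k j l))
      (PowerSeries.C (mon 0 j l)) := rfl

/-- The operator `C`. -/
def opC : Op⟦X⟧ := opRow ρ k (baseC ρ k)

variable {ρ k}

theorem relAB_op (h₃ : k.c₃ = 0) (c : Op⟦X⟧) : relAB k mulA (opB k) c = 0 := by
  rw [relAB, opB, rowOpZ_commutator, valAB, h₃]
  module

theorem relAC_opRow (base : ℕ → ℕ → Poly⟦X⟧) : relAC ρ k mulA (opB k) (opRow ρ k base) = 0 := by
  rw [relAC, opRow, rowOpZ_commutator, valAC]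
  module

theorem opRow_commutator (base : ℕ → ℕ → Poly⟦X⟧) :
    PowerSeries.C mulA * opRow ρ k base - opRow ρ k base * PowerSeries.C mulA =
      valAC ρ k mulA (opB k) (opRow ρ k base) :=
  sub_eq_zero.1 (relAC_opRow base)

theorem opRow_sub_commutator (base base' : ℕ → ℕ → Poly⟦X⟧) :
    PowerSeries.C mulA * (opRow ρ k base - opRow ρ k base') -
        (opRow ρ k base - opRow ρ k base') * PowerSeries.C mulA =
      (-(ρ * k.c₂)) • (opRow ρ k base - opRow ρ k base') := by
  rw [mul_sub, sub_mul, sub_sub_sub_comm, opRow_commutator, opRow_commutator, valAC_sub]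

/-- Two rows differ by an eigenvector of ad A, and C enters [B,C] only through `symE`. By
`act_symE_eq_zero` the value on B^j C^l depends on the base value at (j, l) alone, which makes the
recursion for `baseC` legitimate. -/
theorem act_valBC_congr {base base' : ℕ → ℕ → Poly⟦X⟧} {j l : ℕ} (h : base j l = base' j l) :
    act (valBC ρ k mulA (opB k) (opRow ρ k base)) (PowerSeries.C (mon 0 j l)) =
      act (valBC ρ k mulA (opB k) (opRow ρ k base')) (PowerSeries.C (mon 0 j l)) := by
  have h₀ : act (opRow ρ k base - opRow ρ k base') (PowerSeries.C (mon 0 j l)) = 0 := by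
    rw [act_sub, opRow, opRow, act_rowOpZ, act_rowOpZ, h, sub_self]
  have hs : ∀ t : ℂ, act (symE (t • mulA)
      ((ρ * k.c₁ * 2⁻¹) • (opRow ρ k base - opRow ρ k base'))) (PowerSeries.C (mon 0 j l)) = 0 := by
    intro t
    refine act_symE_eq_zero (μ := -(ρ * k.c₂)) ?_ ?_ t
    · rw [mul_smul_comm, smul_mul_assoc, ← smul_sub, opRow_sub_commutator, smul_comm]
    · ext1 n
      rw [coeff_act_C, PowerSeries.coeff_smul, LinearMap.smul_apply, ← coeff_act_C, h₀, map_zero,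
        smul_zero]
  rw [← sub_eq_zero, ← act_sub]
  rw [valBC_sub, ← one_smul ℂ (mulA : Op), ← neg_smul, act_add, hs, hs, add_zero]

/-- The defect is an eigenvector of ad A by `commutator_relBC`, and on the B^j C^l it vanishes by
the choice of `baseC`. -/
theorem relBC_op (h : Constraints ρ k) (h₃ : k.c₃ = 0) :
    relBC ρ k mulA (opB k) (opC ρ k) = 0 := by
  refine eq_zero_of_row (commutator_relBC h₃ h.b₂ h.a₁ (relAB_op h₃ _) (relAC_opRow _))
    fun j l => ?_
  have hB : act (opB k) (PowerSeries.C (mon 0 j l)) = PowerSeries.C (mon 0 (j + 1) l) := by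
    rw [opB, act_rowOpZ]
  rw [relBC, act_sub, act_sub, act_mul, act_mul, hB, opC, opRow, act_rowOpZ, act_rowOpZ,
    baseC_succ, ← opRow, act_valBC_congr (base := baseC ρ k)
      (base' := fun _ _ => baseC ρ k j l) rfl]
  abel

end Representation

end

section

/-! ### Symbols of operators -/

/-- `D` is multiplication by `q` up to lower degree. -/
def HasSymbol (D : Op) (q : Poly) : Prop :=
  ∀ (n : ℕ) (p : Poly), p ∈ lowerDeg n → D p - q * p ∈ lowerDeg n

namespace HasSymbol

variable {D E : Op} {q r : Poly}

theorem add (hD : HasSymbol D q) (hE : HasSymbol E r) : HasSymbol (D + E) (q + r) :=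
  fun n p hp => by
    rw [LinearMap.add_apply, add_mul, add_sub_add_comm]
    exact Submodule.add_mem _ (hD n p hp) (hE n p hp)

theorem smul (hD : HasSymbol D q) (c : ℂ) : HasSymbol (c • D) (c • q) :=
  fun n p hp => by
    rw [LinearMap.smul_apply, smul_mul_assoc, ← smul_sub]
    exact Submodule.smul_mem _ _ (hD n p hp)

theorem mem (hD : HasSymbol D q) (hq : q ∈ lowerDeg 2) {n : ℕ} {p : Poly} (hp : p ∈ lowerDeg n) :
    D p ∈ lowerDeg (1 + n) := by
  rw [← sub_add_cancel (D p) (q * p)]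
  exact Submodule.add_mem _ (lowerDeg_mono (Nat.le_add_left _ _) (hD n p hp))
    (mul_mem_lowerDeg hq hp)

theorem of_mon (h : ∀ i j l, D (mon i j l) - q * mon i j l ∈ lowerDeg (i + j + l + 1)) :
    HasSymbol D q := by
  intro n p hp
  rw [lowerDeg_eq_span_mon] at hp
  induction hp using Submodule.span_induction with
  | mem x hx =>
    obtain ⟨i, j, l, hl, rfl⟩ := hx
    exact lowerDeg_mono hl (h i j l)
  | zero => simp
  | add x y _ _ hx hy =>
    rw [map_add, mul_add, add_sub_add_comm]
    exact Submodule.add_mem _ hx hy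
  | smul c x _ hx =>
    rw [map_smul, mul_smul_comm, ← smul_sub]
    exact Submodule.smul_mem _ _ hx

theorem mulA : HasSymbol mulA (letter 0) := fun n p _ => by
  change letter 0 * p - letter 0 * p ∈ _
  rw [sub_self]
  exact Submodule.zero_mem _

/-- Induction on the exponent of A: each application of the recursion multiplies the leading part by
A, while the scalar μ and the operator `W` contribute only lower degree. -/
theorem rowOp {μ : ℂ} {W : Op} {base : ℕ → ℕ → Poly} (hW : HasSymbol W r) (hr : r ∈ lowerDeg 2)
    (hq : q ∈ lowerDeg 2) (hb : ∀ j l, base j l - q * mon 0 j l ∈ lowerDeg (j + l + 1)) :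
    HasSymbol (rowOp μ W base) q := by
  refine of_mon fun i j l => ?_
  induction i with
  | zero => rw [rowOp_mon_zero, zero_add]; exact hb j l
  | succ i ih =>
    have hm := mon_mem_lowerDeg i j l
    have h : QuantumAlgebra3D.rowOp μ W base (mon (i + 1) j l) =
        letter 0 * QuantumAlgebra3D.rowOp μ W base (mon i j l) -
        μ • QuantumAlgebra3D.rowOp μ W base (mon i j l) + W (mon i j l) := by
      rw [rowOp_mon, rowOp_mon]
    have hD : QuantumAlgebra3D.rowOp μ W base (mon i j l) ∈ lowerDeg (1 + (i + j + l + 1)) := by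
      rw [← sub_add_cancel (QuantumAlgebra3D.rowOp μ W base (mon i j l)) (q * mon i j l)]
      exact Submodule.add_mem _ (lowerDeg_mono (Nat.le_add_left _ _) ih) (mul_mem_lowerDeg hq hm)
    have e : i + 1 + j + l + 1 = 1 + (i + j + l + 1) := by ring
    rw [h, ← letter_zero_mul_mon, e]
    have := mul_mem_lowerDeg (letter_mem_lowerDeg 0) ih
    convert Submodule.add_mem _ (Submodule.sub_mem _ this (Submodule.smul_mem _ μ hD))
      (hW.mem hr hm) using 1
    ring

end HasSymbol

theorem coeff_zero_symE {R : Type*} [Ring R] [Algebra ℂ R] (x : R) (p : R⟦X⟧) :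
    PowerSeries.coeff 0 (symE x p) = PowerSeries.coeff 0 p := by
  rw [(isZLinear_symE x).coeff_eq, Finset.Nat.antidiagonal_zero, Finset.sum_singleton, coeff_symE_C,
    sandwich_zero]
  simp

theorem coeff_zero_shc {R : Type*} [Ring R] [Algebra ℂ R] (t : ℂ) (x : R) :
    PowerSeries.coeff 0 (shc t x) = x := by
  rw [coeff_shc]
  simp

theorem coeff_zero_valBC {R : Type*} [Ring R] [Algebra ℂ R] (ρ : ℂ) (k : StructureConstants)
    (a : R) (b c : R⟦X⟧) : PowerSeries.coeff 0 (valBC ρ k a b c) =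
      k.a₁ • a + k.a₂ • PowerSeries.coeff 0 b + (ρ * k.c₁) • PowerSeries.coeff 0 c := by
  simp only [valBC, map_add, PowerSeries.coeff_smul, coeff_zero_symE, coeff_zero_shc]
  module

theorem coeff_zero_act (D : Op⟦X⟧) (v : Poly⟦X⟧) : PowerSeries.coeff 0 (act D v) =
    PowerSeries.coeff 0 D (PowerSeries.coeff 0 v) := by
  rw [act, coeff_extendZ, Finset.Nat.antidiagonal_zero, Finset.sum_singleton]

section Representation

variable {ρ : ℂ} {k : StructureConstants}

theorem smul_letter_mem_lowerDeg (c : ℂ) (i : Fin 3) : c • letter i ∈ lowerDeg 2 :=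
  Submodule.smul_mem _ _ (letter_mem_lowerDeg i)

theorem hasSymbol_opB : HasSymbol (PowerSeries.coeff 0 (opB k)) (letter 1) := by
  rw [opB, rowOpZ, PowerSeries.coeff_mk]
  refine HasSymbol.rowOp (r := (-k.c₁) • letter 0) ?_ (smul_letter_mem_lowerDeg _ _)
    (letter_mem_lowerDeg 1) fun j l => ?_
  · rw [← neg_smul, PowerSeries.coeff_smul, coeff_zero_shc]
    exact HasSymbol.mulA.smul _
  · rw [letter_one_mul_mon, PowerSeries.coeff_zero_C, sub_self]
    exact Submodule.zero_mem _

/-- At z = 0 the commutator [B,C] is linear, so passing C through one B changes only terms of lower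
degree. -/
theorem coeff_zero_baseC (j l : ℕ) :
    PowerSeries.coeff 0 (baseC ρ k j l) - mon 0 j (l + 1) ∈ lowerDeg (j + l + 1) := by
  induction j with
  | zero =>
    rw [baseC_zero, PowerSeries.coeff_zero_C, sub_self]
    exact Submodule.zero_mem _
  | succ j ih =>
    set v := PowerSeries.coeff 0 (baseC ρ k j l) with hv
    have hm : mon 0 j l ∈ lowerDeg (j + l + 1) := by simpa using mon_mem_lowerDeg 0 j l
    have hv' : v ∈ lowerDeg (1 + (j + l + 1)) := by
      rw [← sub_add_cancel v (mon 0 j (l + 1)), ← letter_two_mul_mon]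
      rw [← letter_two_mul_mon] at ih
      exact Submodule.add_mem _ (lowerDeg_mono (Nat.le_add_left _ _) ih)
        (mul_mem_lowerDeg (letter_mem_lowerDeg 2) hm)
    have e : PowerSeries.coeff 0 (opRow ρ k fun _ _ => baseC ρ k j l) (mon 0 j l) = v := by
      rw [hv, ← coeff_act_C, opRow, act_rowOpZ]
    have e' : j + 1 + l + 1 = 1 + (j + l + 1) := by ring
    rw [baseC_succ, map_sub, coeff_zero_act, coeff_zero_act, coeff_zero_valBC,
      PowerSeries.coeff_zero_C, ← hv, e']
    simp only [LinearMap.add_apply, LinearMap.smul_apply, e]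
    have h₁ := hasSymbol_opB (k := k) _ _ hv'
    have h₂ := mul_mem_lowerDeg (letter_mem_lowerDeg 1) ih
    have h₃ := HasSymbol.mulA.mem (letter_mem_lowerDeg 0) hm
    have h₄ := (hasSymbol_opB (k := k)).mem (letter_mem_lowerDeg 1) hm
    rw [← letter_one_mul_mon]
    convert Submodule.sub_mem _ (Submodule.add_mem _ h₁ h₂) (Submodule.add_mem _
      (Submodule.add_mem _ (Submodule.smul_mem _ k.a₁ h₃) (Submodule.smul_mem _ k.a₂ h₄))
      (Submodule.smul_mem _ (ρ * k.c₁) hv')) using 1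
    ring

theorem hasSymbol_opC : HasSymbol (PowerSeries.coeff 0 (opC ρ k)) (letter 2) := by
  rw [opC, opRow, rowOpZ, PowerSeries.coeff_mk]
  refine HasSymbol.rowOp (r := (k.a₂ * ρ) • letter 0 + (-k.b₂) • letter 1) ?_
    (Submodule.add_mem _ (smul_letter_mem_lowerDeg _ _) (smul_letter_mem_lowerDeg _ _))
    (letter_mem_lowerDeg 2) fun j l => ?_
  · rw [sub_eq_add_neg, ← neg_smul, map_add, PowerSeries.coeff_smul, PowerSeries.coeff_smul,
      coeff_zero_shc]
    exact (HasSymbol.mulA.smul _).add (hasSymbol_opB.smul _)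
  · rw [letter_two_mul_mon]
    exact coeff_zero_baseC j l

end Representation

/-! ### Triangularization for `ρ = 1` -/

section Triangular

/-- The structure constants in the basis `A, B', C'` with `B = -c₃ C'` and
`C = c₃⁻¹ B' + (c₂ + μ) C'`. -/
def triangular (k : StructureConstants) (μ : ℂ) : StructureConstants where
  a₁ := k.a₁
  a₂ := k.c₁ * k.c₃⁻¹
  a₃ := (k.c₂ + μ) * k.c₁ - k.c₃ * k.a₂
  b₁ := -(k.c₁ * k.c₃⁻¹)
  b₂ := -k.c₃⁻¹
  b₃ := -μ
  c₁ := (k.c₂ + μ) * k.c₁ - k.c₃ * k.a₂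
  c₂ := μ
  c₃ := 0

theorem constraints_triangular (k : StructureConstants) (μ : ℂ) :
    Constraints 1 (triangular k μ) where
  b₁ := by rw [triangular, one_mul]
  a₃ := by rw [triangular, one_mul]
  b₃ := by rw [triangular, one_mul]
  b₂ := Or.inl rfl
  c₃ := Or.inl rfl
  a₁ := Or.inl rfl

variable {R : Type*} [Ring R] [Algebra ℂ R]

theorem relAB_triangular {k : StructureConstants} (h : k.c₃ ≠ 0) (μ : ℂ) (a : R) (b c : R⟦X⟧) :
    relAB k a (-k.c₃ • c) (k.c₃⁻¹ • b + (k.c₂ + μ) • c) =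
      -k.c₃ • relAC 1 (triangular k μ) a b c := by
  simp only [relAB, relAC, valAB, valAC, triangular, mul_smul_comm, smul_mul_assoc]
  match_scalars <;> field_simp
  ring

/-- For ρ = 1 and b₃ = -c₂, ad A acts at z = 0 on the span of B and C modulo A by a traceless
matrix, whose eigenvalues are the two square roots of c₂² + b₂c₃. The hypothesis on μ says that it
is one of them, so the new letter B' can be an eigenvector modulo A. -/
theorem relAC_triangular {k : StructureConstants} (h : k.c₃ ≠ 0) {μ : ℂ}
    (hμ : μ ^ 2 = k.c₂ ^ 2 + k.b₂ * k.c₃) (a : R) (b c : R⟦X⟧) :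
    relAC 1 k a (-k.c₃ • c) (k.c₃⁻¹ • b + (k.c₂ + μ) • c) =
      k.c₃⁻¹ • relAB (triangular k μ) a b c +
        (k.c₂ + μ) • relAC 1 (triangular k μ) a b c := by
  have hb : k.b₂ = (μ ^ 2 - k.c₂ ^ 2) * k.c₃⁻¹ := by
    rw [hμ, add_sub_cancel_left, mul_inv_cancel_right₀ h]
  simp only [relAB, relAC, valAB, valAC, triangular, mul_smul_comm, smul_mul_assoc, mul_add,
    add_mul, hb]
  match_scalars <;> field_simp <;> ring

/-- The change of basis has determinant 1, so [B,C] = [B',C']. -/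
theorem relBC_triangular {k : StructureConstants} (h : k.c₃ ≠ 0) (μ : ℂ) (a : R) (b c : R⟦X⟧) :
    relBC 1 k a (-k.c₃ • c) (k.c₃⁻¹ • b + (k.c₂ + μ) • c) =
      relBC 1 (triangular k μ) a b c := by
  simp only [relBC, valBC, triangular, mul_smul_comm, smul_mul_assoc, mul_add,
    add_mul, symE_smul, (isZLinear_symE _).add, one_smul]
  match_scalars <;> field_simp <;> ring

end Triangular

end

section

/-! ### Linear independence of the symmetrized monomials -/

section Injectivity

variable {φ : Free →ₐ[ℂ] Op⟦X⟧} {θ : Poly →ₐ[ℂ] Poly}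

/-- The symbols multiply along the word. Applied to 1, its operator at z = 0 therefore has the
substituted commutative monomial as leading term. -/
theorem apply_word_sub_mem (hθ : ∀ i, θ (letter i) ∈ lowerDeg 2)
    (hφ : ∀ i, HasSymbol (PowerSeries.coeff 0 (φ (gen i))) (θ (letter i))) (l : List (Fin 3)) :
    PowerSeries.coeff 0 (φ (word l)) 1 - θ (l.map letter).prod ∈ lowerDeg l.length := by
  induction l with
  | nil => simp [word_nil]
  | cons i l ih =>
    have hp : ∀ l : List (Fin 3), θ (l.map letter).prod ∈ lowerDeg (l.length + 1) := fun l => by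
      induction l with
      | nil => simpa using one_mem_lowerDeg
      | cons i l ih =>
        rw [List.map_cons, List.prod_cons, map_mul, List.length_cons, add_comm l.length, add_assoc]
        exact mul_mem_lowerDeg (hθ i) ih
    set v := PowerSeries.coeff 0 (φ (word l)) 1 with hv
    have h₁ : v ∈ lowerDeg (l.length + 1) := by
      rw [← sub_add_cancel v (θ (l.map letter).prod)]
      exact Submodule.add_mem _ (lowerDeg_mono (Nat.le_succ _) ih) (hp l)
    have h₂ := mul_mem_lowerDeg (hθ i) ih
    rw [add_comm] at h₂
    rw [word_cons, map_mul, PowerSeries.coeff_mul, Finset.Nat.antidiagonal_zero,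
      Finset.sum_singleton, Module.End.mul_apply, ← hv, List.map_cons,
      List.prod_cons, map_mul, List.length_cons]
    convert Submodule.add_mem _ (hφ i _ _ h₁) h₂ using 1
    ring

theorem apply_sym_sub_mem (hθ : ∀ i, θ (letter i) ∈ lowerDeg 2)
    (hφ : ∀ i, HasSymbol (PowerSeries.coeff 0 (φ (gen i))) (θ (letter i))) {n : ℕ} {g : Poly}
    (hg : g ∈ lowerDeg (n + 1)) : PowerSeries.coeff 0 (φ (sym g)) 1 - θ g ∈ lowerDeg n := by
  rw [lowerDeg_eq_span] at hg
  induction hg using Submodule.span_induction with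
  | mem x hx =>
    obtain ⟨l, hl, rfl⟩ := hx
    refine lowerDeg_mono (Nat.lt_succ_iff.1 hl) ?_
    have h : ∀ p : Equiv.Perm (Fin l.length), PowerSeries.coeff 0 (φ (List.ofFn fun i =>
        gen (l.get (p i))).prod) 1 - θ (l.map letter).prod ∈ lowerDeg l.length := fun p => by
      have hp : (List.ofFn fun i => l.get (p i)).Perm l := by
        have := Equiv.Perm.ofFn_comp_perm p l.get
        rwa [List.ofFn_get] at this
      have := apply_word_sub_mem hθ hφ (List.ofFn fun i => l.get (p i))
      rw [(hp.map letter).prod_eq, hp.length_eq, word, List.map_ofFn] at this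
      exact this
    have e : θ (l.map letter).prod = ((l.length.factorial : ℂ)⁻¹) •
        ∑ _p : Equiv.Perm (Fin l.length), θ (l.map letter).prod := by
      rw [Finset.sum_const, Finset.card_univ, Fintype.card_perm, Fintype.card_fin,
        ← Nat.cast_smul_eq_nsmul ℂ, smul_smul,
        inv_mul_cancel₀
        (Nat.cast_ne_zero.2 (Nat.factorial_ne_zero _)), one_smul]
    rw [sym_prod_letter, symWord, map_smul, map_sum, PowerSeries.coeff_smul, map_sum,
      LinearMap.smul_apply, LinearMap.sum_apply, e, ← smul_sub, ← Finset.sum_sub_distrib]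
    exact Submodule.smul_mem _ _ (Submodule.sum_mem _ fun p _ => h p)
  | zero => simp
  | add x y _ _ hx hy =>
    rw [map_add, map_add, map_add, map_add, LinearMap.add_apply, add_sub_add_comm]
    exact Submodule.add_mem _ hx hy
  | smul c x _ hx =>
    rw [map_smul, map_smul, PowerSeries.coeff_smul, LinearMap.smul_apply, map_smul, ← smul_sub]
    exact Submodule.smul_mem _ _ hx

/-- If the operator vanishes then so does the leading term of θ(g). As θ reflects the degree
filtration, the degree bound of g drops step by step to zero. -/
theorem eq_zero_of_apply_sym (hθ : ∀ i, θ (letter i) ∈ lowerDeg 2)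
    (hφ : ∀ i, HasSymbol (PowerSeries.coeff 0 (φ (gen i))) (θ (letter i)))
    (hθ' : ∀ n g, θ g ∈ lowerDeg n → g ∈ lowerDeg n) {g : Poly}
    (hg : PowerSeries.coeff 0 (φ (sym g)) = 0) : g = 0 := by
  have key : ∀ n, g ∈ lowerDeg n → g = 0 := by
    intro n
    induction n with
    | zero => exact lowerDeg_zero
    | succ n ih =>
      intro h
      have := apply_sym_sub_mem hθ hφ h
      rw [hg, LinearMap.zero_apply, zero_sub, ← map_neg] at this
      exact ih (neg_mem_iff.1 (hθ' _ _ this))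
  obtain ⟨n, hn⟩ := exists_mem_lowerDeg g
  exact key n hn

variable {s : Set Free⟦X⟧}

theorem extHom_eq_zero (hs : ∀ p ∈ s, extHom φ p = 0) {p : Free⟦X⟧} (hp : p ∈ closedIdeal s) :
    extHom φ p = 0 := by
  have := map_mem_of_mem_closedIdeal (isZLinear_extHom φ) isZClosed_bot
    (fun p hp => (TwoSidedIdeal.mem_bot _).2 (hs p hp)) hp
  exact (TwoSidedIdeal.mem_bot _).1 this

/-- The lowest nonvanishing coefficient of g would be killed by the representation at z = 0. So
independence over power series follows from independence at z = 0. -/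
theorem eq_zero_of_symZ_mem (hs : ∀ p ∈ s, extHom φ p = 0)
    (h₀ : ∀ g, PowerSeries.coeff 0 (φ (sym g)) = 0 → g = 0) {g : Poly⟦X⟧}
    (hg : symZ g ∈ closedIdeal s) : g = 0 := by
  have h := extHom_eq_zero hs hg
  ext1 n
  rw [map_zero]
  induction n using Nat.strong_induction_on with
  | _ n ih =>
    have hn := congrArg (PowerSeries.coeff n) h
    rw [(isZLinear_extHom φ).coeff_eq, Finset.sum_eq_single (n, 0), map_zero] at hn
    · rw [coeff_symZ, extHom_C] at hn
      exact h₀ _ hn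
    · rintro ⟨i, j⟩ hij hne
      have : i < n := by
        rw [Finset.HasAntidiagonal.mem_antidiagonal] at hij
        rcases Nat.eq_zero_or_pos j with rfl | hj
        · exact absurd (show (i, 0) = (n, 0) from Prod.ext hij rfl) hne
        · simp only at hij
          lia
      rw [coeff_symZ, ih i this]
      simp
    · intro hn
      exact absurd (Finset.HasAntidiagonal.mem_antidiagonal.2 (add_zero n)) hn

theorem eq_zero_of_sym_mem (hs : ∀ p ∈ s, extHom φ p = 0)
    (h₀ : ∀ g, PowerSeries.coeff 0 (φ (sym g)) = 0 → g = 0) {g : Poly}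
    (hg : sym g ∈ limitIdeal (closedIdeal s)) : g = 0 := by
  obtain ⟨p, hp, e⟩ := mem_limitIdeal.1 hg
  have h := congrArg (PowerSeries.coeff 0) (extHom_eq_zero hs hp)
  rw [(isZLinear_extHom φ).coeff_eq, Finset.Nat.antidiagonal_zero, Finset.sum_singleton,
    map_zero, extHom_C] at h
  change PowerSeries.coeff 0 (φ (PowerSeries.coeff 0 p)) = 0 at h
  rw [PowerSeries.coeff_zero_eq_constantCoeff_apply p, e] at h
  exact h₀ _ h

end Injectivity

/-! ### The representation of the family -/

variable {ρ : ℂ} {k : StructureConstants}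

/-- The operators `A, β, γ`. -/
def opHom (β γ : Op⟦X⟧) : Free →ₐ[ℂ] Op⟦X⟧ :=
  FreeAlgebra.lift ℂ ![PowerSeries.C mulA, β, γ]

theorem opHom_gen (β γ : Op⟦X⟧) (i : Fin 3) :
    opHom β γ (gen i) = ![PowerSeries.C mulA, β, γ] i := FreeAlgebra.lift_ι_apply _ _

theorem extHom_opHom {β γ : Op⟦X⟧} (h₁ : relAB k mulA β γ = 0) (h₂ : relAC ρ k mulA β γ = 0)
    (h₃ : relBC ρ k mulA β γ = 0) : ∀ p ∈ (family ρ k).relators, extHom (opHom β γ) p = 0 := by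
  have h₀ : opHom β γ (gen 0) = PowerSeries.C mulA := opHom_gen β γ 0
  have hβ : opHom β γ (gen 1) = β := opHom_gen β γ 1
  have hγ : opHom β γ (gen 2) = γ := opHom_gen β γ 2
  rintro p (rfl | rfl | rfl)
  · rw [relator_family_AB, extHom_relAB _ h₀, extHom_C, extHom_C, hβ, hγ, h₁]
  · rw [relator_family_AC, extHom_relAC _ h₀, extHom_C, extHom_C, hβ, hγ, h₂]
  · rw [relator_family_BC, extHom_relBC _ h₀, extHom_C, extHom_C, hβ, hγ, h₃]

theorem map_mem_lowerDeg {θ : Poly →ₐ[ℂ] Poly} (hθ : ∀ i, θ (letter i) ∈ lowerDeg 2) {n : ℕ}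
    {g : Poly} (hg : g ∈ lowerDeg n) : θ g ∈ lowerDeg n := by
  rw [lowerDeg_eq_span] at hg
  induction hg using Submodule.span_induction with
  | mem x hx =>
    obtain ⟨l, hl, rfl⟩ := hx
    refine lowerDeg_mono hl ?_
    clear hl
    induction l with
    | nil => simpa using one_mem_lowerDeg
    | cons i l ih =>
      rw [List.map_cons, List.prod_cons, map_mul, List.length_cons, Nat.succ_eq_add_one,
        add_comm l.length, add_assoc]
      exact mul_mem_lowerDeg (hθ i) ih
  | zero => simp
  | add x y _ _ hx hy =>
    rw [map_add]
    exact Submodule.add_mem _ hx hy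
  | smul c x _ hx =>
    rw [map_smul]
    exact Submodule.smul_mem _ _ hx

theorem exists_faithful_of {β γ : Op⟦X⟧} (h₁ : relAB k mulA β γ = 0)
    (h₂ : relAC ρ k mulA β γ = 0) (h₃ : relBC ρ k mulA β γ = 0) (θ θ' : Poly →ₐ[ℂ] Poly)
    (hθ : ∀ i, θ (letter i) ∈ lowerDeg 2) (hθ' : ∀ i, θ' (letter i) ∈ lowerDeg 2)
    (hinv : ∀ i, θ' (θ (letter i)) = letter i) (e₀ : θ (letter 0) = letter 0)
    (e₁ : HasSymbol (PowerSeries.coeff 0 β) (θ (letter 1)))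
    (e₂ : HasSymbol (PowerSeries.coeff 0 γ) (θ (letter 2))) :
    ∃ φ : Free →ₐ[ℂ] Op⟦X⟧, (∀ p ∈ (family ρ k).relators, extHom φ p = 0) ∧
      ∀ g, PowerSeries.coeff 0 (φ (sym g)) = 0 → g = 0 := by
  refine ⟨opHom β γ, extHom_opHom h₁ h₂ h₃, fun g => eq_zero_of_apply_sym (θ := θ) hθ ?_ ?_⟩
  · intro i
    match i with
    | 0 =>
      rw [opHom_gen, e₀]
      change HasSymbol (PowerSeries.coeff 0 (PowerSeries.C mulA)) (letter 0)
      rw [PowerSeries.coeff_zero_C]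
      exact HasSymbol.mulA
    | 1 => rw [opHom_gen]; exact e₁
    | 2 => rw [opHom_gen]; exact e₂
  · intro n g hg
    have : θ'.comp θ = AlgHom.id ℂ Poly := MvPolynomial.algHom_ext hinv
    have hg' := map_mem_lowerDeg hθ' hg
    rwa [← AlgHom.comp_apply, this] at hg'

theorem Constraints.exists_faithful (h : Constraints ρ k) :
    ∃ φ : Free →ₐ[ℂ] Op⟦X⟧, (∀ p ∈ (family ρ k).relators, extHom φ p = 0) ∧
      ∀ g, PowerSeries.coeff 0 (φ (sym g)) = 0 → g = 0 := by
  by_cases h₃ : k.c₃ = 0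
  · exact exists_faithful_of (relAB_op h₃ (opC ρ k)) (relAC_opRow _) (relBC_op h h₃)
      (AlgHom.id _ _) (AlgHom.id _ _) letter_mem_lowerDeg letter_mem_lowerDeg (fun _ => rfl) rfl
      hasSymbol_opB hasSymbol_opC
  · obtain rfl : ρ = 1 := h.c₃.resolve_right h₃
    -- An eigenvalue of ad A on the span of B and C modulo A, at z = 0.
    obtain ⟨μ, hμ⟩ := IsAlgClosed.exists_pow_nat_eq (k.c₂ ^ 2 + k.b₂ * k.c₃) two_pos
    have h' := constraints_triangular k μ
    have r₁ := relAB_op (k := triangular k μ) rfl (opC 1 (triangular k μ))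
    have r₂ := relAC_opRow (ρ := 1) (k := triangular k μ) (baseC 1 (triangular k μ))
    have r₃ := relBC_op h' rfl
    have q₁ := relAB_triangular h₃ μ mulA (opB (triangular k μ)) (opC 1 (triangular k μ))
    have q₂ := relAC_triangular h₃ hμ mulA (opB (triangular k μ)) (opC 1 (triangular k μ))
    have q₃ := relBC_triangular h₃ μ mulA (opB (triangular k μ)) (opC 1 (triangular k μ))
    rw [r₁] at q₂
    rw [r₃] at q₃
    change relAC 1 (triangular k μ) mulA (opB (triangular k μ)) (opC 1 (triangular k μ)) = 0 at r₂
    rw [r₂] at q₁ q₂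
    simp only [smul_zero, add_zero] at q₁ q₂
    -- The first substitution records the symbols of B and C in terms of the new letters, and the
    -- second is its inverse.
    refine exists_faithful_of q₁ q₂ q₃
      (MvPolynomial.aeval ![letter 0, -k.c₃ • letter 2,
        k.c₃⁻¹ • letter 1 + (k.c₂ + μ) • letter 2])
      (MvPolynomial.aeval ![letter 0, k.c₃ • letter 2 + (k.c₂ + μ) • letter 1,
        -k.c₃⁻¹ • letter 1]) ?_ ?_ ?_ ?_ ?_ ?_
    · intro i
      rw [MvPolynomial.aeval_X]
      match i with
      | 0 => exact letter_mem_lowerDeg 0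
      | 1 => exact smul_letter_mem_lowerDeg _ _
      | 2 => exact Submodule.add_mem _ (smul_letter_mem_lowerDeg _ _)
                (smul_letter_mem_lowerDeg _ _)
    · intro i
      rw [MvPolynomial.aeval_X]
      match i with
      | 0 => exact letter_mem_lowerDeg 0
      | 1 => exact Submodule.add_mem _ (smul_letter_mem_lowerDeg _ _)
                (smul_letter_mem_lowerDeg _ _)
      | 2 => exact smul_letter_mem_lowerDeg _ _
    · intro i
      rw [MvPolynomial.aeval_X]
      match i with
      | 0 => simp
      | 1 =>
        simp [smul_smul, h₃]
      | 2 =>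
        simp only [Matrix.cons_val, map_add, map_smul, MvPolynomial.aeval_X]
        match_scalars <;> field_simp
        ring
    · simp
    · rw [MvPolynomial.aeval_X, PowerSeries.coeff_smul]
      exact hasSymbol_opC.smul _
    · rw [MvPolynomial.aeval_X, map_add, PowerSeries.coeff_smul, PowerSeries.coeff_smul]
      exact (hasSymbol_opB.smul _).add (hasSymbol_opC.smul _)

end

section

/-! ### The classical limit -/

/-- The commutators are linear at `z = 0`. -/
structure Rules.LinearLimit (F : Rules) (k : StructureConstants) : Prop where
  AB : PowerSeries.coeff 0 F.AB = linearPoly k.c₁ k.c₂ k.c₃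
  AC : PowerSeries.coeff 0 F.AC = linearPoly k.b₁ k.b₂ k.b₃
  BC : PowerSeries.coeff 0 F.BC = linearPoly k.a₁ k.a₂ k.a₃

theorem sub_sym_mem_limitIdeal {J : TwoSidedIdeal Free⟦X⟧} {i j : Fin 3} {P : Poly⟦X⟧}
    (h : relator i j P ∈ J) {r s t : ℂ} (hP : PowerSeries.coeff 0 P = linearPoly r s t) :
    gen i * gen j - gen j * gen i - (r • gen 0 + s • gen 1 + t • gen 2) ∈ limitIdeal J := by
  refine mem_limitIdeal.2 ⟨_, h, ?_⟩
  rw [relator, ← PowerSeries.coeff_zero_eq_constantCoeff_apply, map_sub, coeff_symZ, hP,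
    sym_linearPoly, PowerSeries.coeff_zero_C]

theorem linear_mem_shortWords (r s t : ℂ) :
    r • gen 0 + s • gen 1 + t • gen 2 ∈ shortWords 2 := by
  have h : ∀ i, gen i ∈ shortWords 2 := fun i => by
    have := word_mem_shortWords (l := [i]) (n := 2) (by simp)
    rwa [word_cons, word_nil, mul_one] at this
  exact Submodule.add_mem _ (Submodule.add_mem _ (Submodule.smul_mem _ _ (h 0))
    (Submodule.smul_mem _ _ (h 1))) (Submodule.smul_mem _ _ (h 2))

variable {F : Rules} {k : StructureConstants}

theorem Rules.LinearLimit.linearCommutators (h : F.LinearLimit k) :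
    LinearCommutators (limitIdeal (closedIdeal F.relators)) := by
  set I := limitIdeal (closedIdeal F.relators)
  have hs : ∀ i j, (∃ v ∈ shortWords 2, gen i * gen j - gen j * gen i - v ∈ I) →
      ∃ v ∈ shortWords 2, gen j * gen i - gen i * gen j - v ∈ I := by
    rintro i j ⟨v, hv, hm⟩
    refine ⟨-v, Submodule.neg_mem _ hv, ?_⟩
    have := I.neg_mem hm
    convert this using 1
    abel
  have hd : ∀ i, ∃ v ∈ shortWords 2, gen i * gen i - gen i * gen i - v ∈ I := fun i =>
    ⟨0, Submodule.zero_mem _, by rw [sub_self, sub_self]; exact I.zero_mem⟩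
  have h₁ : ∃ v ∈ shortWords 2, gen 0 * gen 1 - gen 1 * gen 0 - v ∈ I :=
    ⟨_, linear_mem_shortWords _ _ _,
      sub_sym_mem_limitIdeal (subset_closedIdeal _ F.relator_AB_mem) h.AB⟩
  have h₂ : ∃ v ∈ shortWords 2, gen 0 * gen 2 - gen 2 * gen 0 - v ∈ I :=
    ⟨_, linear_mem_shortWords _ _ _,
      sub_sym_mem_limitIdeal (subset_closedIdeal _ F.relator_AC_mem) h.AC⟩
  have h₃ : ∃ v ∈ shortWords 2, gen 1 * gen 2 - gen 2 * gen 1 - v ∈ I :=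
    ⟨_, linear_mem_shortWords _ _ _,
      sub_sym_mem_limitIdeal (subset_closedIdeal _ F.relator_BC_mem) h.BC⟩
  intro i j
  match i, j with
  | 0, 0 => exact hd 0
  | 1, 1 => exact hd 1
  | 2, 2 => exact hd 2
  | 0, 1 => exact h₁
  | 1, 0 => exact hs _ _ h₁
  | 0, 2 => exact h₂
  | 2, 0 => exact hs _ _ h₂
  | 1, 2 => exact h₃
  | 2, 1 => exact hs _ _ h₃

attribute [local instance] LieRing.ofAssociativeRing

section Envelope

variable (I : TwoSidedIdeal Free)

/-- The quotient algebra of the free algebra by an ideal. -/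
abbrev LimitAlgebra : Type := I.ringCon.Quotient

theorem mkA_eq_iff {x y : Free} :
    I.ringCon.mkₐ ℂ x = I.ringCon.mkₐ ℂ y ↔ x - y ∈ I :=
  (I.ringCon.eq).trans (I.rel_iff x y)

/-- The Lie algebra spanned by the generators in a quotient of the free algebra. -/
def spanLie (h : ∀ i j, I.ringCon.mkₐ ℂ (gen i * gen j - gen j * gen i) ∈
    Submodule.span ℂ (Set.range fun i => I.ringCon.mkₐ ℂ (gen i))) :
    LieSubalgebra ℂ (LimitAlgebra I) where
  toSubmodule := Submodule.span ℂ (Set.range fun i => I.ringCon.mkₐ ℂ (gen i))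
  lie_mem' {x y} hx hy := by
    refine LinearMap.BilinMap.apply_apply_mem_of_mem_span _ _ _
      (LieModule.toEnd ℂ (LimitAlgebra I) (LimitAlgebra I)).toLinearMap ?_ x y hx hy
    rintro _ ⟨i, rfl⟩ _ ⟨j, rfl⟩
    have := h i j
    rw [map_sub, map_mul, map_mul] at this
    exact this

variable {I}

/-- L is taken inside the associative quotient, as the span of the generators with the commutator
bracket. The Jacobi identity is inherited, and the universal property supplies the map from the
enveloping algebra. -/
theorem exists_envelope {a₁ a₂ a₃ b₁ b₂ b₃ c₁ c₂ c₃ : ℂ}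
    (h₁ : gen 0 * gen 1 - gen 1 * gen 0 - (c₁ • gen 0 + c₂ • gen 1 + c₃ • gen 2) ∈ I)
    (h₂ : gen 0 * gen 2 - gen 2 * gen 0 - (b₁ • gen 0 + b₂ • gen 1 + b₃ • gen 2) ∈ I)
    (h₃ : gen 1 * gen 2 - gen 2 * gen 1 - (a₁ • gen 0 + a₂ • gen 1 + a₃ • gen 2) ∈ I)
    (hli : LinearIndependent ℂ fun i => I.ringCon.mkₐ ℂ (gen i)) :
    ∃ (L : Type) (_ : LieRing L) (_ : LieAlgebra ℂ L) (e : Module.Basis (Fin 3) ℂ L),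
      ⁅e 0, e 1⁆ = c₁ • e 0 + c₂ • e 1 + c₃ • e 2 ∧
      ⁅e 0, e 2⁆ = b₁ • e 0 + b₂ • e 1 + b₃ • e 2 ∧
      ⁅e 1, e 2⁆ = a₁ • e 0 + a₂ • e 1 + a₃ • e 2 ∧
      ∃ f : UniversalEnvelopingAlgebra ℂ L →ₐ[ℂ] LimitAlgebra I,
        ∀ i, f (UniversalEnvelopingAlgebra.ι ℂ (e i)) = I.ringCon.mkₐ ℂ (gen i) := by
  rw [← mkA_eq_iff] at h₁ h₂ h₃
  have hm : ∀ i, I.ringCon.mkₐ ℂ (gen i) ∈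
      Submodule.span ℂ (Set.range fun i => I.ringCon.mkₐ ℂ (gen i)) :=
    fun i => Submodule.subset_span ⟨i, rfl⟩
  have hl : ∀ r s t : ℂ, I.ringCon.mkₐ ℂ (r • gen 0 + s • gen 1 + t • gen 2) ∈
      Submodule.span ℂ (Set.range fun i => I.ringCon.mkₐ ℂ (gen i)) := fun r s t => by
    rw [map_add, map_add, map_smul, map_smul, map_smul]
    exact Submodule.add_mem _ (Submodule.add_mem _ (Submodule.smul_mem _ _ (hm 0))
      (Submodule.smul_mem _ _ (hm 1))) (Submodule.smul_mem _ _ (hm 2))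
  have h : ∀ i j, I.ringCon.mkₐ ℂ (gen i * gen j - gen j * gen i) ∈
      Submodule.span ℂ (Set.range fun i => I.ringCon.mkₐ ℂ (gen i)) := by
    have hd : ∀ i, I.ringCon.mkₐ ℂ (gen i * gen i - gen i * gen i) ∈
        Submodule.span ℂ (Set.range fun i => I.ringCon.mkₐ ℂ (gen i)) := fun i => by
      rw [sub_self, map_zero]
      exact Submodule.zero_mem _
    intro i j
    match i, j with
    | 0, 0 => exact hd 0
    | 1, 1 => exact hd 1
    | 2, 2 => exact hd 2
    | 0, 1 => exact h₁ ▸ hl _ _ _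
    | 1, 0 => rw [← neg_sub, map_neg]; exact Submodule.neg_mem _ (h₁ ▸ hl _ _ _)
    | 0, 2 => exact h₂ ▸ hl _ _ _
    | 2, 0 => rw [← neg_sub, map_neg]; exact Submodule.neg_mem _ (h₂ ▸ hl _ _ _)
    | 1, 2 => exact h₃ ▸ hl _ _ _
    | 2, 1 => rw [← neg_sub, map_neg]; exact Submodule.neg_mem _ (h₃ ▸ hl _ _ _)
  let e : Module.Basis (Fin 3) ℂ (spanLie I h) := Module.Basis.span hli
  have he : ∀ i, (e i : LimitAlgebra I) = I.ringCon.mkₐ ℂ (gen i) :=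
    fun i => congrArg Subtype.val (Module.Basis.span_apply hli i)
  have hb : ∀ i j (r s t : ℂ), I.ringCon.mkₐ ℂ (gen i * gen j - gen j * gen i) =
      I.ringCon.mkₐ ℂ (r • gen 0 + s • gen 1 + t • gen 2) →
      ⁅e i, e j⁆ = r • e 0 + s • e 1 + t • e 2 := by
    intro i j r s t hij
    apply Subtype.ext
    rw [LieSubalgebra.coe_bracket]
    change _ = r • (e 0 : LimitAlgebra I) + s • (e 1 : LimitAlgebra I) + t • (e 2 : LimitAlgebra I)
    simp only [he]
    rw [LieRing.of_associative_ring_bracket]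
    simpa only [map_add, map_sub, map_mul, map_smul] using hij
  refine ⟨spanLie I h, inferInstance, inferInstance, e, hb _ _ _ _ _ h₁, hb _ _ _ _ _ h₂,
    hb _ _ _ _ _ h₃, UniversalEnvelopingAlgebra.lift ℂ (spanLie I h).incl, fun i => ?_⟩
  rw [UniversalEnvelopingAlgebra.lift_ι_apply]
  exact he i

end Envelope

theorem envelope_hom_surjective {L : Type} [LieRing L] [LieAlgebra ℂ L]
    (e : Module.Basis (Fin 3) ℂ L) {g : Free →ₐ[ℂ] UniversalEnvelopingAlgebra ℂ L}
    (hg : ∀ i, g (gen i) = UniversalEnvelopingAlgebra.ι ℂ (e i)) : Function.Surjective g := by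
  have hι : ∀ x : L, UniversalEnvelopingAlgebra.ι ℂ x ∈ g.range := by
    intro x
    have hx : x ∈ Submodule.span ℂ (Set.range e) := e.span_eq ▸ Submodule.mem_top
    induction hx using Submodule.span_induction with
    | mem x hx =>
      obtain ⟨i, rfl⟩ := hx
      exact ⟨gen i, hg i⟩
    | zero => rw [map_zero]; exact zero_mem _
    | add x y _ _ hx hy => rw [map_add]; exact add_mem hx hy
    | smul c x _ hx => rw [map_smul]; exact g.range.smul_mem hx c
  intro u
  obtain ⟨t, rfl⟩ : ∃ t, UniversalEnvelopingAlgebra.mkAlgHom ℂ L t = u :=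
    RingCon.mkₐ_surjective (α := ℂ) (UniversalEnvelopingAlgebra.ringCon ℂ L) u
  have ht : t ∈ Algebra.adjoin ℂ (Set.range (TensorAlgebra.ι ℂ : L →ₗ[ℂ] TensorAlgebra ℂ L)) :=
    TensorAlgebra.adjoin_range_ι (R := ℂ) (M := L) ▸ Algebra.mem_top
  have hle : Algebra.adjoin ℂ (Set.range (TensorAlgebra.ι ℂ : L →ₗ[ℂ] TensorAlgebra ℂ L)) ≤
      g.range.comap (UniversalEnvelopingAlgebra.mkAlgHom ℂ L) := by
    refine Algebra.adjoin_le ?_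
    rintro _ ⟨x, rfl⟩
    exact hι x
  exact hle ht

theorem isZClosed_ker_constantCoeff {R S : Type*} [Ring R] [Ring S] (f : R →+* S) :
    IsZClosed (TwoSidedIdeal.ker (f.comp (PowerSeries.constantCoeff (R := R)))) := by
  intro p hp
  obtain ⟨q, hq, h⟩ := hp 1
  rw [TwoSidedIdeal.mem_ker] at hq ⊢
  rw [← hq, RingHom.comp_apply, RingHom.comp_apply,
    ← PowerSeries.coeff_zero_eq_constantCoeff_apply, h 0 one_pos,
    PowerSeries.coeff_zero_eq_constantCoeff_apply]

theorem Rules.LinearLimit.classical_limit (h : F.LinearLimit k)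
    (hli : LinearIndependent ℂ fun i =>
      (limitIdeal (closedIdeal F.relators)).ringCon.mkₐ ℂ (gen i)) :
    ∃ (L : Type) (_ : LieRing L) (_ : LieAlgebra ℂ L) (e : Module.Basis (Fin 3) ℂ L),
      ⁅e 0, e 1⁆ = k.c₁ • e 0 + k.c₂ • e 1 + k.c₃ • e 2 ∧
      ⁅e 0, e 2⁆ = k.b₁ • e 0 + k.b₂ • e 1 + k.b₃ • e 2 ∧
      ⁅e 1, e 2⁆ = k.a₁ • e 0 + k.a₂ • e 1 + k.a₃ • e 2 ∧
      ∃ π : F.Uz →+* UniversalEnvelopingAlgebra ℂ L,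
        Function.Surjective π ∧
        (∀ u, π u = 0 ↔ ∃ v, u = toQuot F.relators PowerSeries.X * v) ∧
        (∀ c : ℂ, π (toQuot F.relators (PowerSeries.C (algebraMap ℂ Free c))) =
          algebraMap ℂ (UniversalEnvelopingAlgebra ℂ L) c) ∧
        ∀ i, π (toQuot F.relators (PowerSeries.C (gen i))) =
          UniversalEnvelopingAlgebra.ι ℂ (e i) := by
  obtain ⟨L, _, _, e, h₁, h₂, h₃, f, hf⟩ := exists_envelope
    (sub_sym_mem_limitIdeal (subset_closedIdeal _ F.relator_AB_mem) h.AB)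
    (sub_sym_mem_limitIdeal (subset_closedIdeal _ F.relator_AC_mem) h.AC)
    (sub_sym_mem_limitIdeal (subset_closedIdeal _ F.relator_BC_mem) h.BC) hli
  refine ⟨L, _, _, e, h₁, h₂, h₃, ?_⟩
  let g : Free →ₐ[ℂ] UniversalEnvelopingAlgebra ℂ L :=
    FreeAlgebra.lift ℂ fun i => UniversalEnvelopingAlgebra.ι ℂ (e i)
  have hg : ∀ i, g (gen i) = UniversalEnvelopingAlgebra.ι ℂ (e i) := fun i =>
    FreeAlgebra.lift_ι_apply _ _
  let gz : Free⟦X⟧ →+* UniversalEnvelopingAlgebra ℂ L :=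
    (g : Free →+* UniversalEnvelopingAlgebra ℂ L).comp (PowerSeries.constantCoeff (R := Free))
  have hgz : ∀ p, gz p = g (PowerSeries.constantCoeff p) := fun p => rfl
  have hrel : ∀ {i j : Fin 3} {P : Poly⟦X⟧} {r s t : ℂ},
      PowerSeries.coeff 0 P = linearPoly r s t → ⁅e i, e j⁆ = r • e 0 + s • e 1 + t • e 2 →
      gz (relator i j P) = 0 := by
    intro i j P r s t hP hb
    rw [hgz, ← PowerSeries.coeff_zero_eq_constantCoeff_apply, relator, map_sub, coeff_symZ, hP,
      sym_linearPoly, PowerSeries.coeff_zero_C, map_sub g, sub_eq_zero]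
    have := congrArg (UniversalEnvelopingAlgebra.ι ℂ) hb
    rw [LieHom.map_lie, LieRing.of_associative_ring_bracket] at this
    simpa only [map_add, map_sub, map_mul, map_smul, hg] using this
  have hker : ∀ p ∈ closedIdeal F.relators, gz p = 0 := by
    intro p hp
    refine (TwoSidedIdeal.mem_ker gz).1 (closedIdeal_le ?_ (isZClosed_ker_constantCoeff _) hp)
    rintro p (rfl | rfl | rfl)
    · exact (TwoSidedIdeal.mem_ker gz).2 (hrel h.AB h₁)
    · exact (TwoSidedIdeal.mem_ker gz).2 (hrel h.AC h₂)
    · exact (TwoSidedIdeal.mem_ker gz).2 (hrel h.BC h₃)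
  let π : F.Uz →+* UniversalEnvelopingAlgebra ℂ L := RingCon.lift _ gz fun x y hxy => by
    rw [RingCon.ker_apply, ← sub_eq_zero, ← map_sub]
    exact hker _ (((closedIdeal F.relators).rel_iff x y).1 hxy)
  have hπ : ∀ p, π (toQuot F.relators p) = g (PowerSeries.constantCoeff p) := fun p => rfl
  refine ⟨π, ?_, ?_, ?_, ?_⟩
  · intro u
    obtain ⟨x, rfl⟩ := envelope_hom_surjective e hg u
    exact ⟨toQuot F.relators (PowerSeries.C x), by rw [hπ, PowerSeries.constantCoeff_C]⟩
  · intro u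
    obtain ⟨p, rfl⟩ := toQuot_surjective F.relators u
    rw [hπ]
    constructor
    · intro hp
      -- Composing the map onto the enveloping algebra with the one back gives the quotient map. An
      -- element killed by `g` therefore lies in the limit ideal, and the kernel of π is exactly
      -- zU_z.
      have hfg : f.comp g = (limitIdeal (closedIdeal F.relators)).ringCon.mkₐ ℂ :=
        free_hom_ext fun i => by rw [AlgHom.comp_apply, hg, hf]
      have h0 : PowerSeries.constantCoeff p ∈ limitIdeal (closedIdeal F.relators) := by
        have := AlgHom.congr_fun hfg (PowerSeries.constantCoeff p)
        rw [AlgHom.comp_apply, hp, map_zero, ← map_zero ((limitIdeal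
          (closedIdeal F.relators)).ringCon.mkₐ ℂ), eq_comm, mkA_eq_iff, sub_zero] at this
        exact this
      obtain ⟨j, hj, hjp⟩ := mem_limitIdeal.1 h0
      obtain ⟨q, hq⟩ := eq_C_add_X_mul (p - j)
      rw [map_sub, hjp, sub_self, map_zero, zero_add] at hq
      refine ⟨toQuot F.relators q, ?_⟩
      rw [← map_mul, toQuot_eq_iff, ← hq, sub_sub_cancel]
      exact hj
    · rintro ⟨v, hv⟩
      obtain ⟨q, rfl⟩ := toQuot_surjective F.relators v
      rw [← hπ, hv, map_mul, hπ, PowerSeries.constantCoeff_X, map_zero, zero_mul]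
  · intro c
    rw [hπ, PowerSeries.constantCoeff_C, AlgHom.commutes]
  · intro i
    rw [hπ, PowerSeries.constantCoeff_C, hg]

/-! ### The family is a quantization -/

variable {ρ : ℂ}

theorem Constraints.linearLimit (h : Constraints ρ k) : (family ρ k).LinearLimit k where
  AB := by
    simp only [family, map_add, PowerSeries.coeff_smul, coeff_zero_shc, PowerSeries.coeff_zero_C,
      linearPoly]
  AC := by
    simp only [family, map_add, map_sub, map_neg, PowerSeries.coeff_smul, coeff_zero_shc,
      PowerSeries.coeff_zero_C, linearPoly, h.b₁, h.b₃]
    module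
  BC := by
    have hc : ∀ x, PowerSeries.coeff 0 (coshZ x) = 1 := fun x => by
      simp [coshZ]
    have hm : ∀ (x : Poly) (q : Poly⟦X⟧), PowerSeries.coeff 0 (PowerSeries.C x * q) =
        x * PowerSeries.coeff 0 q := fun x q => PowerSeries.coeff_C_mul 0 q x
    simp only [family, map_add, PowerSeries.coeff_smul, coeff_zero_shc, hm, hc, mul_one,
      linearPoly, h.a₃]

theorem Constraints.linearIndependent (h : Constraints ρ k) : LinearIndependent ℂ fun i =>
    (limitIdeal (closedIdeal (family ρ k).relators)).ringCon.mkₐ ℂ (gen i) := by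
  obtain ⟨φ, hs, h₀⟩ := h.exists_faithful
  rw [Fintype.linearIndependent_iff]
  intro c hc
  have e : ∑ i, c i • (limitIdeal (closedIdeal (family ρ k).relators)).ringCon.mkₐ ℂ (gen i) =
      (limitIdeal (closedIdeal (family ρ k).relators)).ringCon.mkₐ ℂ
        (sym (linearPoly (c 0) (c 1) (c 2))) := by
    rw [sym_linearPoly, Fin.sum_univ_three, map_add, map_add, map_smul, map_smul, map_smul]
  rw [e, ← map_zero ((limitIdeal (closedIdeal (family ρ k).relators)).ringCon.mkₐ ℂ), mkA_eq_iff,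
    sub_zero] at hc
  have hl := eq_zero_of_sym_mem hs h₀ hc
  intro i
  have := congrArg (MvPolynomial.coeff (Finsupp.single i 1)) hl
  match i with
  | 0 => simpa [linearPoly, MvPolynomial.coeff_X, Finsupp.single_left_inj] using this
  | 1 => simpa [linearPoly, MvPolynomial.coeff_X, Finsupp.single_left_inj] using this
  | 2 => simpa [linearPoly, MvPolynomial.coeff_X, Finsupp.single_left_inj] using this

theorem Constraints.basis (h : Constraints ρ k) :
    Function.Bijective fun g : Poly⟦X⟧ => toQuot (family ρ k).relators (symZ g) := by
  constructor
  · intro g g' hgg'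
    obtain ⟨φ, hs, h₀⟩ := h.exists_faithful
    have hm := toQuot_eq_iff.1 hgg'
    rw [← isZLinear_symZ.map_sub] at hm
    exact sub_eq_zero.1 (eq_zero_of_symZ_mem hs h₀ hm)
  · intro u
    obtain ⟨p, rfl⟩ := toQuot_surjective _ u
    obtain ⟨g, hg⟩ := exists_symZ (isZClosed_closedIdeal _) h.linearLimit.linearCommutators p
    exact ⟨g, (toQuot_eq_iff.2 hg).symm⟩

end

section

/-! ### The odd ansatz -/

/-- A monomial of degree d can occur only in the coefficient of z^(d-1), so f can be read off from
F, and oddness of d is evenness of the order in z. -/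
theorem isOddAnsatz_iff {F : Poly⟦X⟧} : IsOddAnsatz F ↔ ∀ n,
    (PowerSeries.coeff n F).IsHomogeneous (n + 1) ∧ (Odd n → PowerSeries.coeff n F = 0) := by
  constructor
  · rintro ⟨f, hf, h⟩ n
    refine ⟨fun m hm => ?_, fun hn => MvPolynomial.ext _ _ fun m => ?_⟩
    · rw [h] at hm
      change Finsupp.weight (fun _ => 1) m = n + 1
      rw [← Finsupp.degree_eq_weight_one]
      by_contra hne
      exact hm (if_neg hne)
    · rw [h, MvPolynomial.coeff_zero]
      split_ifs with hm
      · exact hf m (hm ▸ hn.add_one)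
      · rfl
  · intro h
    -- For the monomial 1 the subtraction truncates to 0. The coefficient read there vanishes
    -- because the constant coefficient of F is homogeneous of degree 1.
    refine ⟨fun m => MvPolynomial.coeff m (PowerSeries.coeff (m.degree - 1) F), fun m hm => ?_,
      fun n m => ?_⟩
    · change MvPolynomial.coeff m (PowerSeries.coeff (m.degree - 1) F) = 0
      rcases Nat.eq_zero_or_pos m.degree with h0 | hpos
      · exact (h _).1.coeff_eq_zero (by lia)
      · rw [(h _).2 (Nat.Even.sub_odd hpos hm odd_one), MvPolynomial.coeff_zero]
    · split_ifs with hm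
      · change _ = MvPolynomial.coeff m (PowerSeries.coeff (m.degree - 1) F)
        rw [hm, Nat.add_sub_cancel]
      · exact (h n).1.coeff_eq_zero hm

namespace IsOddAnsatz

variable {F G : Poly⟦X⟧}

theorem add (hF : IsOddAnsatz F) (hG : IsOddAnsatz G) : IsOddAnsatz (F + G) := by
  rw [isOddAnsatz_iff] at *
  intro n
  rw [map_add]
  exact ⟨(hF n).1.add (hG n).1, fun hn => by rw [(hF n).2 hn, (hG n).2 hn, add_zero]⟩

theorem smul (hF : IsOddAnsatz F) (c : ℂ) : IsOddAnsatz (c • F) := by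
  rw [isOddAnsatz_iff] at *
  intro n
  rw [PowerSeries.coeff_smul]
  exact ⟨(MvPolynomial.homogeneousSubmodule (Fin 3) ℂ (n + 1)).smul_mem c (hF n).1,
    fun hn => by rw [(hF n).2 hn, smul_zero]⟩

theorem neg (hF : IsOddAnsatz F) : IsOddAnsatz (-F) := by
  rw [← neg_one_smul ℂ]
  exact hF.smul _

theorem sub (hF : IsOddAnsatz F) (hG : IsOddAnsatz G) : IsOddAnsatz (F - G) := by
  rw [sub_eq_add_neg]
  exact hF.add hG.neg

theorem shc (t : ℂ) : IsOddAnsatz (shc t (letter 0)) := by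
  rw [isOddAnsatz_iff]
  intro n
  rw [coeff_shc]
  refine ⟨?_, fun hn => if_neg (Nat.not_even_iff_odd.2 hn)⟩
  split_ifs with hn
  · exact (MvPolynomial.homogeneousSubmodule (Fin 3) ℂ (n + 1)).smul_mem _
      (MvPolynomial.isHomogeneous_X_pow _ _)
  · exact MvPolynomial.isHomogeneous_zero _ _ _

theorem letter (i : Fin 3) : IsOddAnsatz (PowerSeries.C (letter i)) := by
  rw [isOddAnsatz_iff]
  intro n
  rw [PowerSeries.coeff_C]
  refine ⟨?_, fun hn => if_neg ?_⟩
  · split_ifs with hn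
    · rw [hn]
      exact MvPolynomial.isHomogeneous_X _ _
    · exact MvPolynomial.isHomogeneous_zero _ _ _
  · rintro rfl
    exact absurd hn (by decide)

theorem letter_mul_coshZ (i : Fin 3) (t : ℂ) : IsOddAnsatz
    (PowerSeries.C (QuantumAlgebra3D.letter i) * coshZ (t • QuantumAlgebra3D.letter 0)) := by
  rw [isOddAnsatz_iff]
  intro n
  rw [PowerSeries.coeff_C_mul, coshZ, PowerSeries.coeff_mk]
  refine ⟨?_, fun hn => by rw [if_neg (Nat.not_even_iff_odd.2 hn), mul_zero]⟩
  split_ifs with hn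
  · rw [smul_pow, add_comm]
    exact (MvPolynomial.isHomogeneous_X _ _).mul
      ((MvPolynomial.homogeneousSubmodule (Fin 3) ℂ n).smul_mem _
        ((MvPolynomial.homogeneousSubmodule (Fin 3) ℂ n).smul_mem _
          (MvPolynomial.isHomogeneous_X_pow _ _)))
  · rw [mul_zero]
    exact MvPolynomial.isHomogeneous_zero _ _ _

end IsOddAnsatz

theorem Constraints.isQuantization {ρ : ℂ} {k : StructureConstants} (h : Constraints ρ k) :
    IsQuantization ρ k (family ρ k) where
  ansatz_AB := (((IsOddAnsatz.shc _).smul _).add ((IsOddAnsatz.letter _).smul _)).add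
    ((IsOddAnsatz.letter _).smul _)
  ansatz_AC := (((IsOddAnsatz.shc _).smul _).neg.add ((IsOddAnsatz.letter _).smul _)).sub
    ((IsOddAnsatz.letter _).smul _)
  ansatz_BC := (((IsOddAnsatz.shc _).smul _).add ((IsOddAnsatz.letter_mul_coshZ _ _).smul _)).add
    ((IsOddAnsatz.letter_mul_coshZ _ _).smul _)
  limit_AB := h.linearLimit.AB
  limit_AC := h.linearLimit.AC
  limit_BC := h.linearLimit.BC
  classical_limit := h.linearLimit.classical_limit h.linearIndependent
  basis := h.basis
  coproduct := h.coproduct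

/-! ### The listed cases -/

theorem shc_neg {R : Type*} [Ring R] [Algebra ℂ R] (t : ℂ) (x : R) : shc (-t) x = shc t x := by
  ext1 n
  rw [coeff_shc, coeff_shc]
  split_ifs with hn
  · rw [hn.neg_pow]
  · rfl

theorem coshZ_neg (x : Poly) : coshZ (-x) = coshZ x := by
  ext1 n
  rw [coshZ, coshZ, PowerSeries.coeff_mk, PowerSeries.coeff_mk]
  split_ifs with hn
  · rw [hn.neg_pow]
  · rfl

section Cases

variable {ρ : ℂ} {k : StructureConstants}

theorem sinhDivZ_letter : sinhDivZ (letter 0) = shc 1 (letter 0) := sinhDivZ_eq _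

theorem family11_eq (h₂ : k.c₂ ≠ 0) (hc₃ : k.c₃ = 0) (hb₂ : k.b₂ = 0)
    (ha : k.a₁ * k.c₂ = (1 + ρ) * (k.a₂ * k.c₁)) : family11 ρ k = family ρ k := by
  have e : k.a₁ = k.a₂ * k.c₁ / k.c₂ * (1 + ρ) := by
    field_simp
    linear_combination ha
  ext1
  · simp only [family11, family, sinhDivZ_letter, hc₃]
    module
  · simp only [family11, family, sinhDivZ_smul, hb₂]
    module
  · simp only [family11, family, sinhDivZ_smul, one_smul, e, smul_smul]

theorem family12_eq (h₂ : k.c₂ = 0) (hc₃ : k.c₃ = 0) (hb₂ : k.b₂ = 0) (ha : k.a₂ = 0)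
    (hρ : 1 + ρ ≠ 0) : family12 ρ k = family ρ k := by
  ext1
  · simp [family12, family, sinhDivZ_letter, hc₃, h₂]
  · simp [family12, family, hb₂, ha, h₂]
  · simp only [family12, family, sinhDivZ_smul, one_smul, smul_smul, ha, div_mul_cancel₀ _ hρ]
    module

theorem family13_eq (h₂ : k.c₂ = 0) (hc₃ : k.c₃ = 0) (hb₂ : k.b₂ = 0) (hc : k.c₁ = 0)
    (hρ : 1 + ρ ≠ 0) : family13 ρ k = family ρ k := by
  ext1
  · simp [family13, family, hc, hc₃, h₂]
  · simp only [family13, family, sinhDivZ_smul, hb₂, h₂]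
    module
  · simp only [family13, family, sinhDivZ_smul, smul_smul, hc, div_mul_cancel₀ _ hρ]
    module

theorem family21_eq : family21 k = family 1 k := by
  ext1
  · simp only [family21, family, sinhDivZ_letter]
  · simp only [family21, family, sinhDivZ_letter, mul_one, one_mul]
  · simp only [family21, family, sinhDivZ_smul, smul_smul, one_smul, one_mul, add_mul,
      smul_mul_assoc, div_mul_cancel₀ _ (two_ne_zero (α := ℂ)), one_add_one_eq_two, add_assoc]

theorem family31_eq (h₂ : k.c₂ ≠ 0) (hc₃ : k.c₃ = 0) (hb₂ : k.b₂ = 0) (hb₁ : k.b₁ = k.a₂)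
    (ha : k.a₁ * k.c₂ = 0) : family31 k = family (-1) k := by
  have ha₁ : k.a₁ = 0 := (mul_eq_zero.1 ha).resolve_right h₂
  ext1
  · simp only [family31, family, sinhDivZ_letter, hc₃]
    module
  · simp only [family31, family, sinhDivZ_letter, shc_neg, hb₂, hb₁]
    module
  · simp only [family31, family, one_smul, neg_one_smul ℂ (letter 0), coshZ_neg, sub_mul,
      smul_mul_assoc, hb₁, ha₁]
    module

theorem family32_eq (h₂ : k.c₂ = 0) (hc₃ : k.c₃ = 0) (hb₂ : k.b₂ = 0) (hb₁ : k.b₁ = k.a₂) :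
    family32 k = family (-1) k := by
  ext1
  · simp only [family32, family, sinhDivZ_letter, hc₃, h₂]
    module
  · simp only [family32, family, sinhDivZ_letter, shc_neg, hb₂, hb₁, h₂]
    module
  · simp only [family32, family, one_smul, neg_one_smul ℂ (letter 0), coshZ_neg, sub_mul,
      smul_mul_assoc, hb₁, add_neg_cancel, shc_zero]
    module

variable {F : Rules}

theorem cases_generic (h₁ : ρ ≠ 1) (h₂ : ρ ≠ -1) : (ConstraintsGeneric ρ k ∧
    ((k.c₂ ≠ 0 ∧ F = family11 ρ k) ∨ (k.c₂ = 0 ∧ k.a₂ = 0 ∧ F = family12 ρ k) ∨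
      (k.c₂ = 0 ∧ k.a₂ ≠ 0 ∧ k.c₁ = 0 ∧ F = family13 ρ k))) ↔
    Constraints ρ k ∧ F = family ρ k := by
  have hρ : 1 + ρ ≠ 0 := fun h => h₂ (by linear_combination h)
  constructor
  · rintro ⟨⟨hb₂, hc₃, hb₁, ha₃, hb₃, ha⟩, hF⟩
    have ha' : k.a₁ * k.c₂ = (1 + ρ) * (k.a₂ * k.c₁) := by linear_combination -ha
    refine ⟨⟨by rw [hb₁]; ring, ha₃, by rw [hb₃]; ring, Or.inr hb₂, Or.inr hc₃, Or.inr ha'⟩, ?_⟩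
    rcases hF with ⟨h, rfl⟩ | ⟨h, h', rfl⟩ | ⟨h, -, h', rfl⟩
    · exact family11_eq h hc₃ hb₂ ha'
    · exact family12_eq h hc₃ hb₂ h' hρ
    · exact family13_eq h hc₃ hb₂ h' hρ
  · rintro ⟨h, rfl⟩
    have hb₂ := h.b₂.resolve_left h₁
    have hc₃ := h.c₃.resolve_left h₁
    have ha := h.a₁.resolve_left h₁
    refine ⟨⟨hb₂, hc₃, by rw [h.b₁]; ring, h.a₃, by rw [h.b₃]; ring, by linear_combination -ha⟩, ?_⟩
    by_cases hc : k.c₂ = 0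
    -- With c₂ = 0 and 1 + ρ ≠ 0 the last constraint is a₂c₁ = 0, which leaves the second and third
    -- families.
    · rw [hc, mul_zero, zero_eq_mul, or_iff_right hρ] at ha
      by_cases ha₂ : k.a₂ = 0
      · exact Or.inr (Or.inl ⟨hc, ha₂, (family12_eq hc hc₃ hb₂ ha₂ hρ).symm⟩)
      · have hc₁ := (mul_eq_zero.1 ha).resolve_left ha₂
        exact Or.inr (Or.inr ⟨hc, ha₂, hc₁, (family13_eq hc hc₃ hb₂ hc₁ hρ).symm⟩)
    · exact Or.inl ⟨hc, (family11_eq hc hc₃ hb₂ ha).symm⟩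

theorem cases_one : (ConstraintsOne k ∧ F = family21 k) ↔ Constraints 1 k ∧ F = family 1 k := by
  rw [family21_eq]
  refine and_congr_left fun _ => ⟨?_, fun h => ?_⟩
  · rintro ⟨h₁, h₂, h₃⟩
    exact ⟨by rw [h₁, one_mul], by rw [h₂, one_mul], by rw [h₃, one_mul], Or.inl rfl, Or.inl rfl,
      Or.inl rfl⟩
  · exact ⟨by rw [h.b₁, one_mul], by rw [h.a₃, one_mul], by rw [h.b₃, one_mul]⟩

theorem cases_neg_one : (ConstraintsNegOne k ∧
    ((k.c₂ ≠ 0 ∧ F = family31 k) ∨ (k.c₂ = 0 ∧ F = family32 k))) ↔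
    Constraints (-1) k ∧ F = family (-1) k := by
  have h₁ : (-1 : ℂ) ≠ 1 := by norm_num
  constructor
  · rintro ⟨⟨hb₂, hc₃, hb₁, ha₃, hb₃, ha⟩, hF⟩
    refine ⟨⟨by rw [hb₁]; ring, by rw [ha₃]; ring, by rw [hb₃]; ring, Or.inr hb₂, Or.inr hc₃,
      Or.inr (by rw [ha]; ring)⟩, ?_⟩
    rcases hF with ⟨h, rfl⟩ | ⟨h, rfl⟩
    · exact family31_eq h hc₃ hb₂ hb₁ ha
    · exact family32_eq h hc₃ hb₂ hb₁
  · rintro ⟨h, rfl⟩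
    have hb₂ := h.b₂.resolve_left h₁
    have hc₃ := h.c₃.resolve_left h₁
    have hb₁ : k.b₁ = k.a₂ := by rw [h.b₁]; ring
    have ha : k.a₁ * k.c₂ = 0 := by
      rw [h.a₁.resolve_left h₁]
      ring
    refine ⟨⟨hb₂, hc₃, hb₁, by rw [h.a₃]; ring, by rw [h.b₃]; ring, ha⟩, ?_⟩
    by_cases hc : k.c₂ = 0
    · exact Or.inr ⟨hc, (family32_eq hc hc₃ hb₂ hb₁).symm⟩
    · exact Or.inl ⟨hc, (family31_eq hc hc₃ hb₂ hb₁ ha).symm⟩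

end Cases

end

section

/-! ### Normal forms -/

/-- The largest ideal on which a map vanishes. -/
def IsZLinear.largestIdeal {R S : Type*} [Ring R] [Ring S] {f : R⟦X⟧ → S⟦X⟧} (hf : IsZLinear f) :
    TwoSidedIdeal R⟦X⟧ :=
  TwoSidedIdeal.mk' {p | ∀ u v : R⟦X⟧, f (u * p * v) = 0}
    (fun u v => by rw [mul_zero, zero_mul, hf.map_zero])
    (fun hp hq u v => by rw [mul_add, add_mul, hf.add, hp u v, hq u v, add_zero])
    (fun hp u v => by rw [mul_neg, neg_mul, hf.map_neg, hp u v, neg_zero])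
    (fun {x y} hp u v => by rw [← mul_assoc]; exact hp (u * x) v)
    (fun {x y} hp u v => by rw [← mul_assoc, mul_assoc]; exact hp u (y * v))

theorem IsZLinear.mem_largestIdeal {R S : Type*} [Ring R] [Ring S] {f : R⟦X⟧ → S⟦X⟧}
    (hf : IsZLinear f) {p : R⟦X⟧} : p ∈ hf.largestIdeal ↔ ∀ u v : R⟦X⟧, f (u * p * v) = 0 :=
  TwoSidedIdeal.mem_mk' _ _ _ _ _ _ _

section NormalForm

variable {F : Rules} (hb : Function.Bijective fun g : Poly⟦X⟧ => toQuot F.relators (symZ g))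

/-- The coordinates of an element with respect to the symmetrized monomials. -/
def normalForm (p : Free⟦X⟧) : Poly⟦X⟧ := (Equiv.ofBijective _ hb).symm (toQuot F.relators p)

theorem normalForm_eq_iff {p : Free⟦X⟧} {g : Poly⟦X⟧} :
    normalForm hb p = g ↔ p - symZ g ∈ closedIdeal F.relators := by
  rw [normalForm, Equiv.symm_apply_eq, ← toQuot_eq_iff]
  rfl

theorem sub_normalForm_mem (p : Free⟦X⟧) :
    p - symZ (normalForm hb p) ∈ closedIdeal F.relators :=
  (normalForm_eq_iff hb).1 rfl

theorem normalForm_symZ (g : Poly⟦X⟧) : normalForm hb (symZ g) = g := by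
  rw [normalForm_eq_iff, sub_self]
  exact TwoSidedIdeal.zero_mem _

theorem normalForm_eq_zero {p : Free⟦X⟧} (hp : p ∈ closedIdeal F.relators) :
    normalForm hb p = 0 := by
  rwa [normalForm_eq_iff, isZLinear_symZ.map_zero, sub_zero]

theorem isZLinear_normalForm : IsZLinear (normalForm hb) where
  add p q := by
    rw [normalForm_eq_iff, isZLinear_symZ.add, add_sub_add_comm]
    exact TwoSidedIdeal.add_mem _ (sub_normalForm_mem hb p) (sub_normalForm_mem hb q)
  X_mul p := by
    rw [normalForm_eq_iff, isZLinear_symZ.X_mul, ← mul_sub]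
    exact TwoSidedIdeal.mul_mem_left _ _ _ (sub_normalForm_mem hb p)

theorem normalForm_smul (c : ℂ) (p : Free⟦X⟧) : normalForm hb (c • p) = c • normalForm hb p := by
  rw [normalForm_eq_iff, symZ_smul, ← smul_sub]
  exact smul_mem_ideal _ c (sub_normalForm_mem hb p)

/-- The embedding of the left tensor factor. -/
def polyL : Poly →ₐ[ℂ] Poly ⊗[ℂ] Poly := Algebra.TensorProduct.includeLeft

/-- The embedding of the right tensor factor. -/
def polyR : Poly →ₐ[ℂ] Poly ⊗[ℂ] Poly := Algebra.TensorProduct.includeRight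

/-- The tensor square of the normal form, on constants. -/
def normalForm₂C : Free ⊗[ℂ] Free →ₗ[ℂ] (Poly ⊗[ℂ] Poly)⟦X⟧ :=
  TensorProduct.lift (LinearMap.mk₂ ℂ (fun x y =>
      mapHom polyL (normalForm hb (PowerSeries.C x)) *
        mapHom polyR (normalForm hb (PowerSeries.C y)))
    (fun x x' y => by rw [map_add, (isZLinear_normalForm hb).add, map_add, add_mul])
    (fun c x y => by rw [C_smul, normalForm_smul, map_smul, smul_mul_assoc])
    (fun x y y' => by rw [map_add, (isZLinear_normalForm hb).add, map_add, mul_add])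
    (fun c x y => by rw [C_smul, normalForm_smul, map_smul, mul_smul_comm]))

/-- The tensor square of the normal form. -/
def normalForm₂ : (Free ⊗[ℂ] Free)⟦X⟧ → (Poly ⊗[ℂ] Poly)⟦X⟧ :=
  extendZ (coeffMap (normalForm₂C hb))

theorem isZLinear_normalForm₂ : IsZLinear (normalForm₂ hb) := isZLinear_extendZ _

theorem normalForm₂_C_tmul (x y : Free) : normalForm₂ hb (PowerSeries.C (x ⊗ₜ y)) =
    mapHom polyL (normalForm hb (PowerSeries.C x)) *
      mapHom polyR (normalForm hb (PowerSeries.C y)) := by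
  rw [normalForm₂, extendZ_coeffMap_C]
  rfl

theorem inL_mul_inR (x y : Free) : inL x * inR y = x ⊗ₜ y := by
  change (x ⊗ₜ[ℂ] (1 : Free)) * ((1 : Free) ⊗ₜ[ℂ] y) = x ⊗ₜ y
  rw [Algebra.TensorProduct.tmul_mul_tmul, mul_one, one_mul]

theorem normalForm₂_mul (p q : Free⟦X⟧) :
    normalForm₂ hb (mapHom inL p * mapHom inR q) =
      mapHom polyL (normalForm hb p) * mapHom polyR (normalForm hb q) := by
  have hN := isZLinear_normalForm₂ hb
  have h₁ : ∀ (x : Free) (q : Free⟦X⟧), normalForm₂ hb (PowerSeries.C (inL x) * mapHom inR q) =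
      mapHom polyL (normalForm hb (PowerSeries.C x)) * mapHom polyR (normalForm hb q) := by
    intro x
    refine (hN.comp ((isZLinear_mapHom inR).const_mul _)).ext
      (((isZLinear_mapHom polyR).comp (isZLinear_normalForm hb)).const_mul _) fun y => ?_
    rw [mapHom_C, ← map_mul, inL_mul_inR, normalForm₂_C_tmul]
  refine (hN.comp ((isZLinear_mapHom inL).mul_const _)).ext
    (((isZLinear_mapHom polyL).comp (isZLinear_normalForm hb)).mul_const _) (fun x => ?_) p
  rw [mapHom_C]
  exact h₁ x q

/-- The largest ideal on which the normal form vanishes. -/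
def normalFormKer : TwoSidedIdeal (Free ⊗[ℂ] Free)⟦X⟧ := (isZLinear_normalForm₂ hb).largestIdeal

theorem mem_normalFormKer {p : (Free ⊗[ℂ] Free)⟦X⟧} : p ∈ normalFormKer hb ↔
    ∀ u v : (Free ⊗[ℂ] Free)⟦X⟧, normalForm₂ hb (u * p * v) = 0 :=
  (isZLinear_normalForm₂ hb).mem_largestIdeal

/-- Additivity passes from pure tensors to constants, and z-linearity from constants to series, one
outer factor at a time. -/
theorem mem_normalFormKer_of_tmul {p : (Free ⊗[ℂ] Free)⟦X⟧}
    (h : ∀ x y x' y' : Free, normalForm₂ hb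
      (PowerSeries.C (x ⊗ₜ y) * p * PowerSeries.C (x' ⊗ₜ y')) = 0) : p ∈ normalFormKer hb := by
  have hN := isZLinear_normalForm₂ hb
  have h₁ : ∀ (x y : Free) (w : Free ⊗[ℂ] Free), normalForm₂ hb
      (PowerSeries.C (x ⊗ₜ y) * p * PowerSeries.C w) = 0 := by
    intro x y w
    induction w with
    | zero => rw [map_zero, mul_zero, hN.map_zero]
    | tmul x' y' => exact h x y x' y'
    | add a b ha hb' => rw [map_add, mul_add, hN.add, ha, hb', add_zero]
  have h₂ : ∀ v w : Free ⊗[ℂ] Free, normalForm₂ hb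
      (PowerSeries.C v * p * PowerSeries.C w) = 0 := by
    intro v w
    induction v with
    | zero => rw [map_zero, zero_mul, zero_mul, hN.map_zero]
    | tmul x y => exact h₁ x y w
    | add a b ha hb' => rw [map_add, add_mul, add_mul, hN.add, ha, hb', add_zero]
  rw [mem_normalFormKer]
  have h₃ : ∀ (v : Free ⊗[ℂ] Free) (q : (Free ⊗[ℂ] Free)⟦X⟧), normalForm₂ hb
      (PowerSeries.C v * p * q) = 0 := fun v =>
    (hN.comp (IsZLinear.id.const_mul _)).ext IsZLinear.zero (h₂ v)
  intro u v
  simp only [mul_assoc] at h₃ ⊢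
  exact (hN.comp (IsZLinear.id.mul_const (p * v))).ext IsZLinear.zero (fun w => h₃ w v) u

theorem isZClosed_normalFormKer : IsZClosed (normalFormKer hb) := by
  intro p hp
  rw [mem_normalFormKer]
  intro u v
  have hz : IsZLinear fun p => normalForm₂ hb (u * p * v) :=
    (isZLinear_normalForm₂ hb).comp ((IsZLinear.id.const_mul u).mul_const v)
  ext1 n
  obtain ⟨q, hq, h⟩ := hp (n + 1)
  rw [hz.coeff_congr h (Nat.lt_succ_self n), (mem_normalFormKer hb).1 hq, map_zero]

theorem C_tmul_eq (x y : Free) :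
    (PowerSeries.C (x ⊗ₜ[ℂ] y) : (Free ⊗[ℂ] Free)⟦X⟧) =
      mapHom inL (PowerSeries.C x) * mapHom inR (PowerSeries.C y) := by
  rw [mapHom_C, mapHom_C, ← map_mul, inL_mul_inR]

theorem commute_inL_inR (p q : Free⟦X⟧) : Commute (mapHom inL p) (mapHom inR q) :=
  commute_of_coeff fun i j => by
    rw [coeff_mapHom, coeff_mapHom]
    exact commute_includeLeft_includeRight Free _ _

/-- A relation of one tensor factor, multiplied by pure tensors on both sides, is a product of an
element of the ideal in that factor with something in the other, so its normal form is a product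
with a zero factor. This inclusion is all that is used about the completed tensor square; no basis
of it is constructed. -/
theorem normalForm₂_eq_zero {p : (Free ⊗[ℂ] Free)⟦X⟧} (hp : p ∈ closedIdeal F.relators₂) :
    normalForm₂ hb p = 0 := by
  suffices h : p ∈ normalFormKer hb by
    simpa using (mem_normalFormKer hb).1 h 1 1
  refine closedIdeal_le ?_ (isZClosed_normalFormKer hb) hp
  rintro _ (⟨r, hr, rfl⟩ | ⟨r, hr, rfl⟩)
  · refine mem_normalFormKer_of_tmul hb fun x y x' y' => ?_
    have e : PowerSeries.C (x ⊗ₜ[ℂ] y) * mapHom inL r * PowerSeries.C (x' ⊗ₜ[ℂ] y') =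
        mapHom inL (PowerSeries.C x * r * PowerSeries.C x') *
          mapHom inR (PowerSeries.C y * PowerSeries.C y') := by
      rw [C_tmul_eq, C_tmul_eq, map_mul, map_mul, map_mul]
      have c₁ := (commute_inL_inR r (PowerSeries.C y)).eq
      have c₂ := (commute_inL_inR (PowerSeries.C x') (PowerSeries.C y)).eq
      simp only [mul_assoc]
      rw [← mul_assoc (mapHom inR _) (mapHom inL r), ← c₁, mul_assoc,
        ← mul_assoc (mapHom inR (PowerSeries.C y)) (mapHom inL _), ← c₂]
      simp only [mul_assoc]
    refine (congrArg (normalForm₂ hb) e).trans ?_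
    rw [normalForm₂_mul, normalForm_eq_zero hb (TwoSidedIdeal.mul_mem_right _ _ _
      (TwoSidedIdeal.mul_mem_left _ _ _ (subset_closedIdeal _ hr))), map_zero, zero_mul]
  · refine mem_normalFormKer_of_tmul hb fun x y x' y' => ?_
    have e : PowerSeries.C (x ⊗ₜ[ℂ] y) * mapHom inR r * PowerSeries.C (x' ⊗ₜ[ℂ] y') =
        mapHom inL (PowerSeries.C x * PowerSeries.C x') *
          mapHom inR (PowerSeries.C y * r * PowerSeries.C y') := by
      rw [C_tmul_eq, C_tmul_eq, map_mul, map_mul, map_mul]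
      have c₁ := (commute_inL_inR (PowerSeries.C x') r).eq
      have c₂ := (commute_inL_inR (PowerSeries.C x') (PowerSeries.C y)).eq
      simp only [mul_assoc]
      rw [← mul_assoc (mapHom inR r) (mapHom inL _), ← c₁, mul_assoc,
        ← mul_assoc (mapHom inR (PowerSeries.C y)) (mapHom inL _), ← c₂]
      simp only [mul_assoc]
    refine (congrArg (normalForm₂ hb) e).trans ?_
    rw [normalForm₂_mul, normalForm_eq_zero hb (TwoSidedIdeal.mul_mem_right _ _ _
      (TwoSidedIdeal.mul_mem_left _ _ _ (subset_closedIdeal _ hr))), map_zero, mul_zero]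

/-! ### The normal form at `z = 0` -/

/-- The constant term of the normal form. -/
def normalForm₀ : Free →ₗ[ℂ] Poly where
  toFun x := PowerSeries.coeff 0 (normalForm hb (PowerSeries.C x))
  map_add' x y := by rw [map_add, (isZLinear_normalForm hb).add, map_add]
  map_smul' c x := by
    rw [C_smul, normalForm_smul, PowerSeries.coeff_smul]
    rfl

theorem coeff_zero_normalForm (p : Free⟦X⟧) : PowerSeries.coeff 0 (normalForm hb p) =
    normalForm₀ hb (PowerSeries.coeff 0 p) := by
  rw [(isZLinear_normalForm hb).coeff_eq, Finset.Nat.antidiagonal_zero, Finset.sum_singleton]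
  rfl

theorem normalForm₀_eq_zero {x : Free} (hx : x ∈ limitIdeal (closedIdeal F.relators)) :
    normalForm₀ hb x = 0 := by
  obtain ⟨p, hp, rfl⟩ := mem_limitIdeal.1 hx
  rw [← PowerSeries.coeff_zero_eq_constantCoeff_apply, ← coeff_zero_normalForm,
    normalForm_eq_zero hb hp, map_zero]

theorem normalForm₀_sym (g : Poly) : normalForm₀ hb (sym g) = g := by
  change PowerSeries.coeff 0 (normalForm hb (PowerSeries.C (sym g))) = g
  rw [← symZ_C, normalForm_symZ, PowerSeries.coeff_zero_C]

theorem normalForm₀_gen (i : Fin 3) : normalForm₀ hb (gen i) = letter i := by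
  rw [← sym_letter, normalForm₀_sym]

theorem normalForm₀_one : normalForm₀ hb 1 = 1 := by
  rw [← sym_one, normalForm₀_sym]

/-- At z = 0 reordering costs only lower degree, so the normal form of a word has the commutative
monomial as leading term. -/
theorem normalForm₀_word (hl : LinearCommutators (limitIdeal (closedIdeal F.relators)))
    (l : List (Fin 3)) :
    normalForm₀ hb (word l) - (l.map letter).prod ∈ lowerDeg l.length := by
  obtain ⟨g, hg, hm⟩ := hl.word_sub_sym l
  have := normalForm₀_eq_zero hb hm
  rw [map_sub, normalForm₀_sym, sub_eq_zero] at this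
  rw [this, add_sub_cancel_left]
  exact hg

/-- The lowest coefficient of an element of the ideal of relations. -/
theorem normalForm₀_tensor_eq_zero {p q : (Free ⊗[ℂ] Free)⟦X⟧} {n : ℕ}
    (hp : p ∈ closedIdeal F.relators₂) (hq : p = PowerSeries.X ^ n * q) :
    TensorProduct.map (normalForm₀ hb) (normalForm₀ hb) (PowerSeries.coeff 0 q) = 0 := by
  have hN := isZLinear_normalForm₂ hb
  have h₂ : normalForm₂ hb q = 0 := by
    have := normalForm₂_eq_zero hb hp
    rw [hq, hN.X_pow_mul] at this
    ext1 m
    have := congrArg (PowerSeries.coeff (m + n)) this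
    rwa [PowerSeries.coeff_X_pow_mul, map_zero] at this
  have h₃ : ∀ w : Free ⊗[ℂ] Free, PowerSeries.coeff 0 (normalForm₂ hb (PowerSeries.C w)) =
      TensorProduct.map (normalForm₀ hb) (normalForm₀ hb) w := by
    intro w
    induction w with
    | zero => rw [map_zero, hN.map_zero, map_zero, map_zero]
    | tmul x y =>
      rw [normalForm₂_C_tmul, PowerSeries.coeff_mul, Finset.Nat.antidiagonal_zero,
        Finset.sum_singleton, coeff_mapHom, coeff_mapHom, TensorProduct.map_tmul]
      change (_ ⊗ₜ[ℂ] (1 : Poly)) * ((1 : Poly) ⊗ₜ[ℂ] _) = _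
      rw [Algebra.TensorProduct.tmul_mul_tmul, mul_one, one_mul]
      rfl
    | add a b ha hb' => rw [map_add, hN.add, map_add, ha, hb', map_add]
  rw [← h₃]
  have := congrArg (PowerSeries.coeff 0) h₂
  rwa [hN.coeff_eq, Finset.Nat.antidiagonal_zero, Finset.sum_singleton] at this

end NormalForm

end

section

/-! ### The coproduct of the relations for general rules -/

/-- The failure of `Sym P` to be twisted primitive. -/
def defect (s ρ : ℂ) (P : Poly⟦X⟧) : (Free ⊗[ℂ] Free)⟦X⟧ :=
  expZ (s • genL 0) * mapHom inR (symZ P) + mapHom inL (symZ P) * expZ (-(s • genR 0)) -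
    coprodZ ρ (symZ P)

theorem isZLinear_defect (s ρ : ℂ) : IsZLinear (defect s ρ) :=
  ((((isZLinear_mapHom inR).comp isZLinear_symZ).const_mul _).add_fun
    (((isZLinear_mapHom inL).comp isZLinear_symZ).mul_const _)).sub_fun
    ((isZLinear_extendZ _).comp isZLinear_symZ)

theorem mapHom_relator (φ : Free →ₐ[ℂ] Free ⊗[ℂ] Free) (i j : Fin 3) (P : Poly⟦X⟧) :
    mapHom φ (relator i j P) =
      PowerSeries.C (φ (gen i) * φ (gen j) - φ (gen j) * φ (gen i)) - mapHom φ (symZ P) := by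
  rw [relator, map_sub, mapHom_C, map_sub, map_mul, map_mul]

theorem coprodZ_relator (ρ : ℂ) (i j : Fin 3) (P : Poly⟦X⟧) :
    coprodZ ρ (relator i j P) = coprod ρ (gen i) * coprod ρ (gen j) -
      coprod ρ (gen j) * coprod ρ (gen i) - coprodZ ρ (symZ P) := by
  rw [coprodZ_eq_extHom, coprodZ_eq_extHom, relator, map_sub, extHom_C, map_sub, map_mul, map_mul]

theorem rearrange {S : Type*} [Ring S] (e e' x y x' y' d : S) :
    e * x + y * e' - d = e * (x - x') + (y - y') * e' + (e * x' + y' * e' - d) := by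
  noncomm_ring

/-- The first two summands lie in the ideal of relations. Compatibility of Δ with this relation is
thus the condition that the defect lies there, and the defect is linear in the rule. -/
theorem coprodZ_relator_zero {s ρ : ℂ} {i : Fin 3}
    (h : coprod ρ (gen i) = twist s (genL 0) (genR i) (genL i) (genR 0)) (P : Poly⟦X⟧) :
    coprodZ ρ (relator 0 i P) = expZ (s • genL 0) * mapHom inR (relator 0 i P) +
      mapHom inL (relator 0 i P) * expZ (-(s • genR 0)) + defect s ρ P := by
  rw [coprodZ_relator, coprod_gen_zero, h, commutator_twist commute_genL_genR, mapHom_relator,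
    mapHom_relator, defect]
  exact rearrange _ _ _ _ _ _ _

/-- The part of `[Δ(B), Δ(C)]` that is not twisted primitive. -/
def crossTerm (ρ : ℂ) : (Free ⊗[ℂ] Free)⟦X⟧ :=
  (expZ (genL 0) * PowerSeries.C (genL 2 * genR 1) * expZ (-(ρ • genR 0)) -
    expZ (-(ρ • genR 0)) * PowerSeries.C (genL 2 * genR 1) * expZ (genL 0)) -
  (expZ (ρ • genL 0) * PowerSeries.C (genL 1 * genR 2) * expZ (-(genR 0)) -
    expZ (-(genR 0)) * PowerSeries.C (genL 1 * genR 2) * expZ (ρ • genL 0))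

theorem rearrange' {S : Type*} [Ring S] (e e' x y x' y' d t : S) :
    e * x + y * e' + t - d = e * (x - x') + (y - y') * e' + (e * x' + y' * e' - d + t) := by
  noncomm_ring

theorem coprodZ_relator_one (ρ : ℂ) (P : Poly⟦X⟧) :
    coprodZ ρ (relator 1 2 P) = expZ ((1 + ρ) • genL 0) * mapHom inR (relator 1 2 P) +
      mapHom inL (relator 1 2 P) * expZ (-((1 + ρ) • genR 0)) +
      (defect (1 + ρ) ρ P + crossTerm ρ) := by
  rw [coprodZ_relator, coprod_gen_one, coprod_gen_two, twist_commutator commute_genL_genR,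
    mapHom_relator, mapHom_relator, defect]
  exact rearrange' _ _ _ _ _ _ _ _

/-- By `expZ_conj` each mixed term is z times a symmetrized commutator, whose value at z = 0 is the
commutator of the difference of exponents with C ⊗ B or B ⊗ C. -/
theorem exists_crossTerm (ρ : ℂ) : ∃ q, crossTerm ρ = PowerSeries.X * q ∧
    PowerSeries.coeff 0 q = (gen 0 * gen 2 - gen 2 * gen 0) ⊗ₜ[ℂ] gen 1 +
      ρ • (gen 2 ⊗ₜ[ℂ] (gen 0 * gen 1 - gen 1 * gen 0)) -
      (ρ • ((gen 0 * gen 1 - gen 1 * gen 0) ⊗ₜ[ℂ] gen 2) +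
        gen 1 ⊗ₜ[ℂ] (gen 0 * gen 2 - gen 2 * gen 0)) := by
  have x₁ := expZ_conj ((commute_genL_genR 0 0).smul_right ρ).neg_right
    (PowerSeries.C (genL 2 * genR 1))
  have x₂ := expZ_conj ((commute_genL_genR 0 0).smul_left ρ).neg_right
    (PowerSeries.C (genL 1 * genR 2))
  have h₀ : ∀ (x y w : Free ⊗[ℂ] Free), PowerSeries.coeff 0
      (expZ y * symE x (PowerSeries.C x * PowerSeries.C w - PowerSeries.C w * PowerSeries.C x) *
        expZ y) = x * w - w * x := by
    intro x y w
    have he : PowerSeries.coeff 0 (expZ y) = 1 := by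
      rw [PowerSeries.coeff_zero_eq_constantCoeff_apply, constantCoeff_expZ]
    rw [PowerSeries.coeff_mul, Finset.Nat.antidiagonal_zero, Finset.sum_singleton,
      PowerSeries.coeff_mul, Finset.Nat.antidiagonal_zero, Finset.sum_singleton, he, one_mul,
      mul_one, coeff_zero_symE, ← map_mul, ← map_mul, ← map_sub, PowerSeries.coeff_zero_C]
  refine ⟨_, (congrArg₂ (fun a b => a - b) x₁ x₂).trans (mul_sub _ _ _).symm, ?_⟩
  rw [map_sub, h₀, h₀]
  simp only [genL, genR, sub_neg_eq_add, add_mul, mul_add, smul_mul_assoc, mul_smul_comm,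
    Algebra.TensorProduct.tmul_mul_tmul, one_mul, mul_one, TensorProduct.sub_tmul,
    TensorProduct.tmul_sub]
  module

/-! ### The first order -/

theorem coeff_zero_expZ_mul {R : Type*} [Ring R] [Algebra ℂ R] (s : ℂ) (a d : R) (x y : R⟦X⟧) :
    PowerSeries.coeff 0 (expZ (s • a) * x + y * expZ (-(s • d))) =
      PowerSeries.coeff 0 x + PowerSeries.coeff 0 y := by
  have he : ∀ x : R, PowerSeries.coeff 0 (expZ x) = 1 := fun x => by simp [coeff_expZ]
  rw [map_add, PowerSeries.coeff_mul, PowerSeries.coeff_mul, Finset.Nat.antidiagonal_zero,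
    Finset.sum_singleton, Finset.sum_singleton, he, he, one_mul, mul_one]

theorem coeff_one_expZ_mul {R : Type*} [Ring R] [Algebra ℂ R] (s : ℂ) (a d : R) (x y : R⟦X⟧) :
    PowerSeries.coeff 1 (expZ (s • a) * x + y * expZ (-(s • d))) =
      PowerSeries.coeff 1 x + PowerSeries.coeff 1 y +
        s • (a * PowerSeries.coeff 0 x - PowerSeries.coeff 0 y * d) := by
  have he : ∀ x : R, PowerSeries.coeff 0 (expZ x) = 1 := fun x => by simp [coeff_expZ]
  have he' : ∀ x : R, PowerSeries.coeff 1 (expZ x) = x := fun x => by simp [coeff_expZ]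
  have a₁ : Finset.HasAntidiagonal.antidiagonal 1 = {((0 : ℕ), (1 : ℕ)), (1, 0)} := by decide
  rw [map_add, PowerSeries.coeff_mul, PowerSeries.coeff_mul, a₁, Finset.sum_pair (by decide),
    Finset.sum_pair (by decide), he, he, he', he', one_mul, mul_one, smul_mul_assoc, mul_neg,
    mul_smul_comm]
  module

/-- At order z the twist contributes s A ∧ X for every letter X, and the coproduct contributes the
cocommutator of X. The defect compares the two. -/
theorem coeff_one_defect {s ρ : ℂ} {P : Poly⟦X⟧} {r u t : ℂ}
    (h₀ : PowerSeries.coeff 0 P = linearPoly r u t) (h₁ : PowerSeries.coeff 1 P = 0) :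
    PowerSeries.coeff 0 (defect s ρ P) = 0 ∧ PowerSeries.coeff 1 (defect s ρ P) =
      ((s - 1) * u) • wedge 0 1 + ((s - ρ) * t) • wedge 0 2 := by
  have hs₀ : PowerSeries.coeff 0 (symZ P) = r • gen 0 + u • gen 1 + t • gen 2 := by
    rw [coeff_symZ, h₀, sym_linearPoly]
  have hs₁ : PowerSeries.coeff 1 (symZ P) = 0 := by rw [coeff_symZ, h₁, map_zero]
  have hc : ∀ i, coprodCoeff ρ 0 (gen i) = genR i + genL i ∧
      coprodCoeff ρ 1 (gen i) = cocommutator ρ i := fun i => coeff_coprod_gen ρ i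
  have hL : ∀ i, inL (gen i) = gen i ⊗ₜ 1 := fun i => rfl
  have hR : ∀ i, inR (gen i) = 1 ⊗ₜ gen i := fun i => rfl
  have k₀ : cocommutator ρ 0 = 0 := rfl
  have k₁ : cocommutator ρ 1 = wedge 0 1 := rfl
  have k₂ : cocommutator ρ 2 = ρ • wedge 0 2 := rfl
  have a₁ : Finset.HasAntidiagonal.antidiagonal 1 = {((0 : ℕ), (1 : ℕ)), (1, 0)} := by decide
  have hz₀ : PowerSeries.coeff 0 (coprodZ ρ (symZ P)) =
      coprodCoeff ρ 0 (r • gen 0 + u • gen 1 + t • gen 2) := by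
    rw [coprodZ, coeff_extendZ, Finset.Nat.antidiagonal_zero, Finset.sum_singleton, hs₀]
  have hz₁ : PowerSeries.coeff 1 (coprodZ ρ (symZ P)) =
      coprodCoeff ρ 1 (r • gen 0 + u • gen 1 + t • gen 2) := by
    rw [coprodZ, coeff_extendZ, a₁, Finset.sum_pair (by decide), hs₀, hs₁, map_zero, add_zero]
  constructor
  · rw [defect, map_sub, hz₀, coeff_zero_expZ_mul, coeff_mapHom, coeff_mapHom, hs₀]
    simp only [map_add, map_smul, hc, inL_gen, inR_gen]
    module
  · rw [defect, map_sub, hz₁, coeff_one_expZ_mul, coeff_mapHom, coeff_mapHom, coeff_mapHom,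
      coeff_mapHom, hs₀, hs₁]
    simp only [map_zero, map_add, map_smul, hc, hL, hR, genL, genR, k₀, k₁, k₂,
      wedge, mul_add, add_mul, smul_mul_assoc, mul_smul_comm,
      Algebra.TensorProduct.tmul_mul_tmul, one_mul, mul_one]
    module

/-- The coefficient of a letter. -/
def letterCoeff (i : Fin 3) : Poly →ₗ[ℂ] ℂ := MvPolynomial.lcoeff ℂ (Finsupp.single i 1)

theorem letterCoeff_letter (i j : Fin 3) :
    letterCoeff i (letter j) = if j = i then 1 else 0 := by
  simp [letterCoeff, MvPolynomial.lcoeff_apply, MvPolynomial.coeff_X, Finsupp.single_left_inj]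

/-- The coefficient of `X_i ⊗ X_j`. -/
def letterCoeff₂ (i j : Fin 3) : Poly ⊗[ℂ] Poly →ₗ[ℂ] ℂ :=
  LinearMap.mul' ℂ ℂ ∘ₗ TensorProduct.map (letterCoeff i) (letterCoeff j)

theorem letterCoeff₂_tmul (i j : Fin 3) (p q : Poly) :
    letterCoeff₂ i j (p ⊗ₜ q) = letterCoeff i p * letterCoeff j q := by
  simp [letterCoeff₂]

/-! ### Necessity of the constraints. -/

section Necessity

variable {ρ : ℂ} {k : StructureConstants} {F : Rules}

theorem IsOddAnsatz.coeff_one {P : Poly⟦X⟧} (h : IsOddAnsatz P) : PowerSeries.coeff 1 P = 0 :=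
  (isOddAnsatz_iff.1 h 1).2 odd_one

theorem IsQuantization.linearLimit (h : IsQuantization ρ k F) : F.LinearLimit k :=
  ⟨h.limit_AB, h.limit_AC, h.limit_BC⟩

theorem IsQuantization.coprodZ_mem (h : IsQuantization ρ k F) {p : Free⟦X⟧}
    (hp : p ∈ F.relators) : coprodZ ρ p ∈ closedIdeal F.relators₂ := by
  obtain ⟨Δ, hΔ⟩ := h.coproduct
  rw [← toQuot_eq_zero, ← hΔ, toQuot_eq_zero.2 (subset_closedIdeal _ hp), map_zero]

theorem mem_of_sum_mem {S : Type*} [Ring S] (I : TwoSidedIdeal S) {e e' x y d c : S}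
    (hx : x ∈ I) (hy : y ∈ I) (hc : c ∈ I) (h : c = e * x + y * e' + d) : d ∈ I := by
  have : d = c - (e * x + y * e') := by rw [h, add_sub_cancel_left]
  rw [this]
  exact I.sub_mem hc (I.add_mem (I.mul_mem_left _ _ hx) (I.mul_mem_right _ _ hy))

theorem IsQuantization.defect_AB (h : IsQuantization ρ k F) :
    defect 1 ρ F.AB ∈ closedIdeal F.relators₂ :=
  mem_of_sum_mem _ (F.mapHom_inR_mem F.relator_AB_mem) (F.mapHom_inL_mem F.relator_AB_mem)
    (h.coprodZ_mem F.relator_AB_mem) (coprodZ_relator_zero (coprod_gen_one ρ) F.AB)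

theorem IsQuantization.defect_AC (h : IsQuantization ρ k F) :
    defect ρ ρ F.AC ∈ closedIdeal F.relators₂ :=
  mem_of_sum_mem _ (F.mapHom_inR_mem F.relator_AC_mem) (F.mapHom_inL_mem F.relator_AC_mem)
    (h.coprodZ_mem F.relator_AC_mem) (coprodZ_relator_zero (coprod_gen_two ρ) F.AC)

theorem IsQuantization.defect_BC (h : IsQuantization ρ k F) :
    defect (1 + ρ) ρ F.BC + crossTerm ρ ∈ closedIdeal F.relators₂ :=
  mem_of_sum_mem _ (F.mapHom_inR_mem F.relator_BC_mem) (F.mapHom_inL_mem F.relator_BC_mem)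
    (h.coprodZ_mem F.relator_BC_mem) (coprodZ_relator_one ρ F.BC)

theorem eq_X_mul_of_coeff_zero {R : Type*} [Ring R] {p : R⟦X⟧} (h : PowerSeries.coeff 0 p = 0) :
    ∃ q, p = PowerSeries.X * q ∧ PowerSeries.coeff 0 q = PowerSeries.coeff 1 p := by
  obtain ⟨q, hq⟩ := eq_C_add_X_mul p
  rw [← PowerSeries.coeff_zero_eq_constantCoeff_apply, h, map_zero, zero_add] at hq
  exact ⟨q, hq, by rw [hq, ← PowerSeries.coeff_succ_X_mul]⟩

/-- The defect is divisible by z, and the leading term of the quotient must vanish in normal form.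
The two equations are its coefficients at A ⊗ B and A ⊗ C. -/
theorem IsQuantization.normalForm₀_defect (h : IsQuantization ρ k F) {s : ℂ} {P : Poly⟦X⟧}
    {r u t : ℂ} (hP : IsOddAnsatz P) (h₀ : PowerSeries.coeff 0 P = linearPoly r u t)
    (hd : defect s ρ P ∈ closedIdeal F.relators₂) :
    (s - 1) * u = 0 ∧ (s - ρ) * t = 0 := by
  obtain ⟨d₀, d₁⟩ := coeff_one_defect (s := s) (ρ := ρ) h₀ hP.coeff_one
  obtain ⟨q, hq, e⟩ := eq_X_mul_of_coeff_zero d₀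
  rw [← pow_one PowerSeries.X] at hq
  have := normalForm₀_tensor_eq_zero h.basis hd hq
  rw [e, d₁] at this
  have h₁ := congrArg (letterCoeff₂ 0 1) this
  have h₂ := congrArg (letterCoeff₂ 0 2) this
  simp only [wedge, map_add, map_sub, map_smul, TensorProduct.map_tmul, normalForm₀_gen,
    letterCoeff₂_tmul, letterCoeff_letter, map_zero] at h₁ h₂
  simp at h₁ h₂
  exact ⟨by simpa using h₁, by simpa using h₂⟩

/-- These are the coefficients at A ⊗ B, A ⊗ C and B ⊗ C of the terms of order z in the third
relation: the compatibility of cocommutator and bracket in a Lie bialgebra. -/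
theorem IsQuantization.normalForm₀_BC (h : IsQuantization ρ k F) :
    ρ * k.a₂ + k.b₁ = 0 ∧ k.a₃ - ρ * k.c₁ = 0 ∧ k.b₃ + ρ * k.c₂ = 0 := by
  obtain ⟨d₀, d₁⟩ := coeff_one_defect (s := 1 + ρ) (ρ := ρ) h.limit_BC h.ansatz_BC.coeff_one
  obtain ⟨q, hq, e⟩ := eq_X_mul_of_coeff_zero d₀
  obtain ⟨q', hq', e'⟩ := exists_crossTerm ρ
  have hs : defect (1 + ρ) ρ F.BC + crossTerm ρ = PowerSeries.X ^ 1 * (q + q') := by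
    rw [hq, hq', pow_one, mul_add]
  have := normalForm₀_tensor_eq_zero h.basis h.defect_BC hs
  have hAB := normalForm₀_eq_zero h.basis
    (sub_sym_mem_limitIdeal (subset_closedIdeal _ F.relator_AB_mem) h.limit_AB)
  have hAC := normalForm₀_eq_zero h.basis
    (sub_sym_mem_limitIdeal (subset_closedIdeal _ F.relator_AC_mem) h.limit_AC)
  rw [map_sub, sub_eq_zero] at hAB hAC
  rw [map_add, e, d₁, e'] at this
  have h₁ := congrArg (letterCoeff₂ 0 1) this
  have h₂ := congrArg (letterCoeff₂ 0 2) this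
  have h₃ := congrArg (letterCoeff₂ 1 2) this
  simp only [wedge, map_add, map_sub, map_smul, TensorProduct.map_tmul, hAB, hAC, normalForm₀_gen,
    letterCoeff₂_tmul, letterCoeff_letter, map_zero] at h₁ h₂ h₃
  simp at h₁ h₂ h₃
  refine ⟨?_, ?_, ?_⟩
  · linear_combination h₁
  · linear_combination h₂
  · linear_combination -h₃

/-- This is the A-component of the Jacobi identity in L. It supplies the constraint on a₁ that the
first order of the coproduct does not give. -/
theorem IsQuantization.jacobi (h : IsQuantization ρ k F) :
    k.a₂ * k.c₁ + k.a₃ * k.b₁ = (k.c₂ + k.b₃) * k.a₁ := by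
  obtain ⟨L, _, _, e, h₁, h₂, h₃, -⟩ := h.classical_limit
  have h₁' : ⁅e 1, e 0⁆ = -(k.c₁ • e 0 + k.c₂ • e 1 + k.c₃ • e 2) := by rw [← h₁, lie_skew]
  have hj := leibniz_lie (e 0) (e 1) (e 2)
  rw [h₁, h₂, h₃] at hj
  simp only [lie_add, add_lie, lie_smul, smul_lie, lie_self, h₁, h₁', h₂, h₃] at hj
  have := congrArg (e.coord 0) hj
  simp only [map_add, map_smul, map_neg, map_zero, Module.Basis.coord_apply,
    Module.Basis.repr_self] at this
  simp at this
  linear_combination this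

theorem IsQuantization.constraints (h : IsQuantization ρ k F) : Constraints ρ k := by
  obtain ⟨h₁, h₂, h₃⟩ := h.normalForm₀_BC
  obtain ⟨-, hc⟩ := h.normalForm₀_defect h.ansatz_AB h.limit_AB h.defect_AB
  obtain ⟨hb, -⟩ := h.normalForm₀_defect h.ansatz_AC h.limit_AC h.defect_AC
  have hj := h.jacobi
  refine ⟨by linear_combination h₁, by linear_combination h₂, by linear_combination h₃, ?_, ?_, ?_⟩
  · exact (mul_eq_zero.1 hb).imp_left sub_eq_zero.1
  · exact (mul_eq_zero.1 hc).imp_left fun e => (sub_eq_zero.1 e).symm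
  -- After the other constraints are inserted, the Jacobi identity carries a factor ρ - 1. That is
  -- why a₁ is unconstrained for ρ = 1.
  · have : (ρ - 1) * (k.a₁ * k.c₂ - (1 + ρ) * (k.a₂ * k.c₁)) = 0 := by
      have e₁ : k.b₁ = -(ρ * k.a₂) := by linear_combination h₁
      have e₂ : k.a₃ = ρ * k.c₁ := by linear_combination h₂
      have e₃ : k.b₃ = -(ρ * k.c₂) := by linear_combination h₃
      rw [e₁, e₂, e₃] at hj
      linear_combination hj
    exact (mul_eq_zero.1 this).imp sub_eq_zero.1 sub_eq_zero.1

end Necessity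

end

section

/-! ### Uniqueness -/

/-- The noncommutative polynomials that are homogeneous of degree `n`. -/
def words (n : ℕ) : Submodule ℂ Free :=
  Submodule.span ℂ {x | ∃ l : List (Fin 3), l.length = n ∧ x = word l}

theorem symWord_mem_words (l : List (Fin 3)) : symWord l ∈ words l.length := by
  refine Submodule.smul_mem _ _ (Submodule.sum_mem _ fun p _ => Submodule.subset_span
    ⟨List.ofFn fun i => l.get (p i), List.length_ofFn, ?_⟩)
  rw [word, List.map_ofFn]
  rfl

theorem sym_mem_words {d : Poly} {n : ℕ} (hd : d.IsHomogeneous n) : sym d ∈ words n := by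
  rw [d.as_sum, map_sum]
  refine Submodule.sum_mem _ fun m hm => ?_
  obtain ⟨l, hl, e⟩ := monomial_eq_prod_letter m
  have hn : m.degree = n := by
    by_contra hne
    exact MvPolynomial.mem_support_iff.1 hm (hd.coeff_eq_zero hne)
  rw [← mul_one (MvPolynomial.coeff m d), ← smul_eq_mul, ← MvPolynomial.smul_monomial, e, map_smul,
    sym_prod_letter, ← hn, ← hl]
  exact Submodule.smul_mem _ _ (symWord_mem_words l)

/-- The elements of the tensor square of the free algebra that are homogeneous of degree `n`. -/
def words₂ (n : ℕ) : Submodule ℂ (Free ⊗[ℂ] Free) :=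
  Submodule.span ℂ {w | ∃ l l' : List (Fin 3), l.length + l'.length = n ∧ w = word l ⊗ₜ word l'}

theorem tmul_mem_words₂ {l l' : List (Fin 3)} {n : ℕ} (h : l.length + l'.length = n) :
    word l ⊗ₜ word l' ∈ words₂ n := Submodule.subset_span ⟨l, l', h, rfl⟩

theorem gen_mul_mem_words₂ (i : Fin 3) {n : ℕ} {w : Free ⊗[ℂ] Free} (hw : w ∈ words₂ n) :
    (genL i + genR i) * w ∈ words₂ (n + 1) := by
  induction hw using Submodule.span_induction with
  | mem w hw =>
    obtain ⟨l, l', h, rfl⟩ := hw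
    rw [add_mul, genL, genR, Algebra.TensorProduct.tmul_mul_tmul,
      Algebra.TensorProduct.tmul_mul_tmul, one_mul, one_mul, ← word_cons, ← word_cons]
    exact Submodule.add_mem _ (tmul_mem_words₂ (by rw [List.length_cons]; lia))
      (tmul_mem_words₂ (by rw [List.length_cons]; lia))
  | zero => rw [mul_zero]; exact Submodule.zero_mem _
  | add x y _ _ hx hy => rw [mul_add]; exact Submodule.add_mem _ hx hy
  | smul c x _ hx => rw [mul_smul_comm]; exact Submodule.smul_mem _ _ hx

theorem coprodCoeff_zero_one (ρ : ℂ) : coprodCoeff ρ 0 1 = 1 := by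
  change PowerSeries.coeff 0 (coprod ρ 1) = 1
  rw [map_one, PowerSeries.coeff_zero_one]

theorem coprodCoeff_zero_gen_mul (ρ : ℂ) (i : Fin 3) (x : Free) :
    coprodCoeff ρ 0 (gen i * x) = (genL i + genR i) * coprodCoeff ρ 0 x := by
  change PowerSeries.coeff 0 (coprod ρ (gen i * x)) = _
  rw [map_mul, PowerSeries.coeff_mul, Finset.Nat.antidiagonal_zero, Finset.sum_singleton,
    (coeff_coprod_gen ρ i).1, add_comm]
  rfl

theorem coprodCoeff_zero_word_mem (ρ : ℂ) (l : List (Fin 3)) :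
    coprodCoeff ρ 0 (word l) ∈ words₂ l.length := by
  induction l with
  | nil =>
    rw [word_nil, coprodCoeff_zero_one]
    exact tmul_mem_words₂ (l := []) (l' := []) rfl
  | cons i l ih =>
    rw [word_cons, coprodCoeff_zero_gen_mul]
    exact gen_mul_mem_words₂ i ih

/-- Multiplication of the two tensor factors as commutative polynomials. -/
def abel₂ : Free ⊗[ℂ] Free →ₐ[ℂ] Poly := Algebra.TensorProduct.productMap abel abel

theorem abel₂_tmul (x y : Free) : abel₂ (x ⊗ₜ y) = abel x * abel y :=
  Algebra.TensorProduct.productMap_apply_tmul _ _ _ _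

theorem abel₂_coprodCoeff_zero_word (ρ : ℂ) (l : List (Fin 3)) :
    abel₂ (coprodCoeff ρ 0 (word l)) = (2 : ℂ) ^ l.length • (l.map letter).prod := by
  induction l with
  | nil => simp [coprodCoeff_zero_one]
  | cons i l ih =>
    have e : abel₂ (genL i + genR i) = (2 : ℂ) • letter i := by
      rw [map_add, genL, genR, abel₂_tmul, abel₂_tmul, map_one, mul_one, one_mul, abel_gen,
        two_smul]
    rw [word_cons, coprodCoeff_zero_gen_mul, map_mul, ih, e, smul_mul_smul_comm, List.map_cons,
      List.prod_cons, List.length_cons, pow_succ']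

section

variable {F : Rules} (hb : Function.Bijective fun g : Poly⟦X⟧ => toQuot F.relators (symZ g))

/-- The product of the normal forms of the two tensor factors. -/
def mulNormalForm₀ : Free ⊗[ℂ] Free →ₗ[ℂ] Poly :=
  LinearMap.mul' ℂ Poly ∘ₗ TensorProduct.map (normalForm₀ hb) (normalForm₀ hb)

theorem mulNormalForm₀_tmul (x y : Free) :
    mulNormalForm₀ hb (x ⊗ₜ y) = normalForm₀ hb x * normalForm₀ hb y := by
  simp [mulNormalForm₀]

/-- Up to lower degree the normal form at z = 0 is abelianization, and so is its tensor square
followed by multiplication. -/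
theorem mulNormalForm₀_sub_mem (hl : LinearCommutators (limitIdeal (closedIdeal F.relators)))
    {n : ℕ} {w : Free ⊗[ℂ] Free} (hw : w ∈ words₂ n) :
    mulNormalForm₀ hb w - abel₂ w ∈ lowerDeg n := by
  induction hw using Submodule.span_induction with
  | mem w hw =>
    obtain ⟨l, l', h, rfl⟩ := hw
    have h₁ := normalForm₀_word hb hl l
    have h₂ := normalForm₀_word hb hl l'
    have h₃ : normalForm₀ hb (word l) ∈ lowerDeg (l.length + 1) := by
      rw [← sub_add_cancel (normalForm₀ hb (word l)) (l.map letter).prod]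
      exact Submodule.add_mem _ (lowerDeg_mono (Nat.le_succ _) h₁) (prod_letter_mem_lowerDeg l)
    rw [mulNormalForm₀_tmul, abel₂_tmul, abel_word, abel_word, ← h]
    have e : normalForm₀ hb (word l) * normalForm₀ hb (word l') -
        (l.map letter).prod * (l'.map letter).prod =
        normalForm₀ hb (word l) * (normalForm₀ hb (word l') - (l'.map letter).prod) +
          (l'.map letter).prod * (normalForm₀ hb (word l) - (l.map letter).prod) := by ring
    rw [e]
    refine Submodule.add_mem _ (mul_mem_lowerDeg h₃ h₂) ?_
    rw [add_comm]
    exact mul_mem_lowerDeg (prod_letter_mem_lowerDeg l') h₁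
  | zero => rw [map_zero, map_zero, sub_zero]; exact Submodule.zero_mem _
  | add x y _ _ hx hy =>
    rw [map_add, map_add, add_sub_add_comm]
    exact Submodule.add_mem _ hx hy
  | smul c x _ hx => rw [map_smul, map_smul, ← smul_sub]; exact Submodule.smul_mem _ _ hx

/-- At z = 0 each letter is primitive and becomes twice itself when the tensor factors are
multiplied. A word of length n therefore acquires the factor 2^n. -/
theorem mulNormalForm₀_coprodCoeff_sub_mem
    (hl : LinearCommutators (limitIdeal (closedIdeal F.relators))) (ρ : ℂ) {n : ℕ} {x : Free}
    (hx : x ∈ words n) :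
    mulNormalForm₀ hb (coprodCoeff ρ 0 x) - (2 : ℂ) ^ n • abel x ∈ lowerDeg n := by
  induction hx using Submodule.span_induction with
  | mem x hx =>
    obtain ⟨l, rfl, rfl⟩ := hx
    rw [abel_word, ← abel₂_coprodCoeff_zero_word ρ]
    exact mulNormalForm₀_sub_mem hb hl (coprodCoeff_zero_word_mem ρ l)
  | zero => rw [map_zero, map_zero, map_zero, smul_zero, sub_zero]; exact Submodule.zero_mem _
  | add x y _ _ hx hy =>
    rw [map_add, map_add, map_add, smul_add, add_sub_add_comm]
    exact Submodule.add_mem _ hx hy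
  | smul c x _ hx =>
    rw [map_smul, map_smul, map_smul, smul_comm, ← smul_sub]
    exact Submodule.smul_mem _ _ hx

theorem coeff_zero_defect (s ρ : ℂ) (P : Poly⟦X⟧) : PowerSeries.coeff 0 (defect s ρ P) =
    inR (sym (PowerSeries.coeff 0 P)) + inL (sym (PowerSeries.coeff 0 P)) -
      coprodCoeff ρ 0 (sym (PowerSeries.coeff 0 P)) := by
  rw [defect, map_sub, coeff_zero_expZ_mul, coeff_mapHom, coeff_mapHom, coeff_symZ, coprodZ,
    coeff_extendZ, Finset.Nat.antidiagonal_zero, Finset.sum_singleton, coeff_symZ]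

theorem mulNormalForm₀_inL_sym (d : Poly) : mulNormalForm₀ hb (inL (sym d)) = d := by
  change mulNormalForm₀ hb (sym d ⊗ₜ 1) = d
  rw [mulNormalForm₀_tmul, normalForm₀_sym, normalForm₀_one, mul_one]

theorem mulNormalForm₀_inR_sym (d : Poly) : mulNormalForm₀ hb (inR (sym d)) = d := by
  change mulNormalForm₀ hb (1 ⊗ₜ sym d) = d
  rw [mulNormalForm₀_tmul, normalForm₀_sym, normalForm₀_one, one_mul]

end

theorem eq_zero_of_mem_lowerDeg {d : Poly} {n : ℕ} (hd : d.IsHomogeneous n)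
    (h : d ∈ lowerDeg n) : d = 0 := by
  ext m
  rw [MvPolynomial.coeff_zero]
  rcases eq_or_ne m.degree n with e | e
  · exact h m e.ge
  · exact hd.coeff_eq_zero e

section

variable {ρ : ℂ} {k : StructureConstants} {F : Rules}

/-- Let d be the first coefficient of P not yet known to vanish, homogeneous of degree n + 1. The
leading term of the defect is 1 ⊗ d + d ⊗ 1 - Δ₀(d), symmetrized. Multiplying the factors of its
normal form gives (2 - 2^(n+1)) d up to lower degree, and homogeneity then forces d = 0. -/
theorem IsQuantization.eq_zero_of_defect (h : IsQuantization ρ k F) {s : ℂ} {P : Poly⟦X⟧}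
    (hP : IsOddAnsatz P) (h₀ : PowerSeries.coeff 0 P = 0)
    (hd : defect s ρ P ∈ closedIdeal F.relators₂) : P = 0 := by
  ext1 n
  rw [map_zero]
  induction n using Nat.strong_induction_on with
  | _ n ih =>
  rcases Nat.eq_zero_or_pos n with rfl | hn
  · exact h₀
  obtain ⟨Q, hQ⟩ := PowerSeries.X_pow_dvd_iff.2 ih
  have hQ₀ : PowerSeries.coeff 0 Q = PowerSeries.coeff n P := by
    have := PowerSeries.coeff_X_pow_mul Q n 0
    rwa [zero_add, ← hQ, eq_comm] at this
  have hz := normalForm₀_tensor_eq_zero h.basis hd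
    ((congrArg _ hQ).trans ((isZLinear_defect s ρ).X_pow_mul n Q))
  have hm : mulNormalForm₀ h.basis (PowerSeries.coeff 0 (defect s ρ Q)) = 0 := by
    rw [mulNormalForm₀, LinearMap.comp_apply, hz, map_zero]
  have hh := (isOddAnsatz_iff.1 hP n).1
  rw [coeff_zero_defect, hQ₀, map_sub, map_add, mulNormalForm₀_inL_sym, mulNormalForm₀_inR_sym,
    sub_eq_zero] at hm
  have hc := mulNormalForm₀_coprodCoeff_sub_mem h.basis h.linearLimit.linearCommutators ρ
    (sym_mem_words hh)
  rw [← hm, abel_sym, ← two_smul ℂ, ← sub_smul] at hc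
  -- This needs n ≥ 1. Linear terms are primitive and are fixed by the prescribed limit instead.
  have h2 : (2 : ℂ) - 2 ^ (n + 1) ≠ 0 := by
    rw [sub_ne_zero]
    have : 2 ≠ 2 ^ (n + 1) := by
      have := Nat.one_lt_two_pow (n := n) (by lia)
      rw [pow_succ]
      lia
    exact_mod_cast this
  exact eq_zero_of_mem_lowerDeg hh ((Submodule.smul_mem_iff _ h2).1 hc)

theorem eq_zero_of_eq_add {S : Type*} [AddGroup S] {a x d : S} (h₁ : a = x) (h₂ : a = x + d) :
    d = 0 := by
  rw [h₁] at h₂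
  exact left_eq_add.1 h₂

theorem defect_family_AB (h : ρ = 1 ∨ k.c₃ = 0) : defect 1 ρ (family ρ k).AB = 0 := by
  have := coprodZ_relator_AB (ρ := ρ) (k := k) h
  rw [← one_smul ℂ (genL 0), ← one_smul ℂ (genR 0)] at this
  exact eq_zero_of_eq_add this (coprodZ_relator_zero (coprod_gen_one ρ) _)

theorem defect_family_AC (h : ρ = 1 ∨ k.b₂ = 0) : defect ρ ρ (family ρ k).AC = 0 :=
  eq_zero_of_eq_add (coprodZ_relator_AC h) (coprodZ_relator_zero (coprod_gen_two ρ) _)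

theorem defect_family_BC (h : ρ = 1 ∨ k.b₂ = 0 ∧ k.c₃ = 0) (hAB : F.AB = (family ρ k).AB)
    (hAC : F.AC = (family ρ k).AC) :
    defect (1 + ρ) ρ (family ρ k).BC + crossTerm ρ ∈ closedIdeal F.relators₂ := by
  have := coprodZ_relator_BC_sub_mem h hAB hAC
  rwa [coprodZ_relator_one, add_sub_cancel_left] at this

theorem IsQuantization.eq_family (h : IsQuantization ρ k F) : F = family ρ k := by
  have hc := h.constraints
  have hq := hc.isQuantization
  have key : ∀ {s : ℂ} {P Q : Poly⟦X⟧}, IsOddAnsatz P → IsOddAnsatz Q →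
      PowerSeries.coeff 0 P = PowerSeries.coeff 0 Q →
      defect s ρ P - defect s ρ Q ∈ closedIdeal F.relators₂ → P = Q := by
    intro s P Q hP hQ h₀ hd
    rw [← (isZLinear_defect s ρ).map_sub] at hd
    exact sub_eq_zero.1 (h.eq_zero_of_defect (hP.sub hQ) (by rw [map_sub, h₀, sub_self]) hd)
  have hAB : F.AB = (family ρ k).AB := key h.ansatz_AB hq.ansatz_AB
    (h.limit_AB.trans hq.limit_AB.symm) <| by
      rw [defect_family_AB hc.c₃, sub_zero]
      exact h.defect_AB
  have hAC : F.AC = (family ρ k).AC := key h.ansatz_AC hq.ansatz_AC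
    (h.limit_AC.trans hq.limit_AC.symm) <| by
      rw [defect_family_AC hc.b₂, sub_zero]
      exact h.defect_AC
  -- The third rule comes last, since the family satisfies its condition only modulo the first two
  -- relations of `F`. The mixed terms do not involve the third rule and cancel in the difference.
  have hBC := TwoSidedIdeal.sub_mem _ h.defect_BC
    (defect_family_BC (by rcases hc.b₂ with e | e <;> rcases hc.c₃ with e' | e' <;> tauto) hAB hAC)
  rw [add_sub_add_right_eq_sub] at hBC
  exact Rules.ext hAB hAC
    (key h.ansatz_BC hq.ansatz_BC (h.limit_BC.trans hq.limit_BC.symm) hBC)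

theorem isQuantization_iff : IsQuantization ρ k F ↔ Constraints ρ k ∧ F = family ρ k :=
  ⟨fun h => ⟨h.constraints, h.eq_family⟩, fun ⟨h, e⟩ => e ▸ h.isQuantization⟩

end

end

end

end QuantumAlgebra3D

open QuantumAlgebra3D in
theorem mainTheorem1 (ρ : ℂ) :
    -- the coproduct is coassociative, invariant under the flip with `z ↦ -z`,
    -- and its first order is given by the cocommutator
    (IsCoassociative ρ ∧
      (∀ x : Free, flipNeg (coprod ρ x) = coprod ρ x) ∧
      (∀ i : Fin 3, PowerSeries.coeff 0 (coprod ρ (gen i)) = 1 ⊗ₜ gen i + gen i ⊗ₜ 1 ∧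
        PowerSeries.coeff 1 (coprod ρ (gen i)) = cocommutator ρ i)) ∧
    -- the compatible deformed commutation rules are exactly the listed families
    ∀ (k : StructureConstants) (F : Rules),
      (ρ ≠ 1 → ρ ≠ -1 →
        (IsQuantization ρ k F ↔ ConstraintsGeneric ρ k ∧
          ((k.c₂ ≠ 0 ∧ F = family11 ρ k) ∨
            (k.c₂ = 0 ∧ k.a₂ = 0 ∧ F = family12 ρ k) ∨
            (k.c₂ = 0 ∧ k.a₂ ≠ 0 ∧ k.c₁ = 0 ∧ F = family13 ρ k)))) ∧
      (ρ = 1 → (IsQuantization ρ k F ↔ ConstraintsOne k ∧ F = family21 k)) ∧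
      (ρ = -1 → (IsQuantization ρ k F ↔ ConstraintsNegOne k ∧
        ((k.c₂ ≠ 0 ∧ F = family31 k) ∨ (k.c₂ = 0 ∧ F = family32 k)))) := by
  refine ⟨⟨isCoassociative ρ, flipNeg_coprod ρ, coeff_coprod_gen ρ⟩, fun k F => ⟨fun h₁ h₂ =>
    isQuantization_iff.trans (cases_generic h₁ h₂).symm, ?_, ?_⟩⟩
  · rintro rfl
    exact isQuantization_iff.trans cases_one.symm
  · rintro rfl
    exact isQuantization_iff.trans cases_neg_one.symm
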